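/- Let $d,m\ge 1$ and $0\le q<p$ be integers, let $A_1,\dots,A_p\in\mathbb R^{d\times d}$, $B_0,\dots,B_q\in\mathbb R^{d\times m}$, and put $$A(\lambda)=I_d\lambda^p+A_1\lambda^{p-1}+\dots+A_p,\qquad B(\lambda)=B_0\lambda^q+\dots+B_q,\qquad F(\lambda)=A(\lambda)^{-1}B(\lambda),$$ and $\sigma(A(\cdot))=\{\lambda\in\mathbb C:\det A(\lambda)=0\}$. Assume: (i) $F$ is irreducible, i.e. every common left divisor of the polynomial matrices $A(\lambda)$ and $B(\lambda)$ is unimodular. (ii) $A(\lambda)$ has a complete set of regular right solvents $R_1,\dots,R_p\in\mathbb C^{d\times d}$: for every $k$, $R_k^p+A_1R_k^{p-1}+\dots+A_p=0$, and $\sigma(R_k)\cap\sigma(A^{(1)}_k(\cdot))=\emptyset$, where $A^{(1)}_k$ is the monic matrix polynomial of degree $p-1$ with $A(\lambda)=A^{(1)}_k(\lambda)(\lambda I_d-R_k)$; and $\sigma(A(\cdot))=\bigcup_{k=1}^p\sigma(R_k)$. Let $\operatorname{res}[F,R_k]=\frac1{2\pi i}\oint_{\Gamma_k}F(\lambda)\,d\lambda$,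 where $\Gamma_k$ is any positively oriented piecewise $C^1$ simple closed contour with $\sigma(R_k)$ in its interior and $\sigma(A(\cdot))\setminus\sigma(R_k)$ in its exterior. Let $L=(L(t))_{t\in\mathbb R}$ be a two-sided $\mathbb R^m$-valued Lévy process ($L(0)=0$ a.s., stationary and independent increments, càdlàg paths). Integrals $\int_s^t g(u)\,dL(u)$ of continuous deterministic matrix-valued functions $g$ are limits in probability of Riemann–Stieltjes sums as the mesh tends to $0$, and $\int_{-\infty}^t g(u)\,dL(u)$ is the limit in probability of $\int_s^t g(u)\,dL(u)$ as $s\to-\infty$. Suppose that $\sigma(A(\cdot))\subset\{z\in\mathbb C:\operatorname{Re} z<0\}$ and $\mathbb E[\log\max(1,\|L(1)\|)]<\infty$. Then for $k=1,\dots,p$ the $\mathbb C^d$-valued Ornstein–Uhlenbeck processes $$Y_k(t)=\int_{-\infty}^t e^{R_k(t-u)}\operatorname{res}[F,R_k]\,dL(u),\qquad t\in\mathbb R,$$ are well defined, have càdlàg versions, and are strictly stationary. Taking càdlàg versions, $$Y(t)=\sum_{k=1}^pY_k(t)=\int_{-\infty}^t\sum_{k=1}^pe^{R_k(t-u)}\operatorname{res}[F,R_k]\,dL(u),\qquad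 t\in\mathbb R,$$ is almost surely $\mathbb R^d$-valued for all $t$, is strictly stationary, and is a solution of the state space model: there is a strictly stationary càdlàg $\mathbb R^{pd}$-valued process $X$ with, almost surely for all real $t$ (and all $s\le t$), $$Y(t)=C^*X(t),\qquad X(t)=X(s)+\int_s^tA^*X(u)\,du+B^*(L(t)-L(s)).$$ Here $$A^*=\begin{pmatrix}0&I_d&&\\&\ddots&\ddots&\\&&0&I_d\\-A_p&-A_{p-1}&\cdots&-A_1\end{pmatrix}\in\mathbb R^{pd\times pd},\qquad C^*=(I_d,0,\dots,0)\in\mathbb R^{d\times pd},$$ and $B^*=(\beta_1^{\mathsf T},\dots,\beta_p^{\mathsf T})^{\mathsf T}\in\mathbb R^{pd\times m}$ with $\beta_r=0$ for $r<p-q$ and $\beta_{p-j}=-\sum_{i=1}^{p-j-1}A_i\beta_{p-j-i}+B_{q-j}$ for $j=0,\dots,q$. Hence $Y$ is a stationary MCARMA$(p,q)$ process, that is, a process $Y=C^*X$ for a solution $X$ of this state equation. -/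

import Mathlib

open MeasureTheory ProbabilityTheory Filter Topology

noncomputable section

namespace MCARMA

/-! ### Matrix polynomials

The coefficients of the autoregressive polynomial are `A 1, …, A p` and those of the moving average
polynomial are `B 0, …, B q`; all other values of the sequences `A` and `B` are ignored. -/

/-- A real matrix seen as a complex matrix. -/
def toComplex {m n : Type*} (M : Matrix m n ℝ) : Matrix m n ℂ :=
  M.map Complex.ofReal

/-- `A(λ) = I λ ^ p + A_1 λ ^ (p - 1) + … + A_p`, as a matrix of polynomials. -/
def arPoly {d : ℕ} (p : ℕ) (A : ℕ → Matrix (Fin d) (Fin d) ℝ) :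
    Matrix (Fin d) (Fin d) (Polynomial ℂ) :=
  (Polynomial.X ^ p : Polynomial ℂ) • (1 : Matrix (Fin d) (Fin d) (Polynomial ℂ)) +
    ∑ i ∈ Finset.Icc 1 p,
      (Polynomial.X ^ (p - i) : Polynomial ℂ) • (toComplex (A i)).map Polynomial.C

/-- `B(λ) = B_0 λ ^ q + … + B_{q-1} λ + B_q`, as a matrix of polynomials. -/
def maPoly {d m : ℕ} (q : ℕ) (B : ℕ → Matrix (Fin d) (Fin m) ℝ) :
    Matrix (Fin d) (Fin m) (Polynomial ℂ) :=
  ∑ j ∈ Finset.range (q + 1),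
    (Polynomial.X ^ (q - j) : Polynomial ℂ) • (toComplex (B j)).map Polynomial.C

/-- The value of a matrix polynomial at a complex number. -/
def evalAt {m n : Type*} (P : Matrix m n (Polynomial ℂ)) (z : ℂ) : Matrix m n ℂ :=
  P.map (Polynomial.eval z)

/-- `σ(P(·)) = {z | det P(z) = 0}`. -/
def polySpectrum {d : ℕ} (P : Matrix (Fin d) (Fin d) (Polynomial ℂ)) : Set ℂ :=
  {z | (evalAt P z).det = 0}

/-- Left coprimeness: every common left divisor is unimodular. -/
def LeftCoprime {d m : ℕ} (P : Matrix (Fin d) (Fin d) (Polynomial ℂ))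
    (Q : Matrix (Fin d) (Fin m) (Polynomial ℂ)) : Prop :=
  ∀ (D P' : Matrix (Fin d) (Fin d) (Polynomial ℂ)) (Q' : Matrix (Fin d) (Fin m) (Polynomial ℂ)),
    P = D * P' → Q = D * Q' → IsUnit D

/-- `R` is a right solvent: `R ^ p + A_1 R ^ (p - 1) + … + A_p = 0`. -/
def IsRightSolvent {d : ℕ} (p : ℕ) (A : ℕ → Matrix (Fin d) (Fin d) ℝ)
    (R : Matrix (Fin d) (Fin d) ℂ) : Prop :=
  R ^ p + ∑ i ∈ Finset.Icc 1 p, toComplex (A i) * R ^ (p - i) = 0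

/-- A right solvent `R` is regular if `σ(R)` is disjoint from the spectrum of the quotient `Q` in
`A(λ) = Q(λ) (λ I - R)`. The quotient is unique, and it is monic of degree `p - 1`.
(`R.charmatrix` is the matrix polynomial `λ I - R`.) -/
def IsRegularRightSolvent {d : ℕ} (p : ℕ) (A : ℕ → Matrix (Fin d) (Fin d) ℝ)
    (R : Matrix (Fin d) (Fin d) ℂ) : Prop :=
  IsRightSolvent p A R ∧
    ∃ Q : Matrix (Fin d) (Fin d) (Polynomial ℂ),
      arPoly p A = Q * R.charmatrix ∧ Disjoint (spectrum ℂ R) (polySpectrum Q)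

/-- `R_1, …, R_p` is a complete set of regular right solvents of `A(λ)`. -/
def IsCompleteRegularSolvents {d : ℕ} (p : ℕ) (A : ℕ → Matrix (Fin d) (Fin d) ℝ)
    (R : Fin p → Matrix (Fin d) (Fin d) ℂ) : Prop :=
  (∀ k, IsRegularRightSolvent p A (R k)) ∧ polySpectrum (arPoly p A) = ⋃ k, spectrum ℂ (R k)

/-- `F(λ) = A(λ)⁻¹ B(λ)`. -/
def transferFun {d m : ℕ} (p q : ℕ) (A : ℕ → Matrix (Fin d) (Fin d) ℝ)
    (B : ℕ → Matrix (Fin d) (Fin m) ℝ) (z : ℂ) : Matrix (Fin d) (Fin m) ℂ :=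
  (evalAt (arPoly p A) z)⁻¹ * evalAt (maPoly q B) z

/-! ### Contours and residues -/

/-- The contour integral of `f` along a curve parametrised by `[0, 1]`. -/
def contourIntegral (γ : ℝ → ℂ) (f : ℂ → ℂ) : ℂ :=
  ∫ s in (0 : ℝ)..1, f (γ s) * deriv γ s

/-- The winding number of a closed curve around `z`. -/
def windingNumber (γ : ℝ → ℂ) (z : ℂ) : ℂ :=
  (2 * Real.pi * Complex.I)⁻¹ * contourIntegral γ (fun w => (w - z)⁻¹)

/-- A simple closed contour: a closed, piecewise continuously differentiable curve on `[0, 1]`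
without self-intersections. -/
structure IsSimpleClosedContour (γ : ℝ → ℂ) : Prop where
  closed : γ 0 = γ 1
  simple : Set.InjOn γ (Set.Ico 0 1)
  piecewise_smooth : ∃ (n : ℕ) (τ : ℕ → ℝ), τ 0 = 0 ∧ τ n = 1 ∧
    ∀ i < n, τ i < τ (i + 1) ∧ ContDiffOn ℝ 1 γ (Set.Icc (τ i) (τ (i + 1)))

/-- `γ` is a positively oriented simple closed contour with `σ(R)` in its interior (winding number
`1`) and `σ(A(·)) \ σ(R)` in its exterior (winding number `0`); in particular it does not meet
`σ(A(·))`. -/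
structure IsResidueContour {d : ℕ} (p : ℕ) (A : ℕ → Matrix (Fin d) (Fin d) ℝ)
    (R : Matrix (Fin d) (Fin d) ℂ) (γ : ℝ → ℂ) : Prop where
  contour : IsSimpleClosedContour γ
  avoids_interior_set : ∀ s ∈ Set.Icc (0 : ℝ) 1, γ s ∉ spectrum ℂ R
  avoids_exterior_set : ∀ s ∈ Set.Icc (0 : ℝ) 1, γ s ∉ polySpectrum (arPoly p A) \ spectrum ℂ R
  interior : ∀ z ∈ spectrum ℂ R, windingNumber γ z = 1
  exterior : ∀ z ∈ polySpectrum (arPoly p A) \ spectrum ℂ R, windingNumber γ z = 0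

/-- `(1 / 2πi) ∮_γ F(λ) dλ`, entry by entry. For a contour `γ` with `IsResidueContour p A R γ` this
is the residue `res[F, R]`. -/
def contourResidue {d m : ℕ} (γ : ℝ → ℂ) (F : ℂ → Matrix (Fin d) (Fin m) ℂ) :
    Matrix (Fin d) (Fin m) ℂ :=
  Matrix.of fun a b => (2 * Real.pi * Complex.I)⁻¹ * contourIntegral γ (fun z => F z a b)

/-! ### Processes -/

/-- Càdlàg functions on the real line. -/
def IsCadlag {E : Type*} [TopologicalSpace E] (x : ℝ → E) : Prop :=
  ∀ t, ContinuousWithinAt x (Set.Ici t) t ∧ ∃ l, Tendsto x (𝓝[<] t) (𝓝 l)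

/-- Strict stationarity: the finite-dimensional distributions are invariant under time shifts. -/
def IsStrictlyStationary {Ω E : Type*} [MeasurableSpace Ω] [MeasurableSpace E]
    (Z : ℝ → Ω → E) (μ : Measure Ω) : Prop :=
  ∀ (n : ℕ) (t : Fin n → ℝ) (h : ℝ),
    IdentDistrib (fun ω i => Z (t i + h) ω) (fun ω i => Z (t i) ω) μ μ

/-- A two-sided Lévy process `(L(t))_{t ∈ ℝ}` with values in `ℝ ^ m`. -/
structure IsLevyProcess {Ω : Type*} [MeasurableSpace Ω] {m : ℕ}
    (L : ℝ → Ω → (Fin m → ℝ)) (μ : Measure Ω) : Prop where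
  measurable : ∀ t, Measurable (L t)
  zero : ∀ᵐ ω ∂μ, L 0 ω = 0
  indep_increments : HasIndepIncrements L μ
  stationary_increments : ∀ s t h : ℝ, s ≤ t →
    IdentDistrib (fun ω => L (t + h) ω - L (s + h) ω) (fun ω => L t ω - L s ω) μ μ
  cadlag : ∀ᵐ ω ∂μ, IsCadlag (fun t => L t ω)

/-! ### Integration of continuous deterministic matrix functions with respect to a process -/

/-- `s = τ_0 ≤ ξ_0 ≤ τ_1 ≤ … ≤ ξ_{n-1} ≤ τ_n = t` is a tagged partition of `[s, t]` of mesh smaller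
than `δ`. -/
def IsTaggedPartition (s t δ : ℝ) (n : ℕ) (τ ξ : ℕ → ℝ) : Prop :=
  τ 0 = s ∧ τ n = t ∧ ∀ i < n, τ i ≤ ξ i ∧ ξ i ≤ τ (i + 1) ∧ τ (i + 1) - τ i < δ

/-- The Riemann–Stieltjes sum `∑ i, g(ξ_i) (L(τ_{i+1}) - L(τ_i))`. -/
def stieltjesSum {Ω : Type*} {d m : ℕ} (g : ℝ → Matrix (Fin d) (Fin m) ℂ)
    (L : ℝ → Ω → (Fin m → ℝ)) (n : ℕ) (τ ξ : ℕ → ℝ) (ω : Ω) : Fin d → ℂ :=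
  ∑ i ∈ Finset.range n,
    (g (ξ i)).mulVec (fun b => ((L (τ (i + 1)) ω b - L (τ i) ω b : ℝ) : ℂ))

/-- `I` is (a version of) the stochastic integral `∫_s^t g(u) dL(u)` over `(s, t]` of a continuous
function `g`: the limit in probability of the Riemann–Stieltjes sums as the mesh tends to zero. -/
def HasLevyIntegral {Ω : Type*} [MeasurableSpace Ω] {d m : ℕ} (μ : Measure Ω)
    (L : ℝ → Ω → (Fin m → ℝ)) (g : ℝ → Matrix (Fin d) (Fin m) ℂ) (s t : ℝ)
    (I : Ω → (Fin d → ℂ)) : Prop :=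
  ∀ ε > (0 : ℝ), ∀ η > (0 : ℝ), ∃ δ > (0 : ℝ), ∀ (n : ℕ) (τ ξ : ℕ → ℝ),
    IsTaggedPartition s t δ n τ ξ →
      μ {ω | ε ≤ ‖stieltjesSum g L n τ ξ ω - I ω‖} ≤ ENNReal.ofReal η

/-- `I` is (a version of) `∫_{-∞}^t g(u) dL(u)`, the limit in probability of `∫_s^t g(u) dL(u)` as
`s → -∞`. -/
def HasLevyIntegralFromBot {Ω : Type*} [MeasurableSpace Ω] {d m : ℕ} (μ : Measure Ω)
    (L : ℝ → Ω → (Fin m → ℝ)) (g : ℝ → Matrix (Fin d) (Fin m) ℂ) (t : ℝ)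
    (I : Ω → (Fin d → ℂ)) : Prop :=
  ∃ J : ℝ → Ω → (Fin d → ℂ),
    (∀ s ≤ t, HasLevyIntegral μ L g s t (J s)) ∧ TendstoInMeasure μ J atBot I

/-! ### The state space model -/

/-- The block companion matrix `A^*`; rows and columns are indexed by (block, position in block). -/
def stateA {d : ℕ} (p : ℕ) (A : ℕ → Matrix (Fin d) (Fin d) ℝ) :
    Matrix (Fin p × Fin d) (Fin p × Fin d) ℝ :=
  Matrix.of fun x y =>
    if (x.1 : ℕ) + 1 = p then -(A (p - y.1)) x.2 y.2
    else if (y.1 : ℕ) = x.1 + 1 ∧ x.2 = y.2 then 1 else 0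

/-- `β_r = 0` for `r < p - q` and `β_r = -∑_{i=1}^{r-1} A_i β_{r-i} + B_{r+q-p}` for
`p - q ≤ r ≤ p`. -/
def stateBeta {d m : ℕ} (p q : ℕ) (A : ℕ → Matrix (Fin d) (Fin d) ℝ)
    (B : ℕ → Matrix (Fin d) (Fin m) ℝ) (r : ℕ) : Matrix (Fin d) (Fin m) ℝ :=
  if r < p - q then 0
  else -(∑ i : Fin (r - 1), A (i + 1) * stateBeta p q A B (r - (i + 1))) + B (r + q - p)
termination_by r
decreasing_by omega

/-- `B^*`, the blocks `β_1, …, β_p` on top of each other. -/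
def stateB {d m : ℕ} (p q : ℕ) (A : ℕ → Matrix (Fin d) (Fin d) ℝ)
    (B : ℕ → Matrix (Fin d) (Fin m) ℝ) : Matrix (Fin p × Fin d) (Fin m) ℝ :=
  Matrix.of fun x b => stateBeta p q A B (x.1 + 1) x.2 b

/-- `C^* = (I, 0, …, 0)`. -/
def stateC (d p : ℕ) : Matrix (Fin d) (Fin p × Fin d) ℝ :=
  Matrix.of fun a y => if (y.1 : ℕ) = 0 ∧ a = y.2 then 1 else 0

/-- `(X, Y)` solves `Y(t) = C^* X(t)`, `dX(t) = A^* X(t) dt + B^* dL(t)` on the real line. -/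
structure IsStateSpaceSolution {Ω : Type*} [MeasurableSpace Ω] {d m : ℕ} (μ : Measure Ω)
    (p q : ℕ) (A : ℕ → Matrix (Fin d) (Fin d) ℝ) (B : ℕ → Matrix (Fin d) (Fin m) ℝ)
    (L : ℝ → Ω → (Fin m → ℝ)) (X : ℝ → Ω → (Fin p × Fin d → ℝ)) (Y : ℝ → Ω → (Fin d → ℝ)) :
    Prop where
  aemeasurable : ∀ t, AEMeasurable (X t) μ
  cadlag : ∀ᵐ ω ∂μ, IsCadlag (fun t => X t ω)
  state_eq : ∀ᵐ ω ∂μ, ∀ s t : ℝ, s ≤ t →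
    X t ω = X s ω + (∫ u in s..t, (stateA p A).mulVec (X u ω)) +
      (stateB p q A B).mulVec (L t ω - L s ω)
  output_eq : ∀ᵐ ω ∂μ, ∀ t, Y t ω = (stateC d p).mulVec (X t ω)

/-- `Y` is an MCARMA(`p`, `q`) process driven by `L`. -/
def IsMCARMA {Ω : Type*} [MeasurableSpace Ω] {d m : ℕ} (μ : Measure Ω)
    (p q : ℕ) (A : ℕ → Matrix (Fin d) (Fin d) ℝ) (B : ℕ → Matrix (Fin d) (Fin m) ℝ)
    (L : ℝ → Ω → (Fin m → ℝ)) (Y : ℝ → Ω → (Fin d → ℝ)) : Prop :=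
  ∃ X : ℝ → Ω → (Fin p × Fin d → ℝ), IsStateSpaceSolution μ p q A B L X Y

/-- The kernel `u ↦ e^{R (t - u)} M`. -/
def ouKernel {d m : ℕ} (R : Matrix (Fin d) (Fin d) ℂ) (M : Matrix (Fin d) (Fin m) ℂ) (t u : ℝ) :
    Matrix (Fin d) (Fin m) ℂ :=
  NormedSpace.exp (((t - u : ℝ) : ℂ) • R) * M

end MCARMA

end

/-! The algebra is a partial fraction decomposition; the probability is carried out path by path.

Regularity makes the eigenvalues of each `R k` occur in `det A(λ)` with exactly their own
multiplicity. A degree count then forces the spectra of the solvents to be disjoint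
(`disjoint_spectrum`), so the block Vandermonde matrix of the `R k` is invertible
(`vandermonde_injective`). Hence there are `N k` with `∑ R_k^b N_k = β_{b+1}` for `b < p`, and the
recursion for `β` gives `A(λ)⁻¹ B(λ) = ∑ (λ I - R_k)⁻¹ N_k` (`transferFun_eq_sum`). Over `Γ k` only
the `k`-th resolvent contributes, so the residues are the `N k` and satisfy the moment equations
(`sum_pow_mul_contourResidue`). Contour integrals of resolvents are reduced to winding numbers by
partial fractions and Cayley–Hamilton (`IsSimpleClosedContour.contourIntegral_resolvent`).

Integration by parts turns `∫ e^{R(t-u)} N dL(u)` into the pathwise expression `N L(t) + R ∫_{-∞}^t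
e^{R(t-u)} N L(u) du` (`ouPath`). It makes sense almost surely: stability gives exponential decay of
the kernel (`exists_norm_exp_le`), while the logarithmic moment, through Ottaviani's inequality and
Borel–Cantelli, keeps `L` below any given exponential rate at `-∞` (`IsLevyProcess.ae_isBigO`). The
pathwise expression is càdlàg, represents the integral in probability and solves the
Ornstein–Uhlenbeck equation (`ouPath_eq`). Integrals in probability are almost surely unique, so
every càdlàg version agrees with it at all times. Joint stationarity passes to the limit from
Riemann sums (`IsLevyProcess.isStrictlyStationary_ouPath`).

The state has the blocks `Re ∑ R_k^j Y_k`. By the solvent equation `A^*` acts on it as `R_k` acts on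
each `Y_k`, and by the moment equations the `N_k` are sent to `B^*`; the Ornstein–Uhlenbeck
equations thus combine into the state equation (`blockState_ouPath_eq`). All moments `∑ R_k^b N_k`
are real, hence so are the summed kernel and `∑ Y_k`. -/

namespace MCARMA

/-! ### Determinant of the autoregressive polynomial and disjointness of the solvent spectra. -/

open Polynomial in
/-- The top coefficient of the determinant of a matrix of polynomials of degree at most `p`. -/
lemma coeff_det_of_natDegree_le {d p : ℕ} (P : Matrix (Fin d) (Fin d) ℂ[X])
    (hP : ∀ i j, (P i j).natDegree ≤ p) :
    P.det.coeff (d * p) = (P.map (fun f => f.coeff p)).det := by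
  rw [Matrix.det_apply, Matrix.det_apply, Polynomial.finsetSum_coeff]
  refine Finset.sum_congr rfl fun σ _ => ?_
  rw [Polynomial.coeff_smul]
  congr 1
  have h := Polynomial.coeff_prod_of_natDegree_le (s := Finset.univ)
    (fun i => P (σ i) i) p (fun i _ => hP _ _)
  simpa using h

lemma eval_det_eq {d : ℕ} (P : Matrix (Fin d) (Fin d) (Polynomial ℂ)) (z : ℂ) :
    P.det.eval z = (evalAt P z).det :=
  (Polynomial.evalRingHom z).map_det P

lemma arPoly_apply {d : ℕ} (p : ℕ) (A : ℕ → Matrix (Fin d) (Fin d) ℝ) (i j : Fin d) :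
    arPoly p A i j = Polynomial.X ^ p * (1 : Matrix (Fin d) (Fin d) (Polynomial ℂ)) i j +
      ∑ k ∈ Finset.Icc 1 p, Polynomial.X ^ (p - k) * Polynomial.C (toComplex (A k) i j) := by
  simp [arPoly, Matrix.sum_apply]

lemma natDegree_arPoly_le {d : ℕ} (p : ℕ) (A : ℕ → Matrix (Fin d) (Fin d) ℝ) (i j : Fin d) :
    (arPoly p A i j).natDegree ≤ p := by
  rw [arPoly_apply]
  refine Polynomial.natDegree_add_le_of_degree_le ?_ ?_
  · by_cases h : i = j
    · subst h; simp
    · simp [Matrix.one_apply_ne h]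
  · refine Polynomial.natDegree_sum_le_of_forall_le _ _ fun k _ => ?_
    refine (Polynomial.natDegree_mul_C_le _ _).trans ?_
    simp

lemma coeff_arPoly {d : ℕ} (p : ℕ) (A : ℕ → Matrix (Fin d) (Fin d) ℝ) :
    (arPoly p A).map (fun f => f.coeff p) = 1 := by
  ext i j
  rw [Matrix.map_apply, arPoly_apply, Polynomial.coeff_add, Polynomial.finsetSum_coeff,
    Finset.sum_eq_zero]
  · by_cases h : i = j
    · subst h; simp
    · simp [Matrix.one_apply_ne h]
  · intro k hk
    rw [Finset.mem_Icc] at hk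
    rw [Polynomial.coeff_mul_C, Polynomial.coeff_X_pow, if_neg (by omega), zero_mul]

lemma coeff_det_arPoly {d : ℕ} (p : ℕ) (A : ℕ → Matrix (Fin d) (Fin d) ℝ) :
    (arPoly p A).det.coeff (d * p) = 1 := by
  rw [coeff_det_of_natDegree_le _ (natDegree_arPoly_le p A), coeff_arPoly, Matrix.det_one]

lemma det_arPoly_ne_zero {d : ℕ} (p : ℕ) (A : ℕ → Matrix (Fin d) (Fin d) ℝ) :
    (arPoly p A).det ≠ 0 := by
  intro h
  have := coeff_det_arPoly p A
  simp [h] at this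

lemma mem_polySpectrum_iff {d : ℕ} {P : Matrix (Fin d) (Fin d) (Polynomial ℂ)} {z : ℂ} :
    z ∈ polySpectrum P ↔ P.det.IsRoot z := by
  rw [Polynomial.IsRoot, eval_det_eq]; rfl

/-- The factorisation `A(λ) = Q(λ)(λ I - R)` makes the determinant `det Q` times the characteristic
polynomial of `R`, and regularity says that `det Q` has no root on the spectrum of `R`. -/
lemma rootMultiplicity_det_arPoly {d p : ℕ} {A : ℕ → Matrix (Fin d) (Fin d) ℝ}
    {R : Matrix (Fin d) (Fin d) ℂ} (hR : IsRegularRightSolvent p A R) {z : ℂ}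
    (hz : z ∈ spectrum ℂ R) :
    (arPoly p A).det.rootMultiplicity z = R.charpoly.rootMultiplicity z := by
  obtain ⟨-, Q, hQ, hdisj⟩ := hR
  have hdet : (arPoly p A).det = Q.det * R.charpoly := by
    rw [hQ, Matrix.det_mul, Matrix.charpoly]
  have h0 : Q.det.rootMultiplicity z = 0 := by
    refine Polynomial.rootMultiplicity_eq_zero fun h => ?_
    exact Set.disjoint_left.1 hdisj hz (mem_polySpectrum_iff.2 h)
  have hne := det_arPoly_ne_zero p A
  rw [hdet] at hne
  rw [hdet, Polynomial.rootMultiplicity_mul hne, h0, zero_add]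

/-- The spectra of the solvents in a complete set of regular solvents are pairwise disjoint. -/
lemma disjoint_spectrum {d p : ℕ} {A : ℕ → Matrix (Fin d) (Fin d) ℝ}
    {R : Fin p → Matrix (Fin d) (Fin d) ℂ} (hR : IsCompleteRegularSolvents p A R)
    {j k : Fin p} (hjk : j ≠ k) : Disjoint (spectrum ℂ (R j)) (spectrum ℂ (R k)) := by
  classical
  set D := (arPoly p A).det with hD
  have hD0 : D ≠ 0 := det_arPoly_ne_zero p A
  set S : Multiset ℂ := ∑ l, (R l).charpoly.roots with hS
  -- Every root of `D` lies in some spectrum, where the multiplicities agree. As `S` has `d * p`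
  -- elements and `D` has degree at least `d * p`, the multisets coincide. An eigenvalue shared by
  -- two solvents would then have at least twice its own positive multiplicity.
  have hle : D.roots ≤ S := by
    rw [Multiset.le_iff_count]
    intro z
    by_cases hz : D.IsRoot z
    · have hz' : z ∈ ⋃ l, spectrum ℂ (R l) := hR.2 ▸ mem_polySpectrum_iff.2 hz
      obtain ⟨l, hl⟩ := Set.mem_iUnion.1 hz'
      rw [Polynomial.count_roots, hD, rootMultiplicity_det_arPoly (hR.1 l) hl,
        ← Polynomial.count_roots, hS, Multiset.count_sum']
      exact Finset.single_le_sum (f := fun l => Multiset.count z (R l).charpoly.roots)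
        (fun _ _ => Nat.zero_le _) (Finset.mem_univ l)
    · rw [Polynomial.count_roots, Polynomial.rootMultiplicity_eq_zero hz]
      exact Nat.zero_le _
  have hcard : ∀ f : Polynomial ℂ, f.roots.card = f.natDegree := fun f =>
    (IsAlgClosed.splits f).natDegree_eq_card_roots.symm
  have hcS : S.card = d * p := by
    rw [hS, Multiset.card_sum]
    simp [hcard, Matrix.charpoly_natDegree_eq_dim, mul_comm]
  have heq : D.roots = S := by
    refine Multiset.eq_of_le_of_card_le hle ?_
    rw [hcS, hcard]
    refine Polynomial.le_natDegree_of_ne_zero ?_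
    rw [hD, coeff_det_arPoly]
    exact one_ne_zero
  rw [Set.disjoint_left]
  intro z hzj hzk
  have h1 : ∀ l, z ∈ spectrum ℂ (R l) →
      Multiset.count z (R l).charpoly.roots = Multiset.count z D.roots := by
    intro l hl
    rw [Polynomial.count_roots, Polynomial.count_roots, hD, rootMultiplicity_det_arPoly (hR.1 l) hl]
  have h2 : 0 < Multiset.count z D.roots := by
    rw [Polynomial.count_roots, Polynomial.rootMultiplicity_pos hD0]
    refine mem_polySpectrum_iff.1 ?_
    rw [hR.2]
    exact Set.mem_iUnion.2 ⟨j, hzj⟩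
  have h3 : Multiset.count z (R j).charpoly.roots + Multiset.count z (R k).charpoly.roots ≤
      Multiset.count z S := by
    rw [hS, Multiset.count_sum', ← Finset.sum_pair hjk
      (f := fun l => Multiset.count z (R l).charpoly.roots)]
    exact Finset.sum_le_sum_of_subset (Finset.subset_univ _)
  rw [h1 j hzj, h1 k hzk, ← heq] at h3
  omega

/-! ### Division by the solvents and partial fractions. -/

/-- The coefficients `I, A_1, …, A_p` of the autoregressive polynomial. -/
def arCoeff {d : ℕ} (A : ℕ → Matrix (Fin d) (Fin d) ℝ) (i : ℕ) : Matrix (Fin d) (Fin d) ℂ :=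
  if i = 0 then 1 else toComplex (A i)

lemma sum_arCoeff {d p : ℕ} (A : ℕ → Matrix (Fin d) (Fin d) ℝ) {E : Type*} [AddCommMonoid E]
    (f : Matrix (Fin d) (Fin d) ℂ → ℕ → E) :
    ∑ i ∈ Finset.range (p + 1), f (arCoeff A i) i =
      f 1 0 + ∑ i ∈ Finset.Icc 1 p, f (toComplex (A i)) i := by
  rw [Finset.sum_range_succ', add_comm]
  congr 1
  rw [← Finset.sum_image (s := Finset.range p) (g := fun i => i + 1)
    (f := fun i => f (arCoeff A i) i) (by intro a _ b _ h; simpa using h)]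
  have : Finset.image (fun i => i + 1) (Finset.range p) = Finset.Icc 1 p := by
    ext i
    simp only [Finset.mem_image, Finset.mem_range, Finset.mem_Icc]
    constructor
    · rintro ⟨a, ha, rfl⟩; omega
    · rintro ⟨h1, h2⟩; exact ⟨i - 1, by omega, by omega⟩
  rw [this]
  refine Finset.sum_congr rfl fun i hi => ?_
  rw [Finset.mem_Icc] at hi
  simp [arCoeff, show i ≠ 0 by omega]

lemma evalAt_arPoly {d : ℕ} (p : ℕ) (A : ℕ → Matrix (Fin d) (Fin d) ℝ) (z : ℂ) :
    evalAt (arPoly p A) z = ∑ i ∈ Finset.range (p + 1), z ^ (p - i) • arCoeff A i := by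
  rw [sum_arCoeff A (fun M i => z ^ (p - i) • M)]
  ext i j
  rw [evalAt, Matrix.map_apply, arPoly_apply]
  by_cases h : i = j
  · subst h
    simp only [Polynomial.eval_finsetSum, Matrix.sum_apply, Matrix.one_apply_eq, mul_one,
      Matrix.add_apply, Matrix.smul_apply, smul_eq_mul, Polynomial.eval_add, Polynomial.eval_mul,
      Polynomial.eval_pow, Polynomial.eval_X, Polynomial.eval_C, Nat.sub_zero]
  · simp only [Polynomial.eval_finsetSum, Matrix.sum_apply, Matrix.one_apply_ne h, mul_zero,
      Matrix.add_apply, Matrix.smul_apply, smul_eq_mul, Polynomial.eval_add, Polynomial.eval_mul,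
      Polynomial.eval_pow, Polynomial.eval_X, Polynomial.eval_C, Polynomial.eval_zero]

lemma IsRightSolvent.sum_eq_zero {d p : ℕ} {A : ℕ → Matrix (Fin d) (Fin d) ℝ}
    {R : Matrix (Fin d) (Fin d) ℂ} (hR : IsRightSolvent p A R) :
    ∑ i ∈ Finset.range (p + 1), arCoeff A i * R ^ (p - i) = 0 := by
  rw [sum_arCoeff A (fun M i => M * R ^ (p - i))]
  simpa [IsRightSolvent] using hR

/-- Division of the autoregressive polynomial by `λ I - R`. -/
lemma evalAt_arPoly_eq_mul {d p : ℕ} {A : ℕ → Matrix (Fin d) (Fin d) ℝ}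
    {R : Matrix (Fin d) (Fin d) ℂ} (hR : IsRightSolvent p A R) (z : ℂ) :
    evalAt (arPoly p A) z = (∑ i ∈ Finset.range (p + 1), arCoeff A i *
      ∑ a ∈ Finset.range (p - i), z ^ a • R ^ (p - i - 1 - a)) * (z • 1 - R) := by
  -- Geometric sum for the commuting matrices `z • 1` and `R`. Summed against the coefficients, the
  -- powers of `R` cancel by the solvent equation.
  have h : ∀ n, (∑ a ∈ Finset.range n, z ^ a • R ^ (n - 1 - a)) * (z • 1 - R)
      = z ^ n • 1 - R ^ n := by
    intro n
    have hc : Commute (z • (1 : Matrix (Fin d) (Fin d) ℂ)) R :=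
      (Commute.one_left R).smul_left z
    have := hc.geom_sum₂_mul n
    rw [smul_pow, one_pow] at this
    rw [← this]
    congr 1
    refine Finset.sum_congr rfl fun a _ => ?_
    rw [smul_pow, one_pow, smul_mul_assoc, one_mul]
  rw [Finset.sum_mul]
  simp_rw [mul_assoc, h, mul_sub]
  rw [Finset.sum_sub_distrib, hR.sum_eq_zero, sub_zero, evalAt_arPoly]
  simp

/-- The blocks `β_r` with complex entries. -/
def complexBeta {d m : ℕ} (p q : ℕ) (A : ℕ → Matrix (Fin d) (Fin d) ℝ)
    (B : ℕ → Matrix (Fin d) (Fin m) ℝ) (r : ℕ) : Matrix (Fin d) (Fin m) ℂ :=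
  toComplex (stateBeta p q A B r)

lemma toComplex_mul {l m n : Type*} [Fintype m] (M : Matrix l m ℝ) (N : Matrix m n ℝ) :
    toComplex (M * N) = toComplex M * toComplex N :=
  Matrix.map_mul (f := Complex.ofRealHom)

/-- The recursion for `β` says that the coefficients of `λ^a`, `a ≥ 0`, in `A(λ) ∑ β_r λ^{-r}` are
those of `B(λ)`. For `a > q` all indices `p - a - i` fall below `p - q`, where `β` vanishes. -/
lemma sum_arCoeff_mul_complexBeta {d m p q : ℕ} (A : ℕ → Matrix (Fin d) (Fin d) ℝ)
    (B : ℕ → Matrix (Fin d) (Fin m) ℝ) (a : ℕ) (ha : a < p) (hqp : q < p) :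
    ∑ i ∈ Finset.range (p - a), arCoeff A i * complexBeta p q A B (p - a - i) =
      if a ≤ q then toComplex (B (q - a)) else 0 := by
  split_ifs with h
  · obtain ⟨r, hr⟩ : ∃ r, p - a = r + 1 := ⟨p - a - 1, by omega⟩
    have hβ : complexBeta p q A B (r + 1) =
        -(∑ i ∈ Finset.range r, toComplex (A (i + 1)) * complexBeta p q A B (r + 1 - (i + 1))) +
          toComplex (B (q - a)) := by
      rw [complexBeta, stateBeta, if_neg (by omega), show r + 1 + q - p = q - a by omega]
      rw [Finset.sum_range fun i => toComplex (A (i + 1)) * complexBeta p q A B (r + 1 - (i + 1))]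
      simp only [complexBeta, ← toComplex_mul]
      ext i j
      simp [toComplex, Matrix.sum_apply]
    rw [hr, Finset.sum_range_succ']
    simp only [arCoeff, Nat.sub_zero, if_true, Nat.add_eq_zero_iff, one_ne_zero,
      and_false, if_false]
    rw [hβ, Matrix.one_mul, add_neg_cancel_left]
  · refine Finset.sum_eq_zero fun i _ => ?_
    rw [complexBeta, stateBeta, if_pos (by omega)]
    ext i j
    simp [toComplex, Matrix.mul_apply]

lemma evalAt_maPoly {d m : ℕ} (q : ℕ) (B : ℕ → Matrix (Fin d) (Fin m) ℝ) (z : ℂ) :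
    evalAt (maPoly q B) z = ∑ a ∈ Finset.range (q + 1), z ^ a • toComplex (B (q - a)) := by
  rw [← Finset.sum_range_reflect]
  ext i j
  simp only [evalAt, maPoly, Matrix.map_apply, Matrix.sum_apply, Matrix.smul_apply,
    Polynomial.eval_finsetSum, smul_eq_mul, Polynomial.eval_mul, Polynomial.eval_pow,
    Polynomial.eval_X, Polynomial.eval_C]
  refine Finset.sum_congr rfl fun a ha => ?_
  rw [Finset.mem_range] at ha
  rw [show q + 1 - 1 - a = q - a by omega, show q - (q - a) = a by omega]

/-- The quotients of the division of `A(λ)` by the solvents combine to `B(λ)`. -/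
lemma sum_quotient_mul_eq {d m p q : ℕ} (A : ℕ → Matrix (Fin d) (Fin d) ℝ)
    (B : ℕ → Matrix (Fin d) (Fin m) ℝ) (hqp : q < p) (R : Fin p → Matrix (Fin d) (Fin d) ℂ)
    (N : Fin p → Matrix (Fin d) (Fin m) ℂ)
    (hN : ∀ b < p, ∑ k, R k ^ b * N k = complexBeta p q A B (b + 1)) (z : ℂ) :
    ∑ k, (∑ i ∈ Finset.range (p + 1), arCoeff A i *
      ∑ a ∈ Finset.range (p - i), z ^ a • R k ^ (p - i - 1 - a)) * N k =
      evalAt (maPoly q B) z := by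
  have h1 : ∑ k, (∑ i ∈ Finset.range (p + 1), arCoeff A i *
      ∑ a ∈ Finset.range (p - i), z ^ a • R k ^ (p - i - 1 - a)) * N k =
      ∑ i ∈ Finset.range (p + 1), ∑ a ∈ Finset.range (p - i),
        z ^ a • (arCoeff A i * complexBeta p q A B (p - a - i)) := by
    simp_rw [Matrix.sum_mul]
    rw [Finset.sum_comm]
    refine Finset.sum_congr rfl fun i _ => ?_
    simp_rw [Matrix.mul_assoc, Matrix.sum_mul]
    rw [← Matrix.mul_sum, Finset.sum_comm, Matrix.mul_sum]
    refine Finset.sum_congr rfl fun a ha => ?_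
    rw [Finset.mem_range] at ha
    simp_rw [Matrix.smul_mul]
    rw [← Finset.smul_sum, hN _ (by omega), Matrix.mul_smul,
      show p - i - 1 - a + 1 = p - a - i by omega]
  rw [h1, Finset.sum_comm' (s' := fun a => Finset.range (p - a)) (t' := Finset.range p)
    (by intro i a; simp only [Finset.mem_range]; omega), evalAt_maPoly]
  have h2 : ∀ a ∈ Finset.range p, ∑ i ∈ Finset.range (p - a),
      z ^ a • (arCoeff A i * complexBeta p q A B (p - a - i)) =
        if a ∈ Finset.range (q + 1) then z ^ a • toComplex (B (q - a)) else 0 := by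
    intro a ha
    rw [Finset.mem_range] at ha
    rw [← Finset.smul_sum, sum_arCoeff_mul_complexBeta A B a ha hqp]
    by_cases h : a ≤ q
    · rw [if_pos h, if_pos (by rw [Finset.mem_range]; omega)]
    · rw [if_neg h, if_neg (by rw [Finset.mem_range]; omega), smul_zero]
  rw [Finset.sum_congr rfl h2, Finset.sum_ite_mem,
    Finset.inter_eq_right.2 (Finset.range_subset_range.2 (by omega))]

lemma isUnit_smul_one_sub {d : ℕ} {R : Matrix (Fin d) (Fin d) ℂ} {z : ℂ}
    (hz : z ∉ spectrum ℂ R) : IsUnit (z • (1 : Matrix (Fin d) (Fin d) ℂ) - R) := by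
  simpa [spectrum.mem_iff, Algebra.algebraMap_eq_smul_one] using hz

/-- The partial fraction decomposition of the transfer function. -/
lemma transferFun_eq_sum {d m p q : ℕ} {A : ℕ → Matrix (Fin d) (Fin d) ℝ}
    {B : ℕ → Matrix (Fin d) (Fin m) ℝ} (hqp : q < p) {R : Fin p → Matrix (Fin d) (Fin d) ℂ}
    (hR : IsCompleteRegularSolvents p A R) {N : Fin p → Matrix (Fin d) (Fin m) ℂ}
    (hN : ∀ b < p, ∑ k, R k ^ b * N k = complexBeta p q A B (b + 1)) {z : ℂ}
    (hz : z ∉ polySpectrum (arPoly p A)) :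
    transferFun p q A B z = ∑ k, (z • 1 - R k)⁻¹ * N k := by
  have hu : IsUnit (evalAt (arPoly p A) z).det := isUnit_iff_ne_zero.2 hz
  rw [transferFun, ← sum_quotient_mul_eq A B hqp R N hN z, Matrix.mul_sum]
  refine Finset.sum_congr rfl fun k _ => ?_
  have hk : IsUnit (z • (1 : Matrix (Fin d) (Fin d) ℂ) - R k).det := by
    rw [← Matrix.isUnit_iff_isUnit_det]
    refine isUnit_smul_one_sub fun h => hz ?_
    rw [hR.2]
    exact Set.mem_iUnion.2 ⟨k, h⟩
  rw [← Matrix.mul_assoc]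
  congr 1
  have h1 := evalAt_arPoly_eq_mul (hR.1 k).1 z
  set Q := (∑ i ∈ Finset.range (p + 1), arCoeff A i *
      ∑ a ∈ Finset.range (p - i), z ^ a • R k ^ (p - i - 1 - a))
  have h2 : (evalAt (arPoly p A) z)⁻¹ * Q * (z • 1 - R k) = 1 := by
    rw [mul_assoc, ← h1, Matrix.nonsing_inv_mul _ hu]
  exact (Matrix.inv_eq_left_inv h2).symm

/-! ### The block Vandermonde system. -/

/-- A family satisfying the recursion of the solvents vanishes against all polynomials. -/
lemma sum_pow_mulVec_eq_zero {d p : ℕ} {A : ℕ → Matrix (Fin d) (Fin d) ℝ}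
    {R : Fin p → Matrix (Fin d) (Fin d) ℂ} (hR : ∀ k, IsRightSolvent p A (R k))
    (x : Fin p → Fin d → ℂ) (hx : ∀ b < p, ∑ k, (R k ^ b).mulVec (x k) = 0) (b : ℕ) :
    ∑ k, (R k ^ b).mulVec (x k) = 0 := by
  induction b using Nat.strong_induction_on with
  | _ b ih =>
    by_cases hb : b < p
    · exact hx b hb
    · obtain ⟨c, rfl⟩ : ∃ c, b = c + p := ⟨b - p, by omega⟩
      have h : ∀ k, R k ^ (c + p) =
          -∑ i ∈ Finset.Icc 1 p, toComplex (A i) * R k ^ (c + (p - i)) := by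
        intro k
        have := (hR k)
        rw [IsRightSolvent] at this
        rw [add_comm c p, pow_add, eq_neg_of_add_eq_zero_left this, neg_mul, Finset.sum_mul]
        simp_rw [mul_assoc, ← pow_add, add_comm c]
      simp_rw [h, Matrix.neg_mulVec, Matrix.sum_mulVec, ← Matrix.mulVec_mulVec]
      rw [Finset.sum_neg_distrib, Finset.sum_comm, neg_eq_zero]
      refine Finset.sum_eq_zero fun i hi => ?_
      rw [Finset.mem_Icc] at hi
      rw [← Matrix.mulVec_sum, ih _ (by omega), Matrix.mulVec_zero]

lemma sum_aeval_mulVec_eq_zero {d p : ℕ} {R : Fin p → Matrix (Fin d) (Fin d) ℂ}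
    (x : Fin p → Fin d → ℂ) (hx : ∀ b : ℕ, ∑ k, (R k ^ b).mulVec (x k) = 0) (f : Polynomial ℂ) :
    ∑ k, (Polynomial.aeval (R k) f).mulVec (x k) = 0 := by
  simp_rw [Polynomial.aeval_eq_sum_range, Matrix.sum_mulVec, Matrix.smul_mulVec]
  rw [Finset.sum_comm]
  refine Finset.sum_eq_zero fun i _ => ?_
  rw [← Finset.smul_sum, hx, smul_zero]

/-- The block Vandermonde matrix of a complete set of regular solvents is injective. -/
lemma vandermonde_injective {d p : ℕ} {A : ℕ → Matrix (Fin d) (Fin d) ℝ}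
    {R : Fin p → Matrix (Fin d) (Fin d) ℂ} (hR : IsCompleteRegularSolvents p A R)
    (x : Fin p → Fin d → ℂ) (hx : ∀ b < p, ∑ k, (R k ^ b).mulVec (x k) = 0) : x = 0 := by
  classical
  have hx' := sum_pow_mulVec_eq_zero (fun k => (hR.1 k).1) x hx
  rcases isEmpty_or_nonempty (Fin d) with hd | hd
  · exact Subsingleton.elim _ _
  funext k
  -- By Cayley–Hamilton `f` kills every `R j` with `j ≠ k`, while `f (R k)` is invertible by
  -- spectral mapping, the spectra being disjoint. So only the `k`-th term survives, and it forces
  -- `x k = 0`.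
  set f : Polynomial ℂ := ∏ j ∈ Finset.univ.erase k, (R j).charpoly with hf
  have h := sum_aeval_mulVec_eq_zero x hx' f
  rw [Finset.sum_eq_single k] at h
  · have hu : IsUnit (Polynomial.aeval (R k) f) := by
      by_contra hcon
      have h0 : (0 : ℂ) ∈ spectrum ℂ (Polynomial.aeval (R k) f) :=
        spectrum.zero_mem_iff ℂ |>.2 hcon
      rw [spectrum.map_polynomial_aeval_of_nonempty _ _
        (spectrum.nonempty_of_isAlgClosed_of_finiteDimensional ℂ (R k))] at h0
      obtain ⟨z, hz, hz0⟩ := h0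
      simp only [hf, Polynomial.eval_prod, Finset.prod_eq_zero_iff] at hz0
      obtain ⟨j, hj, hjz⟩ := hz0
      exact Set.disjoint_left.1 (disjoint_spectrum hR (Finset.ne_of_mem_erase hj))
        (Matrix.mem_spectrum_iff_isRoot_charpoly.2 hjz) hz
    have hu' := (Matrix.isUnit_iff_isUnit_det _).1 hu
    calc x k = ((Polynomial.aeval (R k) f)⁻¹ * Polynomial.aeval (R k) f).mulVec (x k) := by
          rw [Matrix.nonsing_inv_mul _ hu', Matrix.one_mulVec]
      _ = 0 := by rw [← Matrix.mulVec_mulVec, h, Matrix.mulVec_zero]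
  · intro j _ hj
    have : f = (∏ i ∈ (Finset.univ.erase k).erase j, (R i).charpoly) * (R j).charpoly := by
      rw [hf, Finset.prod_erase_mul]
      simp [hj]
    rw [this, map_mul, Matrix.aeval_self_charpoly, mul_zero, Matrix.zero_mulVec]
  · simp

/-- Solvability of the block Vandermonde system. -/
lemma exists_vandermonde_solution {d m p : ℕ} {A : ℕ → Matrix (Fin d) (Fin d) ℝ}
    {R : Fin p → Matrix (Fin d) (Fin d) ℂ} (hR : IsCompleteRegularSolvents p A R)
    (β : ℕ → Matrix (Fin d) (Fin m) ℂ) :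
    ∃ N : Fin p → Matrix (Fin d) (Fin m) ℂ, ∀ b < p, ∑ k, R k ^ b * N k = β b := by
  let V : (Fin p → Fin d → ℂ) →ₗ[ℂ] (Fin p → Fin d → ℂ) :=
    LinearMap.pi fun b => ∑ k, (Matrix.mulVecLin (R k ^ (b : ℕ))).comp (LinearMap.proj k)
  have hV : ∀ x b, V x b = ∑ k, (R k ^ (b : ℕ)).mulVec (x k) := by
    intro x b
    simp [V]
  have hinj : Function.Injective V := by
    rw [injective_iff_map_eq_zero]
    intro x hx
    refine vandermonde_injective hR x fun b hb => ?_
    rw [← hV x ⟨b, hb⟩, hx]; rfl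
  have hsurj := LinearMap.injective_iff_surjective.1 hinj
  choose N hN using fun c : Fin m => hsurj fun b a => β b a c
  refine ⟨fun k => Matrix.of fun a c => N c k a, fun b hb => ?_⟩
  ext a c
  have := congrFun (congrFun (hN c) ⟨b, hb⟩) a
  rw [hV] at this
  rw [← this]
  simp [Matrix.sum_apply, Matrix.mul_apply, Matrix.mulVec, dotProduct]

/-! ### Contour integrals of rational functions. -/

/-- The image of the parameter interval of a curve. -/
def trace (γ : ℝ → ℂ) : Set ℂ := γ '' Set.Icc 0 1

/-- At break points `deriv γ` need not agree with the one-sided derivative. On the open interval it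
equals `derivWithin`, which is continuous on the closed one. -/
lemma contDiffOn_piece_integrable {γ : ℝ → ℂ} {f : ℂ → ℂ} {a b : ℝ} (hab : a < b)
    (hγ : ContDiffOn ℝ 1 γ (Set.Icc a b)) (hf : ContinuousOn f (γ '' Set.Icc a b)) :
    IntervalIntegrable (fun s => f (γ s) * deriv γ s) volume a b := by
  rw [intervalIntegrable_iff_integrableOn_Ioo_of_le hab.le]
  have h1 : ContinuousOn (fun s => f (γ s) * derivWithin γ (Set.Icc a b) s) (Set.Icc a b) :=
    (hf.comp hγ.continuousOn (Set.mapsTo_image _ _)).mul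
      (hγ.continuousOn_derivWithin (uniqueDiffOn_Icc hab) le_rfl)
  refine ((h1.integrableOn_Icc).mono_set Set.Ioo_subset_Icc_self).congr_fun (fun s hs => ?_)
    measurableSet_Ioo
  simp only
  rw [derivWithin_of_mem_nhds (Icc_mem_nhds hs.1 hs.2)]

lemma contDiffOn_piece_integral {γ : ℝ → ℂ} {F f : ℂ → ℂ} {a b : ℝ} (hab : a < b)
    (hγ : ContDiffOn ℝ 1 γ (Set.Icc a b)) (hf : ContinuousOn f (γ '' Set.Icc a b))
    (hF : ∀ z ∈ γ '' Set.Icc a b, HasDerivAt F (f z) z) :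
    ∫ s in a..b, f (γ s) * deriv γ s = F (γ b) - F (γ a) := by
  refine intervalIntegral.integral_eq_sub_of_hasDeriv_right_of_le hab.le
    (f := fun s => F (γ s)) ?_ (fun s hs => ?_) (contDiffOn_piece_integrable hab hγ hf)
  · exact fun s hs => ((hF _ ⟨s, hs, rfl⟩).continuousAt.comp_continuousWithinAt
      (hγ.continuousOn s hs))
  · have hd : DifferentiableAt ℝ γ s :=
      (hγ.differentiableOn one_ne_zero).differentiableAt (Icc_mem_nhds hs.1 hs.2)
    exact (HasDerivAt.comp_of_eq s (hF _ ⟨s, ⟨hs.1.le, hs.2.le⟩, rfl⟩) hd.hasDerivAt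
      rfl).hasDerivWithinAt

lemma piece_subset {n : ℕ} {τ : ℕ → ℝ} (h0 : τ 0 = 0) (hn : τ n = 1)
    (hτ : ∀ i < n, τ i < τ (i + 1)) {i : ℕ} (hi : i < n) :
    Set.Icc (τ i) (τ (i + 1)) ⊆ Set.Icc 0 1 := by
  have hmono : ∀ j ≤ n, ∀ i ≤ j, τ i ≤ τ j := by
    intro j
    induction j with
    | zero => intro _ i hi; rw [Nat.le_zero.1 hi]
    | succ j ih =>
      intro hj i hi
      rcases Nat.lt_or_ge i (j + 1) with h | h
      · exact (ih (by omega) i (by omega)).trans (hτ j (by omega)).le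
      · rw [le_antisymm hi h]
  refine Set.Icc_subset_Icc ?_ ?_
  · rw [← h0]; exact hmono i hi.le 0 (Nat.zero_le _)
  · rw [← hn]; exact hmono n le_rfl _ hi

lemma IsSimpleClosedContour.intervalIntegrable {γ : ℝ → ℂ} (hγ : IsSimpleClosedContour γ)
    {f : ℂ → ℂ} (hf : ContinuousOn f (trace γ)) :
    IntervalIntegrable (fun s => f (γ s) * deriv γ s) volume 0 1 := by
  obtain ⟨n, τ, h0, hn, hτ⟩ := hγ.piecewise_smooth
  rw [← h0, ← hn]
  refine IntervalIntegrable.trans_iterate fun i hi => ?_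
  have hsub := piece_subset h0 hn (fun i hi => (hτ i hi).1) hi
  exact contDiffOn_piece_integrable (hτ i hi).1 (hτ i hi).2 (hf.mono (Set.image_mono hsub))

lemma IsSimpleClosedContour.contourIntegral_eq_zero {γ : ℝ → ℂ} (hγ : IsSimpleClosedContour γ)
    {F f : ℂ → ℂ} (hf : ContinuousOn f (trace γ))
    (hF : ∀ z ∈ trace γ, HasDerivAt F (f z) z) : contourIntegral γ f = 0 := by
  obtain ⟨n, τ, h0, hn, hτ⟩ := hγ.piecewise_smooth
  have hsub := fun i hi => piece_subset h0 hn (fun i hi => (hτ i hi).1) (i := i) hi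
  have hint : ∀ i < n, IntervalIntegrable (fun s => f (γ s) * deriv γ s) volume
      (τ i) (τ (i + 1)) := fun i hi =>
    contDiffOn_piece_integrable (hτ i hi).1 (hτ i hi).2 (hf.mono (Set.image_mono (hsub i hi)))
  rw [contourIntegral, ← h0, ← hn, ← intervalIntegral.sum_integral_adjacent_intervals hint]
  have : ∀ i ∈ Finset.range n, ∫ s in τ i..τ (i + 1), f (γ s) * deriv γ s =
      F (γ (τ (i + 1))) - F (γ (τ i)) := by
    intro i hi
    rw [Finset.mem_range] at hi
    exact contDiffOn_piece_integral (hτ i hi).1 (hτ i hi).2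
      (hf.mono (Set.image_mono (hsub i hi)))
      (fun z hz => hF z (Set.image_mono (hsub i hi) hz))
  rw [Finset.sum_congr rfl this, Finset.sum_range_sub (fun i => F (γ (τ i))), h0, hn, hγ.closed,
    sub_self]

lemma contourIntegral_congr {γ : ℝ → ℂ} {f g : ℂ → ℂ} (h : Set.EqOn f g (trace γ)) :
    contourIntegral γ f = contourIntegral γ g := by
  refine intervalIntegral.integral_congr fun s hs => ?_
  rw [Set.uIcc_of_le zero_le_one] at hs
  rw [h ⟨s, hs, rfl⟩]

lemma IsSimpleClosedContour.contourIntegral_add {γ : ℝ → ℂ} (hγ : IsSimpleClosedContour γ)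
    {f g : ℂ → ℂ} (hf : ContinuousOn f (trace γ)) (hg : ContinuousOn g (trace γ)) :
    contourIntegral γ (fun z => f z + g z) = contourIntegral γ f + contourIntegral γ g := by
  simp only [contourIntegral, add_mul]
  exact intervalIntegral.integral_add (hγ.intervalIntegrable hf) (hγ.intervalIntegrable hg)

lemma contourIntegral_mul_const (γ : ℝ → ℂ) (f : ℂ → ℂ) (c : ℂ) :
    contourIntegral γ (fun z => f z * c) = contourIntegral γ f * c := by
  rw [contourIntegral, contourIntegral, ← intervalIntegral.integral_mul_const]
  congr 1
  ext s
  ring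

lemma IsSimpleClosedContour.contourIntegral_sum {γ : ℝ → ℂ} (hγ : IsSimpleClosedContour γ)
    {ι : Type*} (s : Finset ι) {f : ι → ℂ → ℂ} (hf : ∀ i ∈ s, ContinuousOn (f i) (trace γ)) :
    contourIntegral γ (fun z => ∑ i ∈ s, f i z) = ∑ i ∈ s, contourIntegral γ (f i) := by
  simp only [contourIntegral, Finset.sum_mul]
  exact intervalIntegral.integral_finsetSum fun i hi => hγ.intervalIntegrable (hf i hi)

lemma continuousOn_inv_prod {γ : ℝ → ℂ} (s : Multiset ℂ) (hs : ∀ a ∈ s, a ∉ trace γ) :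
    ContinuousOn (fun z => ((s.map fun a => z - a).prod)⁻¹) (trace γ) := by
  refine ContinuousOn.inv₀ ?_ ?_
  · exact (continuous_multiset_prod (f := fun a z => z - a) s
      (fun a _ => by fun_prop)).continuousOn
  · intro z hz
    rw [Ne, Multiset.prod_eq_zero_iff, Multiset.mem_map]
    rintro ⟨a, ha, h⟩
    exact hs a ha (sub_eq_zero.1 h ▸ hz)

/-- The contour integral of the reciprocal of a polynomial with at least two roots vanishes, if the
curve winds equally often around all of them. -/
lemma IsSimpleClosedContour.contourIntegral_inv_prod {γ : ℝ → ℂ} (hγ : IsSimpleClosedContour γ)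
    {w : ℂ} (s : Multiset ℂ) (hs : ∀ a ∈ s, a ∉ trace γ) (hw : ∀ a ∈ s, windingNumber γ a = w)
    (hcard : 2 ≤ s.card) : contourIntegral γ (fun z => ((s.map fun a => z - a).prod)⁻¹) = 0 := by
  induction hn : s.card using Nat.strong_induction_on generalizing s with
  | _ n ih =>
  subst hn
  obtain ⟨a, ha⟩ := Multiset.exists_mem_of_ne_zero (s := s) (by rintro rfl; simp at hcard)
  obtain ⟨s', rfl⟩ := Multiset.exists_cons_of_mem ha
  -- A multiple pole at a single point has a primitive. Two distinct poles are separated by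
  -- `1/((z-a)(z-b)) = (1/(z-a) - 1/(z-b))/(a-b)`, which lowers the number of factors.
  by_cases hall : ∀ b ∈ s', b = a
  · rw [Multiset.card_cons] at hcard
    obtain ⟨n, hn⟩ : ∃ n, s'.card = n + 1 := ⟨s'.card - 1, by omega⟩
    have hs' : s' = Multiset.replicate (n + 1) a := Multiset.eq_replicate.2 ⟨hn, hall⟩
    have hfun : (fun z => (((a ::ₘ s').map fun a => z - a).prod)⁻¹) =
        fun z => ((z - a) ^ (n + 2))⁻¹ := by
      ext z
      rw [hs', ← Multiset.replicate_succ, Multiset.map_replicate, Multiset.prod_replicate]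
    have hc := continuousOn_inv_prod _ hs
    rw [hfun] at hc ⊢
    refine hγ.contourIntegral_eq_zero (F := fun z => -((n : ℂ) + 1)⁻¹ * ((z - a) ^ (n + 1))⁻¹)
      hc fun z hz => ?_
    have hza : z - a ≠ 0 := fun h => hs a (Multiset.mem_cons_self _ _) (sub_eq_zero.1 h ▸ hz)
    have hn1 : (n : ℂ) + 1 ≠ 0 := Nat.cast_add_one_ne_zero n
    have := (((hasDerivAt_id z).sub_const a).fun_pow (n + 1)).fun_inv (pow_ne_zero _ hza)
    refine (this.const_mul (-((n : ℂ) + 1)⁻¹)).congr_deriv ?_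
    rw [id, add_tsub_cancel_right]
    push_cast
    field_simp
    ring
  · push Not at hall
    obtain ⟨b, hb, hab⟩ := hall
    obtain ⟨t, rfl⟩ := Multiset.exists_cons_of_mem hb
    have hab' : a - b ≠ 0 := sub_ne_zero.2 (Ne.symm hab)
    have hsa : ∀ c ∈ a ::ₘ t, c ∉ trace γ := fun c hc => hs c (by
      rcases Multiset.mem_cons.1 hc with h | h
      · exact h ▸ Multiset.mem_cons_self _ _
      · exact Multiset.mem_cons_of_mem (Multiset.mem_cons_of_mem h))
    have hsb : ∀ c ∈ b ::ₘ t, c ∉ trace γ := fun c hc => hs c (Multiset.mem_cons_of_mem hc)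
    have hwa : ∀ c ∈ a ::ₘ t, windingNumber γ c = w := fun c hc => hw c (by
      rcases Multiset.mem_cons.1 hc with h | h
      · exact h ▸ Multiset.mem_cons_self _ _
      · exact Multiset.mem_cons_of_mem (Multiset.mem_cons_of_mem h))
    have hwb : ∀ c ∈ b ::ₘ t, windingNumber γ c = w := fun c hc => hw c (Multiset.mem_cons_of_mem hc)
    have hsplit : contourIntegral γ
        (fun z => (((a ::ₘ b ::ₘ t).map fun a => z - a).prod)⁻¹) =
        contourIntegral γ (fun z => (((a ::ₘ t).map fun a => z - a).prod)⁻¹) * (a - b)⁻¹ +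
        contourIntegral γ (fun z => (((b ::ₘ t).map fun a => z - a).prod)⁻¹) * (-(a - b)⁻¹) := by
      rw [← contourIntegral_mul_const, ← contourIntegral_mul_const, ← hγ.contourIntegral_add
        ((continuousOn_inv_prod _ hsa).fun_mul continuousOn_const)
        ((continuousOn_inv_prod _ hsb).fun_mul continuousOn_const)]
      refine contourIntegral_congr fun z hz => ?_
      have hza : z - a ≠ 0 := fun h => hs a (Multiset.mem_cons_self _ _) (sub_eq_zero.1 h ▸ hz)
      have hzb : z - b ≠ 0 := fun h => hsb b (Multiset.mem_cons_self _ _) (sub_eq_zero.1 h ▸ hz)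
      simp only [Multiset.map_cons, Multiset.prod_cons, mul_inv]
      generalize ((t.map fun a => z - a).prod)⁻¹ = c
      field_simp
      ring
    rw [hsplit]
    rcases Nat.lt_or_ge t.card 1 with ht | ht
    -- Only two simple poles are left; their integrals agree because the winding numbers do, and
    -- they cancel.
    · have ht0 : t = 0 := Multiset.card_eq_zero.1 (by omega)
      subst ht0
      have h1 := hwa a (Multiset.mem_cons_self _ _)
      have h2 := hwb b (Multiset.mem_cons_self _ _)
      rw [windingNumber] at h1 h2
      have hpi : (2 * Real.pi * Complex.I : ℂ)⁻¹ ≠ 0 := inv_ne_zero Complex.two_pi_I_ne_zero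
      have h3 := mul_left_cancel₀ hpi (h1.trans h2.symm)
      simp only [Multiset.map_cons, Multiset.map_zero, Multiset.prod_cons, Multiset.prod_zero,
        mul_one]
      rw [h3]
      ring
    · rw [ih _ (by simp) _ hsa hwa (by rw [Multiset.card_cons]; omega) rfl,
        ih _ (by simp) _ hsb hwb (by rw [Multiset.card_cons]; omega) rfl]
      simp

/-! ### Contour integrals of resolvents and the residues. -/

lemma continuousOn_resolvent {d : ℕ} (R : Matrix (Fin d) (Fin d) ℂ) :
    ContinuousOn (fun z : ℂ => (z • (1 : Matrix (Fin d) (Fin d) ℂ) - R)⁻¹) (spectrum ℂ R)ᶜ := by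
  simp_rw [Matrix.inv_def, Ring.inverse_eq_inv']
  have hc : Continuous fun z : ℂ => z • (1 : Matrix (Fin d) (Fin d) ℂ) - R := by fun_prop
  refine ContinuousOn.smul (hc.matrix_det.continuousOn.inv₀ fun z hz => ?_)
    hc.matrix_adjugate.continuousOn
  exact ((Matrix.isUnit_iff_isUnit_det _).1 (isUnit_smul_one_sub hz)).ne_zero

/-- Since `z - a = (z - R) + (R - a)`, splitting off `(z - a)⁻¹` costs one factor `R - a`. As `a`
runs through the eigenvalues, these factors multiply up to the characteristic polynomial evaluated
at `R`. -/
lemma resolvent_mul_eq {d : ℕ} {R : Matrix (Fin d) (Fin d) ℂ} {z a : ℂ} (hz : z ∉ spectrum ℂ R)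
    (hza : z - a ≠ 0) (N : Matrix (Fin d) (Fin d) ℂ) :
    (z • 1 - R)⁻¹ * N = (z - a)⁻¹ • (N + (z • 1 - R)⁻¹ * ((R - a • 1) * N)) := by
  have hu := (Matrix.isUnit_iff_isUnit_det _).1 (isUnit_smul_one_sub hz)
  have h : (z - a) • (1 : Matrix (Fin d) (Fin d) ℂ) = (z • 1 - R) + (R - a • 1) := by
    rw [sub_smul]; abel
  have h2 : (z - a) • ((z • 1 - R)⁻¹ * N) = N + (z • 1 - R)⁻¹ * ((R - a • 1) * N) := by
    calc (z - a) • ((z • 1 - R)⁻¹ * N) = (z • 1 - R)⁻¹ * (((z - a) • 1) * N) := by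
          rw [smul_mul_assoc, one_mul, mul_smul_comm]
      _ = _ := by
          rw [h, add_mul, mul_add, ← mul_assoc, Matrix.nonsing_inv_mul _ hu, one_mul]
  rw [← h2, smul_smul, inv_mul_cancel₀ hza, one_smul]

lemma continuousOn_resolvent_entry {d : ℕ} {γ : ℝ → ℂ} {R : Matrix (Fin d) (Fin d) ℂ}
    (hR : ∀ a ∈ spectrum ℂ R, a ∉ trace γ) (N : Matrix (Fin d) (Fin d) ℂ) (i j : Fin d) :
    ContinuousOn (fun z : ℂ => ((z • 1 - R)⁻¹ * N) i j) (trace γ) := by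
  have h1 : ContinuousOn (fun z : ℂ => (z • (1 : Matrix (Fin d) (Fin d) ℂ) - R)⁻¹) (trace γ) :=
    (continuousOn_resolvent R).mono fun z hz h => hR z h hz
  have h2 : Continuous fun M : Matrix (Fin d) (Fin d) ℂ => (M * N) i j := by fun_prop
  exact h2.comp_continuousOn h1

/-- Each `a ∈ l` is split off by `resolvent_mul_eq`. The scalar term has at least two poles, because
`s` is nonempty, and integrates to zero; the other term moves `a` into `s` and `R - a` into `N`.
Once `l` is exhausted, `hN` reads `N = 0`. -/
lemma IsSimpleClosedContour.contourIntegral_inv_prod_mul_resolvent {d : ℕ} {γ : ℝ → ℂ}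
    (hγ : IsSimpleClosedContour γ) {R : Matrix (Fin d) (Fin d) ℂ} {w : ℂ}
    (hR : ∀ a ∈ spectrum ℂ R, a ∉ trace γ) (l : List ℂ)
    (hl : ∀ a ∈ l, a ∉ trace γ ∧ windingNumber γ a = w) (s : Multiset ℂ)
    (hs : ∀ a ∈ s, a ∉ trace γ ∧ windingNumber γ a = w) (hs1 : 1 ≤ s.card)
    (N : Matrix (Fin d) (Fin d) ℂ)
    (hN : (l.map fun a => R - a • (1 : Matrix (Fin d) (Fin d) ℂ)).reverse.prod * N = 0)
    (i j : Fin d) :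
    contourIntegral γ (fun z => ((s.map fun a => z - a).prod)⁻¹ * ((z • 1 - R)⁻¹ * N) i j) = 0 := by
  induction l generalizing s N with
  | nil =>
    have : N = 0 := by simpa using hN
    subst this
    simp [contourIntegral]
  | cons a l ih =>
    have has : ∀ b ∈ a ::ₘ s, b ∉ trace γ ∧ windingNumber γ b = w := by
      intro b hb
      rcases Multiset.mem_cons.1 hb with h | h
      · exact h ▸ hl a (by simp)
      · exact hs b h
    have hc := continuousOn_inv_prod (γ := γ) (a ::ₘ s) fun b hb => (has b hb).1
    have hsplit : contourIntegral γ
        (fun z => ((s.map fun a => z - a).prod)⁻¹ * ((z • 1 - R)⁻¹ * N) i j) =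
        contourIntegral γ (fun z => (((a ::ₘ s).map fun a => z - a).prod)⁻¹) * N i j +
        contourIntegral γ (fun z => (((a ::ₘ s).map fun a => z - a).prod)⁻¹ *
          ((z • 1 - R)⁻¹ * ((R - a • 1) * N)) i j) := by
      rw [← contourIntegral_mul_const, ← hγ.contourIntegral_add (hc.fun_mul continuousOn_const)
        (hc.fun_mul (continuousOn_resolvent_entry hR _ i j))]
      refine contourIntegral_congr fun z hz => ?_
      have hza : z - a ≠ 0 := fun h => (hl a (by simp)).1 (sub_eq_zero.1 h ▸ hz)
      rw [resolvent_mul_eq (fun h => hR z h hz) hza]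
      simp only [Matrix.smul_apply, Matrix.add_apply, smul_eq_mul, Multiset.map_cons,
        Multiset.prod_cons, mul_inv]
      ring
    rw [hsplit, hγ.contourIntegral_inv_prod (w := w) _ (fun b hb => (has b hb).1)
      (fun b hb => (has b hb).2) (by rw [Multiset.card_cons]; omega), zero_mul, zero_add]
    refine ih (fun b hb => hl b (by simp [hb])) _ has (by rw [Multiset.card_cons]; omega) _ ?_
    rw [← hN]
    simp [mul_assoc]

/-- The contour integral of the resolvent along a curve which winds equally often around all
eigenvalues. -/
lemma IsSimpleClosedContour.contourIntegral_resolvent {d : ℕ} {γ : ℝ → ℂ}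
    (hγ : IsSimpleClosedContour γ) {R : Matrix (Fin d) (Fin d) ℂ} {w : ℂ}
    (hR : ∀ a ∈ spectrum ℂ R, a ∉ trace γ) (hw : ∀ a ∈ spectrum ℂ R, windingNumber γ a = w)
    (i j : Fin d) :
    (2 * Real.pi * Complex.I)⁻¹ * contourIntegral γ (fun z => (z • 1 - R)⁻¹ i j) =
      w * (1 : Matrix (Fin d) (Fin d) ℂ) i j := by
  have hmem : ∀ a ∈ R.charpoly.roots, a ∈ spectrum ℂ R := fun a ha =>
    Matrix.mem_spectrum_iff_isRoot_charpoly.2 (Polynomial.isRoot_of_mem_roots ha)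
  obtain ⟨l, hl⟩ : ∃ l : List ℂ, (l : Multiset ℂ) = R.charpoly.roots :=
    ⟨_, Multiset.coe_toList _⟩
  have hCH : (l.map fun a => R - a • (1 : Matrix (Fin d) (Fin d) ℂ)).reverse.prod = 0 := by
    have h1 : R.charpoly = ((l.reverse.map fun a => Polynomial.X - Polynomial.C a)).prod := by
      conv_lhs => rw [(IsAlgClosed.splits R.charpoly).eq_prod_roots_of_monic
        (Matrix.charpoly_monic R)]
      rw [← hl, ← Multiset.coe_reverse, Multiset.map_coe, Multiset.prod_coe]
    have h2 := Matrix.aeval_self_charpoly R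
    rw [h1, map_list_prod, List.map_map] at h2
    rw [← List.map_reverse, ← h2]
    congr 2
    ext a : 1
    simp [Algebra.algebraMap_eq_smul_one]
  have hl' : ∀ a ∈ l, a ∉ trace γ ∧ windingNumber γ a = w := fun a ha =>
    have : a ∈ spectrum ℂ R := hmem a (by rw [← hl]; exact ha)
    ⟨hR a this, hw a this⟩
  cases l with
  | nil =>
    -- An empty list of eigenvalues means `d = 0`.
    have h1 : (1 : Matrix (Fin d) (Fin d) ℂ) = 0 := by simpa using hCH
    have h2 : ∀ M : Matrix (Fin d) (Fin d) ℂ, M = 0 := fun M => by rw [← one_mul M, h1, zero_mul]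
    simp_rw [h2 (_ : Matrix (Fin d) (Fin d) ℂ)⁻¹, h1]
    simp [contourIntegral]
  | cons a l =>
    have ha := hl' a (by simp)
    have hs : ∀ b ∈ ({a} : Multiset ℂ), b ∉ trace γ ∧ windingNumber γ b = w := by
      intro b hb
      rw [Multiset.mem_singleton.1 hb]
      exact ha
    have hc := continuousOn_inv_prod (γ := γ) {a} fun b hb => (hs b hb).1
    -- The first eigenvalue yields the only simple pole, whose integral is the winding number; the
    -- remainder vanishes by the previous lemma.
    have hsplit : contourIntegral γ (fun z => (z • 1 - R)⁻¹ i j) =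
        contourIntegral γ (fun z => (z - a)⁻¹) * (1 : Matrix (Fin d) (Fin d) ℂ) i j +
        contourIntegral γ (fun z => ((({a} : Multiset ℂ).map fun a => z - a).prod)⁻¹ *
          ((z • 1 - R)⁻¹ * (R - a • 1)) i j) := by
      rw [← contourIntegral_mul_const, ← hγ.contourIntegral_add
        (ContinuousOn.fun_mul (f := fun z => (z - a)⁻¹) (by simpa using hc) continuousOn_const)
        (hc.fun_mul (continuousOn_resolvent_entry hR _ i j))]
      refine contourIntegral_congr fun z hz => ?_
      have hza : z - a ≠ 0 := fun h => ha.1 (sub_eq_zero.1 h ▸ hz)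
      have := resolvent_mul_eq (fun h => hR z h hz) hza 1
      rw [mul_one, mul_one] at this
      conv_lhs => rw [this]
      simp only [Matrix.smul_apply, Matrix.add_apply, smul_eq_mul, Multiset.map_singleton,
        Multiset.prod_singleton]
      ring
    rw [hsplit, hγ.contourIntegral_inv_prod_mul_resolvent hR l (fun b hb => hl' b (by simp [hb]))
      {a} hs (by simp) (R - a • 1) (by rw [← hCH]; simp), add_zero, ← mul_assoc]
    rw [← ha.2, windingNumber]

/-- The residues satisfy the moment equations. -/
lemma sum_pow_mul_contourResidue {d m p q : ℕ} {A : ℕ → Matrix (Fin d) (Fin d) ℝ}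
    {B : ℕ → Matrix (Fin d) (Fin m) ℝ} (hqp : q < p) {R : Fin p → Matrix (Fin d) (Fin d) ℂ}
    (hR : IsCompleteRegularSolvents p A R) {Γ : Fin p → ℝ → ℂ}
    (hΓ : ∀ k, IsResidueContour p A (R k) (Γ k)) (b : ℕ) (hb : b < p) :
    ∑ k, R k ^ b * contourResidue (Γ k) (transferFun p q A B) =
      complexBeta p q A B (b + 1) := by
  obtain ⟨N, hN⟩ := exists_vandermonde_solution hR fun b => complexBeta p q A B (b + 1)
  rw [← hN b hb]
  refine Finset.sum_congr rfl fun k _ => ?_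
  congr 1
  have hmem : ∀ l, spectrum ℂ (R l) ⊆ polySpectrum (arPoly p A) := fun l => by
    rw [hR.2]; exact Set.subset_iUnion (fun l => spectrum ℂ (R l)) l
  have hav : ∀ z ∈ trace (Γ k), z ∉ polySpectrum (arPoly p A) := by
    rintro _ ⟨s, hs, rfl⟩ h
    exact (hΓ k).avoids_exterior_set s hs ⟨h, (hΓ k).avoids_interior_set s hs⟩
  have hav' : ∀ l, ∀ z ∈ spectrum ℂ (R l), z ∉ trace (Γ k) := fun l z hz h =>
    hav z h (hmem l hz)
  ext i j
  have h1 : contourIntegral (Γ k) (fun z => transferFun p q A B z i j) =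
      ∑ l, ∑ c, contourIntegral (Γ k) (fun z => (z • 1 - R l)⁻¹ i c) * N l c j := by
    simp_rw [← contourIntegral_mul_const]
    have hcont : ∀ l c, ContinuousOn (fun z : ℂ => (z • 1 - R l)⁻¹ i c * N l c j)
        (trace (Γ k)) := fun l c => by
      have := continuousOn_resolvent_entry (hav' l) 1 i c
      simp_rw [mul_one] at this
      exact this.mul continuousOn_const
    simp_rw [← (hΓ k).contour.contourIntegral_sum Finset.univ (fun c _ => hcont _ c)]
    rw [← (hΓ k).contour.contourIntegral_sum Finset.univ
      (fun l _ => continuousOn_finsetSum _ fun c _ => hcont l c)]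
    refine contourIntegral_congr fun z hz => ?_
    rw [transferFun_eq_sum hqp hR hN (hav z hz), Matrix.sum_apply]
    simp_rw [Matrix.mul_apply]
  -- `Γ k` winds once around the spectrum of `R k` and not at all around the other spectra, which
  -- disjointness places in the exterior.
  rw [contourResidue, Matrix.of_apply, h1, Finset.mul_sum, Finset.sum_eq_single k]
  · rw [Finset.mul_sum]
    simp_rw [← mul_assoc, (hΓ k).contour.contourIntegral_resolvent (hav' k) (hΓ k).interior,
      one_mul]
    rw [← Matrix.mul_apply, Matrix.one_mul]
  · intro l _ hl
    rw [Finset.mul_sum]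
    refine Finset.sum_eq_zero fun c _ => ?_
    rw [← mul_assoc, (hΓ k).contour.contourIntegral_resolvent (hav' l) (w := 0), zero_mul, zero_mul]
    exact fun a ha => (hΓ k).exterior a
      ⟨hmem l ha, fun h => Set.disjoint_left.1 (disjoint_spectrum hR hl) ha h⟩
  · simp

/-! ### Decay and differentiability of the matrix exponential. -/

section Exponential

open scoped Matrix.Norms.Operator

lemma hasSum_exp {d : ℕ} (R : Matrix (Fin d) (Fin d) ℂ) :
    HasSum (fun n : ℕ => ((n.factorial : ℂ)⁻¹) • R ^ n) (NormedSpace.exp R) :=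
  NormedSpace.exp_series_hasSum_exp' (𝕂 := ℂ) R

/-- The algebra `ℂ[R]` is finite-dimensional, hence closed, and it contains the partial sums of the
exponential series. This brings the exponential under the polynomial spectral mapping theorem. -/
lemma exists_aeval_eq_exp {d : ℕ} (R : Matrix (Fin d) (Fin d) ℂ) :
    ∃ f : Polynomial ℂ, Polynomial.aeval R f = NormedSpace.exp R := by
  have hcl : IsClosed ((Subalgebra.toSubmodule (Algebra.adjoin ℂ {R}) :
      Submodule ℂ (Matrix (Fin d) (Fin d) ℂ)) : Set (Matrix (Fin d) (Fin d) ℂ)) :=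
    Submodule.closed_of_finiteDimensional _
  have hmem : NormedSpace.exp R ∈ Algebra.adjoin ℂ {R} := by
    refine hcl.mem_of_tendsto (hasSum_exp R) (Eventually.of_forall fun s => ?_)
    exact Submodule.sum_mem _ fun n _ => Submodule.smul_mem _ _
      (Subalgebra.pow_mem _ (Algebra.self_mem_adjoin_singleton ℂ R) n)
  rw [Algebra.adjoin_singleton_eq_range_aeval] at hmem
  exact hmem

lemma pow_mulVec_of_mulVec {d : ℕ} {R : Matrix (Fin d) (Fin d) ℂ} {z : ℂ} {v : Fin d → ℂ}
    (h : R.mulVec v = z • v) (n : ℕ) : (R ^ n).mulVec v = z ^ n • v := by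
  induction n with
  | zero => simp
  | succ n ih =>
    rw [pow_succ, ← Matrix.mulVec_mulVec, h, Matrix.mulVec_smul, ih, smul_smul, pow_succ, mul_comm]

lemma exp_mulVec_of_mulVec {d : ℕ} {R : Matrix (Fin d) (Fin d) ℂ} {z : ℂ} {v : Fin d → ℂ}
    (h : R.mulVec v = z • v) : (NormedSpace.exp R).mulVec v = Complex.exp z • v := by
  have h1 : HasSum (fun n : ℕ => (((n.factorial : ℂ)⁻¹) • R ^ n).mulVec v)
      ((NormedSpace.exp R).mulVec v) := by
    refine (hasSum_exp R).map
      (AddMonoidHom.mk' (fun M : Matrix (Fin d) (Fin d) ℂ => M.mulVec v)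
        (fun M N => Matrix.add_mulVec M N v)) ?_
    exact continuous_id.matrix_mulVec continuous_const
  have h2 : HasSum (fun n : ℕ => (((n.factorial : ℂ)⁻¹) • z ^ n) • v) (Complex.exp z • v) := by
    rw [Complex.exp_eq_exp_ℂ]
    exact (NormedSpace.exp_series_hasSum_exp' (𝕂 := ℂ) z).smul_const v
  refine h1.unique ?_
  convert h2 using 2 with n
  rw [Matrix.smul_mulVec, pow_mulVec_of_mulVec h, smul_assoc]

lemma exists_eigenvector {d : ℕ} {R : Matrix (Fin d) (Fin d) ℂ} {z : ℂ} (hz : z ∈ spectrum ℂ R) :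
    ∃ v ≠ 0, R.mulVec v = z • v := by
  have h : ¬IsUnit (z • (1 : Matrix (Fin d) (Fin d) ℂ) - R) := by
    simpa [spectrum.mem_iff, Algebra.algebraMap_eq_smul_one] using hz
  rw [Matrix.isUnit_iff_isUnit_det, isUnit_iff_ne_zero, not_not,
    ← Matrix.exists_mulVec_eq_zero_iff] at h
  obtain ⟨v, hv, h⟩ := h
  refine ⟨v, hv, ?_⟩
  rw [Matrix.sub_mulVec, Matrix.smul_mulVec, Matrix.one_mulVec, sub_eq_zero] at h
  exact h.symm

/-- Write `exp R = f(R)`; spectral mapping gives `w = f(z)` for an eigenvalue `z`, and comparing the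
two actions on an eigenvector gives `f(z) = exp z`. -/
lemma exists_of_mem_spectrum_exp {d : ℕ} {R : Matrix (Fin d) (Fin d) ℂ} {w : ℂ}
    (hw : w ∈ spectrum ℂ (NormedSpace.exp R)) : ∃ z ∈ spectrum ℂ R, Complex.exp z = w := by
  rcases isEmpty_or_nonempty (Fin d) with hd | hd
  · exact absurd hw (by simp [spectrum.of_subsingleton])
  obtain ⟨f, hf⟩ := exists_aeval_eq_exp R
  rw [← hf, spectrum.map_polynomial_aeval_of_nonempty _ _
        (spectrum.nonempty_of_isAlgClosed_of_finiteDimensional ℂ R)] at hw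
  obtain ⟨z, hz, rfl⟩ := hw
  refine ⟨z, hz, ?_⟩
  obtain ⟨v, hv, h⟩ := exists_eigenvector hz
  have h1 := exp_mulVec_of_mulVec h
  have h2 : (Polynomial.aeval R f).mulVec v = f.eval z • v := by
    rw [Polynomial.aeval_eq_sum_range, Matrix.sum_mulVec, Polynomial.eval_eq_sum_range,
      Finset.sum_smul]
    refine Finset.sum_congr rfl fun n _ => ?_
    rw [Matrix.smul_mulVec, pow_mulVec_of_mulVec h, smul_smul]
  rw [hf, h1] at h2
  exact smul_left_injective ℂ hv h2

lemma exp_add_smul {d : ℕ} (R : Matrix (Fin d) (Fin d) ℂ) (a b : ℂ) :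
    NormedSpace.exp ((a + b) • R) = NormedSpace.exp (a • R) * NormedSpace.exp (b • R) := by
  rw [add_smul, Matrix.exp_add_of_commute _ _ (((Commute.refl R).smul_left a).smul_right b)]

/-- Eigenvalues of `exp R` are `e^z` with `Re z < 0`, so the spectral radius is below one, and
Gelfand's formula provides a power of norm below one. -/
lemma exists_norm_exp_lt_one {d : ℕ} {R : Matrix (Fin d) (Fin d) ℂ}
    (hR : ∀ z ∈ spectrum ℂ R, z.re < 0) :
    ∃ n : ℕ, 0 < n ∧ ‖NormedSpace.exp ((n : ℂ) • R)‖ < 1 := by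
  rcases isEmpty_or_nonempty (Fin d) with hd | hd
  · refine ⟨1, one_pos, ?_⟩
    rw [Subsingleton.elim (NormedSpace.exp (((1 : ℕ) : ℂ) • R)) 0, norm_zero]
    exact one_pos
  have hsr : spectralRadius ℂ (NormedSpace.exp R) < (1 : NNReal) := by
    refine spectrum.spectralRadius_lt_of_forall_lt_of_nonempty
      (spectrum.nonempty_of_isAlgClosed_of_finiteDimensional ℂ _) fun w hw => ?_
    obtain ⟨z, hz, rfl⟩ := exists_of_mem_spectrum_exp hw
    rw [← NNReal.coe_lt_coe, coe_nnnorm, Complex.norm_exp, NNReal.coe_one, Real.exp_lt_one_iff]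
    exact hR z hz
  have hG := spectrum.pow_nnnorm_pow_one_div_tendsto_nhds_spectralRadius (NormedSpace.exp R)
  obtain ⟨n, hn, hn0⟩ := ((hG.eventually (gt_mem_nhds hsr)).and (eventually_gt_atTop 0)).exists
  refine ⟨n, hn0, ?_⟩
  have h1 : (‖NormedSpace.exp R ^ n‖₊ : ENNReal) < 1 := by
    by_contra h
    rw [not_lt] at h
    have := ENNReal.one_le_rpow h (z := 1 / (n : ℝ)) (by positivity)
    exact absurd hn (not_lt.2 (by simpa using this))
  have h2 : NormedSpace.exp ((n : ℂ) • R) = NormedSpace.exp R ^ n := by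
    rw [← Matrix.exp_nsmul, Nat.cast_smul_eq_nsmul]
  rw [h2, ← coe_nnnorm]
  exact_mod_cast h1

lemma continuous_exp_smul {d : ℕ} (R : Matrix (Fin d) (Fin d) ℂ) :
    Continuous fun v : ℝ => NormedSpace.exp ((v : ℂ) • R) :=
  (NormedSpace.exp_continuous (𝔸 := Matrix (Fin d) (Fin d) ℂ)).comp (by fun_prop)

/-- Exponential decay of the semigroup generated by a stable matrix. -/
lemma exists_norm_exp_le {d : ℕ} {R : Matrix (Fin d) (Fin d) ℂ}
    (hR : ∀ z ∈ spectrum ℂ R, z.re < 0) :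
    ∃ c > 0, ∃ C ≥ 0, ∀ v : ℝ, 0 ≤ v →
      ‖NormedSpace.exp ((v : ℂ) • R)‖ ≤ C * Real.exp (-c * v) := by
  obtain ⟨n, hn, hlt⟩ := exists_norm_exp_lt_one hR
  obtain ⟨ρ, hρ, hρ1⟩ := exists_between hlt
  have hρ0 : 0 < ρ := (norm_nonneg _).trans_lt hρ
  have hn' : (0 : ℝ) < n := by exact_mod_cast hn
  obtain ⟨K, hK⟩ := (isCompact_Icc (a := (0 : ℝ)) (b := n)).exists_bound_of_continuousOn
    (continuous_exp_smul R).continuousOn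
  have hK0 : 0 ≤ K := (norm_nonneg _).trans (hK 0 ⟨le_rfl, hn'.le⟩)
  have hlog : Real.log ρ < 0 := Real.log_neg hρ0 hρ1
  -- For `v = j n + s` with `0 ≤ s ≤ n` the norm is at most `ρ^j K`. Since `j` can fall short of `v
  -- / n` by up to one, a factor `ρ⁻¹` is lost.
  refine ⟨-Real.log ρ / n, div_pos (neg_pos.2 hlog) hn', K * ρ⁻¹, by positivity, fun v hv => ?_⟩
  have hstep : ∀ j : ℕ, ∀ s ∈ Set.Icc (0 : ℝ) n,
      ‖NormedSpace.exp (((j * n + s : ℝ) : ℂ) • R)‖ ≤ ρ ^ j * K := by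
    intro j
    induction j with
    | zero => intro s hs; simpa using hK s hs
    | succ j ih =>
      intro s hs
      have : (((j + 1 : ℕ) * n + s : ℝ) : ℂ) = (n : ℂ) + ((j * n + s : ℝ) : ℂ) := by
        push_cast; ring
      rw [this, exp_add_smul, pow_succ']
      refine (norm_mul_le _ _).trans ?_
      rw [mul_assoc]
      exact mul_le_mul hρ.le (ih s hs) (norm_nonneg _) hρ0.le
  set j := ⌊v / n⌋₊ with hj
  have hj1 : (j : ℝ) ≤ v / n := Nat.floor_le (by positivity)
  have hj2 : v / n < j + 1 := Nat.lt_floor_add_one _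
  have hs : v - j * n ∈ Set.Icc (0 : ℝ) n := by
    rw [le_div_iff₀ hn'] at hj1
    rw [div_lt_iff₀ hn'] at hj2
    constructor <;> linarith
  have h1 := hstep j _ hs
  rw [add_sub_cancel] at h1
  refine h1.trans ?_
  have h2 : ρ ^ j ≤ ρ⁻¹ * Real.exp (-(-Real.log ρ / n) * v) := by
    have : ρ⁻¹ = Real.exp (-Real.log ρ) := by rw [Real.exp_neg, Real.exp_log hρ0]
    rw [this, ← Real.exp_add]
    have : ρ ^ j = Real.exp (j * Real.log ρ) := by rw [mul_comm, Real.exp_mul, Real.exp_log hρ0,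
      Real.rpow_natCast]
    rw [this, Real.exp_le_exp]
    have : -(-Real.log ρ / n) * v = (v / n) * Real.log ρ := by ring
    rw [this]
    nlinarith
  calc ρ ^ j * K ≤ (ρ⁻¹ * Real.exp (-(-Real.log ρ / n) * v)) * K := by gcongr
    _ = _ := by ring

lemma hasDerivAt_exp_smul {d : ℕ} (R : Matrix (Fin d) (Fin d) ℂ) (v : ℝ) :
    HasDerivAt (fun v : ℝ => NormedSpace.exp ((v : ℂ) • R))
      (R * NormedSpace.exp ((v : ℂ) • R)) v := by
  have := (hasDerivAt_exp_smul_const' (𝕂 := ℂ) R (v : ℂ)).scomp_of_eq v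
    (Complex.ofRealCLM.hasDerivAt (x := v)) rfl
  exact this.congr_deriv (by
    rw [show Complex.ofRealCLM (1 : ℝ) = 1 from Complex.ofReal_one, one_smul]
    rfl)

lemma hasDerivAt_exp_smul_entry {d : ℕ} (R : Matrix (Fin d) (Fin d) ℂ) (v : ℝ) (i j : Fin d) :
    HasDerivAt (fun v : ℝ => NormedSpace.exp ((v : ℂ) • R) i j)
      ((R * NormedSpace.exp ((v : ℂ) • R)) i j) v := by
  let e : Matrix (Fin d) (Fin d) ℂ →L[ℝ] ℂ :=
    LinearMap.toContinuousLinearMap (Matrix.entryLinearMap ℝ ℂ i j)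
  exact (e.hasFDerivAt (x := NormedSpace.exp ((v : ℂ) • R))).comp_hasDerivAt v
    (hasDerivAt_exp_smul R v)

end Exponential

/-! ### Reality of the moments and of the summed kernel. -/

/-- The moments of the residues are real. -/
lemma im_sum_pow_mul_eq_zero {d m p q : ℕ} {A : ℕ → Matrix (Fin d) (Fin d) ℝ}
    {B : ℕ → Matrix (Fin d) (Fin m) ℝ} {R : Fin p → Matrix (Fin d) (Fin d) ℂ}
    (hR : ∀ k, IsRightSolvent p A (R k)) {N : Fin p → Matrix (Fin d) (Fin m) ℂ}
    (hN : ∀ b < p, ∑ k, R k ^ b * N k = complexBeta p q A B (b + 1)) (b : ℕ) (i : Fin d)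
    (j : Fin m) : ((∑ k, R k ^ b * N k) i j).im = 0 := by
  induction b using Nat.strong_induction_on generalizing i with
  | _ b ih =>
    by_cases hb : b < p
    · rw [hN b hb]
      simp [complexBeta, toComplex]
    -- From `b = p` on, the solvent equation expresses a moment through the `p` preceding ones with
    -- the real coefficients `A i`.
    · obtain ⟨c, rfl⟩ : ∃ c, b = c + p := ⟨b - p, by omega⟩
      have h : ∑ k, R k ^ (c + p) * N k =
          -∑ i ∈ Finset.Icc 1 p, toComplex (A i) * ∑ k, R k ^ (c + (p - i)) * N k := by
        simp_rw [Matrix.mul_sum]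
        rw [Finset.sum_comm, ← Finset.sum_neg_distrib]
        refine Finset.sum_congr rfl fun k _ => ?_
        have := hR k
        rw [IsRightSolvent] at this
        rw [add_comm c p, pow_add, eq_neg_of_add_eq_zero_left this, neg_mul, Finset.sum_mul,
          Matrix.neg_mul, Matrix.sum_mul]
        simp_rw [mul_assoc, ← pow_add, add_comm c, Matrix.mul_assoc]
      rw [h, Matrix.neg_apply, Complex.neg_im, Matrix.sum_apply, Complex.im_sum, neg_eq_zero]
      refine Finset.sum_eq_zero fun l hl => ?_
      rw [Finset.mem_Icc] at hl
      rw [Matrix.mul_apply, Complex.im_sum]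
      refine Finset.sum_eq_zero fun e _ => ?_
      rw [Complex.mul_im, ih _ (by omega) e]
      simp [toComplex]

/-- The summed kernel is a power series in `t - u` whose coefficients are real multiples of the
moments `∑ R_k^n N_k`; these are real although the single terms need not be. -/
lemma im_sum_ouKernel_eq_zero {d m p q : ℕ} {A : ℕ → Matrix (Fin d) (Fin d) ℝ}
    {B : ℕ → Matrix (Fin d) (Fin m) ℝ} {R : Fin p → Matrix (Fin d) (Fin d) ℂ}
    (hR : ∀ k, IsRightSolvent p A (R k)) {N : Fin p → Matrix (Fin d) (Fin m) ℂ}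
    (hN : ∀ b < p, ∑ k, R k ^ b * N k = complexBeta p q A B (b + 1)) (t u : ℝ) (i : Fin d)
    (j : Fin m) : ((∑ k, ouKernel (R k) (N k) t u) i j).im = 0 := by
  set v := t - u
  have h1 : HasSum (fun n : ℕ => ∑ k, (((n.factorial : ℂ)⁻¹) • ((v : ℂ) • R k) ^ n) * N k)
      (∑ k, ouKernel (R k) (N k) t u) := by
    refine hasSum_sum fun k _ => ?_
    refine (hasSum_exp ((v : ℂ) • R k)).map
      (AddMonoidHom.mk' (fun M : Matrix (Fin d) (Fin d) ℂ => M * N k)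
        (fun M M' => Matrix.add_mul M M' _)) ?_
    exact continuous_id.matrix_mul continuous_const
  have h2 := Complex.hasSum_im (Pi.hasSum.1 (Pi.hasSum.1 h1 i) j)
  refine h2.unique ?_
  convert hasSum_zero using 2 with n
  have : ∑ k, (((n.factorial : ℂ)⁻¹) • ((v : ℂ) • R k) ^ n) * N k =
      (((n.factorial : ℝ)⁻¹ * v ^ n : ℝ) : ℂ) • ∑ k, R k ^ n * N k := by
    rw [Finset.smul_sum]
    refine Finset.sum_congr rfl fun k _ => ?_
    rw [smul_pow, smul_smul, Matrix.smul_mul]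
    push_cast
    rfl
  rw [this, Matrix.smul_apply, smul_eq_mul, Complex.im_ofReal_mul,
    im_sum_pow_mul_eq_zero hR hN, mul_zero]

/-! ### Càdlàg functions. -/

section Cadlag

lemma IsCadlag.exists_bound {E : Type*} [NormedAddCommGroup E] {x : ℝ → E} (hx : IsCadlag x)
    (a b : ℝ) : ∃ C ≥ 0, ∀ u ∈ Set.Icc a b, ‖x u‖ ≤ C := by
  have h : ∃ C, ∀ u ∈ Set.Icc a b, ‖x u‖ ≤ C := by
    refine isCompact_Icc.induction_on (p := fun s => ∃ C, ∀ u ∈ s, ‖x u‖ ≤ C) ⟨0, by simp⟩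
      (fun s t hst ⟨C, hC⟩ => ⟨C, fun u hu => hC u (hst hu)⟩) ?_ fun t _ => ?_
    · rintro s t ⟨C, hC⟩ ⟨C', hC'⟩
      refine ⟨max C C', ?_⟩
      rintro u (hu | hu)
      · exact (hC u hu).trans (le_max_left _ _)
      · exact (hC' u hu).trans (le_max_right _ _)
    · obtain ⟨hr, l, hl⟩ := hx t
      have h1 : ∀ᶠ u in 𝓝[≥] t, ‖x u‖ < ‖x t‖ + 1 :=
        hr.norm.eventually (gt_mem_nhds (lt_add_one _))
      have h2 : ∀ᶠ u in 𝓝[<] t, ‖x u‖ < ‖l‖ + 1 := hl.norm.eventually (gt_mem_nhds (lt_add_one _))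
      have h3 : ∀ᶠ u in 𝓝 t, ‖x u‖ ≤ max (‖l‖ + 1) (‖x t‖ + 1) := by
        rw [← nhdsLT_sup_nhdsGE, eventually_sup]
        exact ⟨h2.mono fun u hu => hu.le.trans (le_max_left _ _),
          h1.mono fun u hu => hu.le.trans (le_max_right _ _)⟩
      exact ⟨_, mem_nhdsWithin_of_mem_nhds h3, _, fun u hu => hu⟩
  obtain ⟨C, hC⟩ := h
  exact ⟨max C 0, le_max_right _ _, fun u hu => (hC u hu).trans (le_max_left _ _)⟩

/-- The smallest multiple of `1 / (n + 1)` exceeding `u`. -/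
noncomputable def gridAbove (n : ℕ) (u : ℝ) : ℝ := (⌊u * (n + 1)⌋ + 1) / (n + 1)

lemma lt_gridAbove (n : ℕ) (u : ℝ) : u < gridAbove n u := by
  rw [gridAbove, lt_div_iff₀ (by positivity)]
  exact Int.lt_floor_add_one _

lemma gridAbove_le (n : ℕ) (u : ℝ) : gridAbove n u ≤ u + 1 / (n + 1) := by
  rw [gridAbove, div_le_iff₀ (by positivity), add_mul, one_div, inv_mul_cancel₀ (by positivity)]
  have := Int.floor_le (u * (n + 1))
  linarith

lemma tendsto_gridAbove (u : ℝ) : Tendsto (fun n => gridAbove n u) atTop (𝓝[>] u) := by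
  refine tendsto_nhdsWithin_iff.2 ⟨?_, Eventually.of_forall fun n => lt_gridAbove n u⟩
  refine tendsto_of_tendsto_of_tendsto_of_le_of_le tendsto_const_nhds ?_
    (fun n => (lt_gridAbove n u).le) (fun n => gridAbove_le n u)
  simpa using tendsto_const_nhds.add (tendsto_one_div_add_atTop_nhds_zero_nat (𝕜 := ℝ))

/-- By right-continuity `x` is the pointwise limit of `x ∘ gridAbove n`, and these depend on `u`
only through an integer part. -/
lemma IsCadlag.measurable {E : Type*} [NormedAddCommGroup E] [MeasurableSpace E] [BorelSpace E]
    {x : ℝ → E} (hx : IsCadlag x) : Measurable x := by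
  refine measurable_of_tendsto_metrizable (f := fun n u => x (gridAbove n u)) (fun n => ?_) ?_
  · have h : Measurable fun k : ℤ => x ((k + 1) / (n + 1)) := measurable_from_top
    exact h.comp (Int.measurable_floor.comp (measurable_id.mul_const _))
  · refine tendsto_pi_nhds.2 fun u => ?_
    exact ((hx u).1.mono_left (nhdsWithin_mono _ Set.Ioi_subset_Ici_self)).comp
      (tendsto_gridAbove u)

/-- Just to the right of `t`, values and left limits are all close to `x t`, so no jump above a
fixed threshold occurs there. Each `D n` thus consists of points isolated on the right, and such
points are countable in any set of reals. -/
lemma IsCadlag.countable_not_continuousAt {E : Type*} [NormedAddCommGroup E] {x : ℝ → E}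
    (hx : IsCadlag x) : {t | ¬ContinuousAt x t}.Countable := by
  choose l hl using fun t => (hx t).2
  set D : ℕ → Set ℝ := fun n => {t | 1 / ((n : ℝ) + 1) < ‖l t - x t‖} with hD
  have hsub : {t | ¬ContinuousAt x t} ⊆ ⋃ n, D n := by
    intro t ht
    have hne : l t ≠ x t := by
      intro h
      refine ht ?_
      rw [ContinuousAt, ← nhdsLT_sup_nhdsGE, tendsto_sup]
      exact ⟨h ▸ hl t, (hx t).1⟩
    obtain ⟨n, hn⟩ := exists_nat_one_div_lt (norm_pos_iff.2 (sub_ne_zero.2 hne))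
    exact Set.mem_iUnion.2 ⟨n, hn⟩
  refine (Set.countable_iUnion fun n => ?_).mono hsub
  refine Set.Countable.mono ?_ (countable_setOfPred_isolated_right_within (s := D n))
  intro t ht
  refine ⟨ht, ?_⟩
  have hε : 0 < 1 / ((n : ℝ) + 1) / 2 := by positivity
  have h1 : ∀ᶠ u in 𝓝[>] t, ‖x u - x t‖ < 1 / ((n : ℝ) + 1) / 2 := by
    have := ((hx t).1.mono_left (nhdsWithin_mono _ Set.Ioi_subset_Ici_self)).sub_const (x t)
    have h2 := this.norm
    rw [sub_self, norm_zero] at h2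
    exact h2.eventually (gt_mem_nhds hε)
  obtain ⟨y, hty, hy⟩ := mem_nhdsGT_iff_exists_Ioo_subset.1 h1
  refine empty_mem_iff_bot.1 (mem_nhdsWithin.2 ⟨Set.Iio y, isOpen_Iio, hty, ?_⟩)
  rintro u ⟨huy, huD, hut⟩
  have hu : u ∈ Set.Ioo t y := ⟨hut, huy⟩
  have h3 : ‖l u - x t‖ ≤ 1 / ((n : ℝ) + 1) / 2 := by
    refine le_of_tendsto ((hl u).sub_const (x t)).norm ?_
    filter_upwards [Ioo_mem_nhdsLT hu.1] with v hv
    exact (hy ⟨hv.1, hv.2.trans hu.2⟩ : ‖x v - x t‖ < _).le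
  have h4 : ‖x u - x t‖ < 1 / ((n : ℝ) + 1) / 2 := hy hu
  have h5 : ‖l u - x u‖ ≤ ‖l u - x t‖ + ‖x u - x t‖ := by
    rw [← norm_neg (x u - x t), neg_sub]
    exact norm_sub_le_norm_sub_add_norm_sub _ _ _
  have h6 : 1 / ((n : ℝ) + 1) < ‖l u - x u‖ := huD
  linarith

lemma IsCadlag.comp {E F : Type*} [TopologicalSpace E] [TopologicalSpace F] {x : ℝ → E}
    (hx : IsCadlag x) {f : E → F} (hf : Continuous f) : IsCadlag fun t => f (x t) := fun t =>
  ⟨hf.continuousAt.comp_continuousWithinAt (hx t).1,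
    (hx t).2.imp' f fun l hl => (hf.tendsto l).comp hl⟩

lemma _root_.Continuous.isCadlag {E : Type*} [TopologicalSpace E] {x : ℝ → E}
    (hx : Continuous x) : IsCadlag x := fun t =>
  ⟨hx.continuousWithinAt, x t, hx.continuousAt.tendsto.mono_left nhdsWithin_le_nhds⟩

lemma IsCadlag.add {E : Type*} [TopologicalSpace E] [Add E] [ContinuousAdd E] {x y : ℝ → E}
    (hx : IsCadlag x) (hy : IsCadlag y) : IsCadlag fun t => x t + y t := fun t =>
  ⟨(hx t).1.add (hy t).1, by
    obtain ⟨l, hl⟩ := (hx t).2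
    obtain ⟨l', hl'⟩ := (hy t).2
    exact ⟨l + l', hl.add hl'⟩⟩

lemma isCadlag_pi {ι : Type*} {E : ι → Type*} [∀ i, TopologicalSpace (E i)] {x : ℝ → ∀ i, E i}
    (hx : ∀ i, IsCadlag fun t => x t i) : IsCadlag x := fun t =>
  ⟨continuousWithinAt_pi.2 fun i => (hx i t).1, by
    choose l hl using fun i => (hx i t).2
    exact ⟨l, tendsto_pi_nhds.2 hl⟩⟩

/-- Two càdlàg functions agreeing on the rationals agree. -/
lemma IsCadlag.eq_of_eq_rat {E : Type*} [TopologicalSpace E] [T2Space E] {x y : ℝ → E}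
    (hx : IsCadlag x) (hy : IsCadlag y) (h : ∀ r : ℚ, x r = y r) (t : ℝ) : x t = y t := by
  have h1 := ((hx t).1.mono_left (nhdsWithin_mono _ Set.Ioi_subset_Ici_self)).comp
    (tendsto_gridAbove t)
  have h2 := ((hy t).1.mono_left (nhdsWithin_mono _ Set.Ioi_subset_Ici_self)).comp
    (tendsto_gridAbove t)
  refine tendsto_nhds_unique h1 (h2.congr fun n => ?_)
  have := h ((⌊t * (n + 1)⌋ + 1) / (n + 1))
  push_cast at this
  exact this.symm

end Cadlag

/-! ### Pathwise Riemann–Stieltjes integrals by parts. -/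

section RiemannStieltjes

open scoped Matrix.Norms.Operator

/-- A real vector seen as a complex vector. -/
def cvec {m : Type*} (v : m → ℝ) : m → ℂ := fun b => (v b : ℂ)

lemma continuous_cvec {m : Type*} : Continuous (cvec : (m → ℝ) → m → ℂ) :=
  continuous_pi fun b => Complex.continuous_ofReal.comp (continuous_apply b)

lemma cvec_sub {m : Type*} (v w : m → ℝ) : cvec (v - w) = cvec v - cvec w := by
  ext; simp [cvec]

lemma norm_cvec {m : Type*} [Fintype m] (v : m → ℝ) : ‖cvec v‖ = ‖v‖ := by
  simp [Pi.norm_def, cvec]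

lemma IsTaggedPartition.mono {s t δ : ℝ} {n : ℕ} {τ ξ : ℕ → ℝ} (h : IsTaggedPartition s t δ n τ ξ)
    {i j : ℕ} (hij : i ≤ j) (hj : j ≤ n) : τ i ≤ τ j := by
  induction j, hij using Nat.le_induction with
  | base => exact le_rfl
  | succ j _ ih =>
    exact (ih (by omega)).trans ((h.2.2 j (by omega)).1.trans (h.2.2 j (by omega)).2.1)

/-- The tags increase, so `u ≤ ξ i` holds exactly from some index `j` on, and the sum telescopes. -/
lemma exists_sum_ite_eq {E : Type*} [AddCommGroup E] (y : ℝ → E) {τ ξ : ℕ → ℝ} (u : ℝ) (n : ℕ)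
    (h : ∀ i < n, τ i ≤ ξ i ∧ ξ i ≤ τ (i + 1)) :
    ∃ j ≤ n, ∑ i ∈ Finset.range n, (if u ≤ ξ i then y (τ (i + 1)) - y (τ i) else 0) =
      y (τ n) - y (τ j) ∧ (∀ i < j, ξ i < u) ∧ ∀ i, j ≤ i → i < n → u ≤ ξ i := by
  induction n with
  | zero => exact ⟨0, le_rfl, by simp, by simp, by simp⟩
  | succ n ih =>
    obtain ⟨j, hj, h1, h2, h3⟩ := ih fun i hi => h i (by omega)
    rw [Finset.sum_range_succ, h1]
    by_cases hu : u ≤ ξ n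
    · refine ⟨j, by omega, by rw [if_pos hu]; abel, h2, fun i hi hin => ?_⟩
      rcases Nat.lt_succ_iff_lt_or_eq.1 hin with h' | h'
      · exact h3 i hi h'
      · exact h' ▸ hu
    · have hjn : j = n := by
        by_contra hne
        have h4 := h3 (n - 1) (by omega) (by omega)
        have h5 := (h (n - 1) (by omega)).2
        rw [show n - 1 + 1 = n by omega] at h5
        exact hu (h4.trans (h5.trans (h n (by omega)).1))
      subst hjn
      refine ⟨j + 1, le_rfl, by rw [if_neg hu]; abel, fun i hi => ?_, fun i hi hin => by omega⟩
      rcases Nat.lt_succ_iff_lt_or_eq.1 hi with h' | h'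
      · exact h2 i h'
      · exact h' ▸ not_le.1 hu

lemma IsTaggedPartition.exists_sum_ite_eq {E : Type*} [AddCommGroup E] (y : ℝ → E)
    {s t δ : ℝ} {n : ℕ} {τ ξ : ℕ → ℝ} (h : IsTaggedPartition s t δ n τ ξ) {u : ℝ}
    (hu : u ∈ Set.Ioc s t) : ∃ r ∈ Set.Icc s t, |r - u| < δ ∧
    ∑ i ∈ Finset.range n, (if u ≤ ξ i then y (τ (i + 1)) - y (τ i) else 0) = y t - y r := by
  obtain ⟨j, hj, h1, h2, h3⟩ := MCARMA.exists_sum_ite_eq y (τ := τ) (ξ := ξ) u n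
    fun i hi => ⟨(h.2.2 i hi).1, (h.2.2 i hi).2.1⟩
  refine ⟨τ j, ⟨h.1 ▸ h.mono (Nat.zero_le j) hj, h.2.1 ▸ h.mono hj le_rfl⟩, ?_, by rw [h1, h.2.1]⟩
  have hn : 0 < n := by
    rcases Nat.eq_zero_or_pos n with h0 | h0
    · subst h0
      have := h.1.symm.trans h.2.1
      exact absurd hu (by simp [this])
    · exact h0
  have hδ : 0 < δ := by
    have := h.2.2 0 hn
    linarith
  -- Here `ξ (j - 1) < u ≤ ξ j` puts `τ j` within one mesh of `u`; for `j = 0` or `j = n` the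
  -- missing inequality is supplied by `s < u ≤ t`.
  rw [abs_lt]
  constructor
  · rcases Nat.lt_or_ge j n with hjn | hjn
    · have := h.2.2 j hjn
      have := h3 j le_rfl hjn
      linarith
    · rw [le_antisymm hj hjn, h.2.1]
      linarith [hu.2]
  · rcases Nat.eq_zero_or_pos j with h0 | h0
    · rw [h0, h.1]
      linarith [hu.1]
    · have h4 := h.2.2 (j - 1) (by omega)
      rw [show j - 1 + 1 = j by omega] at h4
      have := h2 (j - 1) (by omega)
      linarith

/-- `I` is the pathwise Riemann–Stieltjes integral `∫_s^t g(u) dx(u)`. -/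
def HasPathIntegral {d m : ℕ} (x : ℝ → Fin m → ℝ) (g : ℝ → Matrix (Fin d) (Fin m) ℂ) (s t : ℝ)
    (I : Fin d → ℂ) : Prop :=
  ∀ (δ : ℕ → ℝ) (n : ℕ → ℕ) (τ ξ : ℕ → ℕ → ℝ), Tendsto δ atTop (𝓝 0) →
    (∀ k, IsTaggedPartition s t (δ k) (n k) (τ k) (ξ k)) →
    Tendsto (fun k => ∑ i ∈ Finset.range (n k),
      (g (ξ k i)).mulVec (cvec (x (τ k (i + 1)) - x (τ k i)))) atTop (𝓝 I)

/-- Summation by parts: insert `g (ξ i) = g s + ∫_s^{ξ i} g'` and exchange sum and integral. At each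
`u` the increments of the cells with tag at least `u` remain. -/
lemma sum_mulVec_eq {d m : ℕ} {x : ℝ → Fin m → ℝ} {g g' : ℝ → Matrix (Fin d) (Fin m) ℂ}
    (hg : ∀ (v : Fin m → ℂ) u, HasDerivAt (fun u => (g u).mulVec v) ((g' u).mulVec v) u)
    (hg' : Continuous g') {s t δ : ℝ} {n : ℕ} {τ ξ : ℕ → ℝ}
    (h : IsTaggedPartition s t δ n τ ξ) :
    ∑ i ∈ Finset.range n, (g (ξ i)).mulVec (cvec (x (τ (i + 1)) - x (τ i))) =
      (g s).mulVec (cvec (x t) - cvec (x s)) + ∫ u in s..t, (g' u).mulVec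
        (∑ i ∈ Finset.range n,
          if u ≤ ξ i then cvec (x (τ (i + 1))) - cvec (x (τ i)) else 0) := by
  have hc : ∀ v, Continuous fun u => (g' u).mulVec v := fun v =>
    hg'.matrix_mulVec continuous_const
  have h1 : ∀ i, (fun u => (g' u).mulVec
      (if u ≤ ξ i then cvec (x (τ (i + 1))) - cvec (x (τ i)) else 0)) =
      Set.indicator {u | u ≤ ξ i} fun u => (g' u).mulVec (cvec (x (τ (i + 1))) - cvec (x (τ i))) := by
    intro i
    ext1 u
    by_cases hu : u ≤ ξ i
    · rw [if_pos hu, Set.indicator_of_mem (show u ∈ {u | u ≤ ξ i} from hu)]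
    · rw [if_neg hu, Set.indicator_of_notMem (show u ∉ {u | u ≤ ξ i} from hu), Matrix.mulVec_zero]
  have h2 : ∀ i ∈ Finset.range n, IntervalIntegrable (fun u => (g' u).mulVec
      (if u ≤ ξ i then cvec (x (τ (i + 1))) - cvec (x (τ i)) else 0)) volume s t := by
    intro i _
    rw [h1]
    have := (hc (cvec (x (τ (i + 1))) - cvec (x (τ i)))).intervalIntegrable (μ := volume) s t
    exact ⟨this.1.indicator measurableSet_Iic, this.2.indicator measurableSet_Iic⟩
  simp_rw [Matrix.mulVec_sum]
  rw [intervalIntegral.integral_finsetSum h2]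
  have h3 : cvec (x t) - cvec (x s) =
      ∑ i ∈ Finset.range n, (cvec (x (τ (i + 1))) - cvec (x (τ i))) := by
    rw [Finset.sum_range_sub (fun i => cvec (x (τ i))), h.1, h.2.1]
  rw [h3, Matrix.mulVec_sum, ← Finset.sum_add_distrib]
  refine Finset.sum_congr rfl fun i hi => ?_
  rw [Finset.mem_range] at hi
  have hsi : s ≤ ξ i := (h.1 ▸ h.mono (Nat.zero_le i) hi.le).trans (h.2.2 i hi).1
  have hit : ξ i ≤ t := (h.2.2 i hi).2.1.trans (h.2.1 ▸ h.mono hi le_rfl)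
  rw [h1, intervalIntegral.integral_indicator ⟨hsi, hit⟩,
    intervalIntegral.integral_eq_sub_of_hasDerivAt (fun u _ => hg _ u)
      ((hc _).intervalIntegrable _ _), cvec_sub]
  abel

/-- Riemann–Stieltjes sums of a continuously differentiable function along a càdlàg path converge,
and the limit is given by integration by parts. -/
lemma hasPathIntegral_of_hasDerivAt {d m : ℕ} {x : ℝ → Fin m → ℝ} (hx : IsCadlag x)
    {g g' : ℝ → Matrix (Fin d) (Fin m) ℂ}
    (hg : ∀ (v : Fin m → ℂ) u, HasDerivAt (fun u => (g u).mulVec v) ((g' u).mulVec v) u)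
    (hg' : Continuous g') {s t : ℝ} (hst : s ≤ t) :
    HasPathIntegral x g s t ((g s).mulVec (cvec (x t) - cvec (x s)) +
      ∫ u in s..t, (g' u).mulVec (cvec (x t) - cvec (x u))) := by
  intro δ n τ ξ hδ h
  simp_rw [fun k => sum_mulVec_eq (x := x) hg hg' (h k)]
  refine tendsto_const_nhds.add ?_
  set D : ℕ → ℝ → Fin m → ℂ := fun k u => ∑ i ∈ Finset.range (n k),
    if u ≤ ξ k i then cvec (x (τ k (i + 1))) - cvec (x (τ k i)) else 0 with hD
  have hD' : ∀ u ∈ Set.Ioc s t, ∀ k, ∃ r ∈ Set.Icc s t, |r - u| < δ k ∧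
      D k u = cvec (x t) - cvec (x r) := fun u hu k =>
    (h k).exists_sum_ite_eq (fun u => cvec (x u)) hu
  obtain ⟨C, hC0, hC⟩ := hx.exists_bound s t
  obtain ⟨K, hK⟩ := (isCompact_Icc (a := s) (b := t)).exists_bound_of_continuousOn hg'.continuousOn
  have hK0 : 0 ≤ K := (norm_nonneg _).trans (hK s ⟨le_rfl, hst⟩)
  -- The inner sum at `u` is `x t - x r` with `r` within one mesh of `u`: bounded uniformly, and
  -- convergent wherever `x` is continuous, that is, off a countable set.
  refine intervalIntegral.tendsto_integral_filter_of_dominated_convergence (fun _ => K * (C + C))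
    (Eventually.of_forall fun k => ?_) (Eventually.of_forall fun k => ?_) (by simp) ?_
  · have hDm : Measurable (D k) := by
      refine Finset.measurable_fun_sum _ fun i _ => ?_
      exact Measurable.ite measurableSet_Iic measurable_const measurable_const
    have : Measurable fun u => (g' u).mulVec (D k u) := by
      refine measurable_pi_iff.2 fun a => ?_
      simp only [Matrix.mulVec, dotProduct]
      refine Finset.measurable_fun_sum _ fun b _ => Measurable.mul ?_ ?_
      · exact (hg'.matrix_elem a b).measurable
      · exact (measurable_pi_apply b).comp hDm
    exact this.aestronglyMeasurable
  · refine Eventually.of_forall fun u hu => ?_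
    rw [Set.uIoc_of_le hst] at hu
    obtain ⟨r, hr, -, hDr⟩ := hD' u hu k
    refine (Matrix.linfty_opNorm_mulVec _ _).trans ?_
    refine mul_le_mul (hK u ⟨hu.1.le, hu.2⟩) ?_ (norm_nonneg _) hK0
    change ‖D k u‖ ≤ _
    rw [hDr]
    refine (norm_sub_le _ _).trans (add_le_add ?_ ?_)
    · rw [norm_cvec]; exact hC t ⟨hst, le_rfl⟩
    · rw [norm_cvec]; exact hC r hr
  · have hae : ∀ᵐ u : ℝ, ContinuousAt x u :=
      measure_mono_null (fun u hu => hu) (hx.countable_not_continuousAt.measure_zero volume)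
    filter_upwards [hae] with u hcu hu
    rw [Set.uIoc_of_le hst] at hu
    choose r hr1 hr2 hr3 using hD' u hu
    have hrt : Tendsto r atTop (𝓝 u) := by
      rw [tendsto_iff_dist_tendsto_zero]
      exact squeeze_zero (fun _ => dist_nonneg) (fun k => (hr2 k).le) hδ
    have hDt : Tendsto (fun k => D k u) atTop (𝓝 (cvec (x t) - cvec (x u))) := by
      simp_rw [hr3]
      exact tendsto_const_nhds.sub ((continuous_cvec.tendsto _).comp (hcu.tendsto.comp hrt))
    exact ((continuous_const.matrix_mulVec continuous_id).tendsto
      (cvec (x t) - cvec (x u))).comp hDt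

end RiemannStieltjes

lemma tendsto_mulVec {m n α : Type*} [Fintype n] {l : Filter α} {M : α → Matrix m n ℂ}
    {y : α → n → ℂ} {A : Matrix m n ℂ} {v : n → ℂ} (hM : Tendsto M l (𝓝 A))
    (hy : Tendsto y l (𝓝 v)) : Tendsto (fun t => (M t).mulVec (y t)) l (𝓝 (A.mulVec v)) := by
  refine tendsto_pi_nhds.2 fun i => ?_
  refine tendsto_finsetSum _ fun j _ => Tendsto.mul ?_ (tendsto_pi_nhds.1 hy j)
  exact ((continuous_id.matrix_elem i j).tendsto A).comp hM

lemma IsCadlag.mulVec {m n : Type*} [Fintype n] {M : ℝ → Matrix m n ℂ} {y : ℝ → n → ℂ}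
    (hM : Continuous M) (hy : IsCadlag y) : IsCadlag fun t => (M t).mulVec (y t) := by
  intro t
  refine ⟨tendsto_mulVec (hM.tendsto t |>.mono_left nhdsWithin_le_nhds) (hy t).1, ?_⟩
  obtain ⟨l, hl⟩ := (hy t).2
  exact ⟨(M t).mulVec l, tendsto_mulVec (hM.tendsto t |>.mono_left nhdsWithin_le_nhds) hl⟩

/-! ### Pathwise Ornstein–Uhlenbeck integrals. -/

section OrnsteinUhlenbeck

open scoped Matrix.Norms.Operator

lemma IsCadlag.integrableOn_Icc {E : Type*} [NormedAddCommGroup E] [SecondCountableTopology E]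
    {x : ℝ → E} (hx : IsCadlag x) (a b : ℝ) : IntegrableOn x (Set.Icc a b) := by
  borelize E
  obtain ⟨C, -, hC⟩ := hx.exists_bound a b
  exact Measure.integrableOn_of_bounded (M := C) measure_Icc_lt_top.ne
    hx.measurable.aestronglyMeasurable ((ae_restrict_iff' measurableSet_Icc).2 (.of_forall hC))

lemma IsCadlag.intervalIntegrable {E : Type*} [NormedAddCommGroup E] [SecondCountableTopology E]
    {x : ℝ → E} (hx : IsCadlag x) (a b : ℝ) : IntervalIntegrable x volume a b :=
  ⟨(hx.integrableOn_Icc a b).mono_set Set.Ioc_subset_Icc_self,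
    (hx.integrableOn_Icc b a).mono_set Set.Ioc_subset_Icc_self⟩

lemma IsCadlag.hasDerivWithinAt_integral {E : Type*} [NormedAddCommGroup E] [NormedSpace ℝ E]
    [CompleteSpace E] [SecondCountableTopology E] {x : ℝ → E} (hx : IsCadlag x) (a t : ℝ) :
    HasDerivWithinAt (fun t => ∫ u in a..t, x u) (x t) (Set.Ici t) t := by
  borelize E
  exact intervalIntegral.integral_hasDerivWithinAt_right (hx.intervalIntegrable a t)
    (hx.measurable.stronglyMeasurable.stronglyMeasurableAtFilter)
    ((hx t).1.mono Set.Ioi_subset_Ici_self)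

lemma mulVec_intervalIntegral {m n : Type*} [Fintype m] [Fintype n] (M : Matrix m n ℂ)
    {f : ℝ → n → ℂ} {a b : ℝ} (hf : IntervalIntegrable f volume a b) :
    ∫ u in a..b, M.mulVec (f u) = M.mulVec (∫ u in a..b, f u) :=
  (LinearMap.toContinuousLinearMap M.mulVecLin).intervalIntegral_comp_comm hf

lemma hasDerivWithinAt_mulVec {m n : Type*} [Fintype m] [Fintype n] {M M' : ℝ → Matrix m n ℂ}
    {v : ℝ → n → ℂ} {v' : n → ℂ} {t : ℝ} {S : Set ℝ}
    (hM : ∀ i j, HasDerivWithinAt (fun u => M u i j) (M' t i j) S t)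
    (hv : HasDerivWithinAt v v' S t) :
    HasDerivWithinAt (fun u => (M u).mulVec (v u)) ((M' t).mulVec (v t) + (M t).mulVec v') S t := by
  rw [hasDerivWithinAt_pi] at hv ⊢
  intro i
  refine (HasDerivWithinAt.fun_sum (u := Finset.univ)
    fun j _ => (hM i j).fun_mul (hv j)).congr_deriv ?_
  simp only [Finset.sum_add_distrib]
  rfl

variable {d m : ℕ} (R : Matrix (Fin d) (Fin d) ℂ) (N : Matrix (Fin d) (Fin m) ℂ)
  (x : ℝ → Fin m → ℝ)

/-- The integrand `e^{-Ru} N x(u)`. -/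
noncomputable def ouDriver (u : ℝ) : Fin d → ℂ :=
  (NormedSpace.exp (((-u : ℝ) : ℂ) • R)).mulVec (N.mulVec (cvec (x u)))

/-- The convolution `∫_{-∞}^t e^{R(t-u)} N x(u) du`. -/
noncomputable def ouConv (t : ℝ) : Fin d → ℂ :=
  (NormedSpace.exp ((t : ℂ) • R)).mulVec (∫ u in Set.Iic t, ouDriver R N x u)

/-- The path `∫_{-∞}^t e^{R(t-u)} N dx(u)`, defined through integration by parts. -/
noncomputable def ouPath (t : ℝ) : Fin d → ℂ :=
  N.mulVec (cvec (x t)) + R.mulVec (ouConv R N x t)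

/-- The integral `∫_s^t e^{R(t-u)} N dx(u)`, defined through integration by parts. -/
noncomputable def ouTrunc (s t : ℝ) : Fin d → ℂ :=
  N.mulVec (cvec (x t)) - (NormedSpace.exp (((t - s : ℝ) : ℂ) • R)).mulVec (N.mulVec (cvec (x s))) +
    R.mulVec ((NormedSpace.exp ((t : ℂ) • R)).mulVec (∫ u in s..t, ouDriver R N x u))

variable {R N x}

lemma exp_mul_exp_neg (t u : ℝ) : NormedSpace.exp ((t : ℂ) • R) *
    NormedSpace.exp (((-u : ℝ) : ℂ) • R) = NormedSpace.exp (((t - u : ℝ) : ℂ) • R) := by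
  rw [← exp_add_smul]
  push_cast
  rw [sub_eq_add_neg]

lemma isCadlag_ouDriver (hx : IsCadlag x) : IsCadlag (ouDriver R N x) := by
  refine IsCadlag.mulVec ((continuous_exp_smul R).comp continuous_neg) ?_
  exact IsCadlag.mulVec continuous_const (hx.comp continuous_cvec)

lemma hasDerivAt_ouKernel (t u : ℝ) (v : Fin m → ℂ) :
    HasDerivAt (fun u => (ouKernel R N t u).mulVec v)
      ((-(R * ouKernel R N t u)).mulVec v) u := by
  have h : ∀ i j, HasDerivWithinAt (fun u => NormedSpace.exp (((t - u : ℝ) : ℂ) • R) i j)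
      ((-(R * NormedSpace.exp (((t - u : ℝ) : ℂ) • R))) i j) Set.univ u := fun i j => by
    have h1 := (hasDerivAt_exp_smul_entry R (t - u) i j).scomp u ((hasDerivAt_id u).const_sub t)
    exact (h1.congr_deriv (by simp)).hasDerivWithinAt
  have h2 := hasDerivWithinAt_mulVec
    (M' := fun u => -(R * NormedSpace.exp (((t - u : ℝ) : ℂ) • R))) h
    (hasDerivWithinAt_const u Set.univ (N.mulVec v))
  rw [hasDerivWithinAt_univ] at h2
  simp only [ouKernel, ← Matrix.mulVec_mulVec] at h2 ⊢
  refine h2.congr_deriv ?_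
  rw [Matrix.mulVec_zero, add_zero, Matrix.neg_mulVec, Matrix.neg_mulVec, ← Matrix.mulVec_mulVec,
    ← Matrix.mulVec_mulVec, ← Matrix.mulVec_mulVec]

lemma continuous_ouKernel (t : ℝ) : Continuous fun u => ouKernel R N t u :=
  ((continuous_exp_smul R).comp (continuous_const.sub continuous_id)).matrix_mul continuous_const

/-- Integration by parts, the kernel having `u`-derivative `-R e^{R(t-u)} N`. The part of the
integral containing the fixed vector `x t` is evaluated by the fundamental theorem of calculus and
merges with the boundary term. -/
lemma hasPathIntegral_ouKernel (hx : IsCadlag x) {s t : ℝ} (hst : s ≤ t) :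
    HasPathIntegral x (ouKernel R N t) s t (ouTrunc R N x s t) := by
  have hc : Continuous fun u => -(R * ouKernel R N t u) :=
    (continuous_const.matrix_mul (continuous_ouKernel t)).neg
  have h := hasPathIntegral_of_hasDerivAt hx (fun v u => hasDerivAt_ouKernel (R := R) (N := N) t u v)
    hc hst
  convert h using 1
  have h1 : ∫ u in s..t, (-(R * ouKernel R N t u)).mulVec (cvec (x t) - cvec (x u)) =
      (N.mulVec (cvec (x t)) - (ouKernel R N t s).mulVec (cvec (x t))) +
      R.mulVec ((NormedSpace.exp ((t : ℂ) • R)).mulVec (∫ u in s..t, ouDriver R N x u)) := by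
    have h2 : ∀ u, (-(R * ouKernel R N t u)).mulVec (cvec (x t) - cvec (x u)) =
        (-(R * ouKernel R N t u)).mulVec (cvec (x t)) +
        (R * NormedSpace.exp ((t : ℂ) • R)).mulVec (ouDriver R N x u) := by
      intro u
      rw [Matrix.mulVec_sub, sub_eq_add_neg, ouDriver, Matrix.neg_mulVec, Matrix.neg_mulVec,
        neg_neg, ouKernel, ← exp_mul_exp_neg]
      simp only [Matrix.mulVec_mulVec, Matrix.mul_assoc]
    simp_rw [h2]
    rw [intervalIntegral.integral_add
      ((hc.matrix_mulVec continuous_const).intervalIntegrable _ _)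
      ((IsCadlag.mulVec continuous_const (isCadlag_ouDriver hx)).intervalIntegrable _ _),
      intervalIntegral.integral_eq_sub_of_hasDerivAt (fun u _ => hasDerivAt_ouKernel t u _)
        ((hc.matrix_mulVec continuous_const).intervalIntegrable _ _),
      mulVec_intervalIntegral _ ((isCadlag_ouDriver hx).intervalIntegrable _ _),
      Matrix.mulVec_mulVec]
    congr 2
    simp [ouKernel, NormedSpace.exp_zero]
  rw [h1, ouTrunc, Matrix.mulVec_sub]
  simp only [ouKernel, Matrix.mulVec_mulVec]
  abel

variable {c c' C : ℝ}

/-- As `u → -∞`, the decay `e^{cu}` of `e^{-Ru}` beats the growth `e^{-c'u}` of `x`. -/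
lemma integrableOn_ouDriver (hx : IsCadlag x)
    (hR : ∀ v : ℝ, 0 ≤ v → ‖NormedSpace.exp ((v : ℂ) • R)‖ ≤ C * Real.exp (-c * v))
    (hc : c' < c) (hgrowth : x =O[atBot] fun u => Real.exp (-c' * u)) (t : ℝ) :
    IntegrableOn (ouDriver R N x) (Set.Iic t) := by
  have hloc : LocallyIntegrableOn (ouDriver R N x) (Set.Iic t) := by
    refine LocallyIntegrable.locallyIntegrableOn (fun u => ?_) _
    exact ⟨Set.Icc (u - 1) (u + 1), Icc_mem_nhds (by linarith) (by linarith),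
      (isCadlag_ouDriver hx).integrableOn_Icc _ _⟩
  refine hloc.integrableOn_of_isBigO_atBot (g := fun u => Real.exp ((c - c') * u)) ?_
    ⟨Set.Iic 0, Iic_mem_atBot 0, integrableOn_exp_mul_Iic (sub_pos.2 hc) 0⟩
  obtain ⟨K, hK⟩ := hgrowth.bound
  refine Asymptotics.IsBigO.of_bound (C * (‖N‖ * K)) ?_
  filter_upwards [hK, eventually_le_atBot 0] with u hu hu0
  rw [Real.norm_of_nonneg (Real.exp_nonneg _)] at hu ⊢
  refine (Matrix.linfty_opNorm_mulVec _ _).trans ?_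
  have h1 := hR (-u) (by linarith)
  have h2 : ‖N.mulVec (cvec (x u))‖ ≤ ‖N‖ * (K * Real.exp (-c' * u)) :=
    (Matrix.linfty_opNorm_mulVec _ _).trans
      (mul_le_mul_of_nonneg_left (by rwa [norm_cvec]) (norm_nonneg _))
  refine (mul_le_mul h1 h2 (norm_nonneg _) ((norm_nonneg _).trans h1)).trans_eq ?_
  rw [show (c - c') * u = -c * -u + -c' * u by ring, Real.exp_add]
  ring

lemma tendsto_ouTrunc (hx : IsCadlag x)
    (hR : ∀ v : ℝ, 0 ≤ v → ‖NormedSpace.exp ((v : ℂ) • R)‖ ≤ C * Real.exp (-c * v))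
    (hc : c' < c) (hgrowth : x =O[atBot] fun u => Real.exp (-c' * u)) (t : ℝ) :
    Tendsto (fun s => ouTrunc R N x s t) atBot (𝓝 (ouPath R N x t)) := by
  have h1 : Tendsto (fun s => (NormedSpace.exp (((t - s : ℝ) : ℂ) • R)).mulVec
      (N.mulVec (cvec (x s)))) atBot (𝓝 0) := by
    have hlim : Tendsto (fun u => Real.exp ((c - c') * u)) atBot (𝓝 0) :=
      Real.tendsto_exp_atBot.comp (tendsto_id.const_mul_atBot (sub_pos.2 hc))
    refine Asymptotics.IsBigO.trans_tendsto ?_ hlim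
    obtain ⟨K, hK⟩ := hgrowth.bound
    refine Asymptotics.IsBigO.of_bound (C * Real.exp (-c * t) * (‖N‖ * K)) ?_
    filter_upwards [hK, eventually_le_atBot t] with u hu hu0
    rw [Real.norm_of_nonneg (Real.exp_nonneg _)] at hu ⊢
    refine (Matrix.linfty_opNorm_mulVec _ _).trans ?_
    have h1 := hR (t - u) (by linarith)
    have h2 : ‖N.mulVec (cvec (x u))‖ ≤ ‖N‖ * (K * Real.exp (-c' * u)) :=
      (Matrix.linfty_opNorm_mulVec _ _).trans
        (mul_le_mul_of_nonneg_left (by rwa [norm_cvec]) (norm_nonneg _))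
    refine (mul_le_mul h1 h2 (norm_nonneg _) ((norm_nonneg _).trans h1)).trans_eq ?_
    rw [show (c - c') * u = c * u + -c' * u by ring, Real.exp_add,
      show -c * (t - u) = -c * t + c * u by ring, Real.exp_add]
    ring
  have h2 : Tendsto (fun s => ∫ u in s..t, ouDriver R N x u) atBot
      (𝓝 (∫ u in Set.Iic t, ouDriver R N x u)) :=
    intervalIntegral_tendsto_integral_Iic t (integrableOn_ouDriver hx hR hc hgrowth t) tendsto_id
  have h3 : Continuous fun v : Fin d → ℂ =>
      R.mulVec ((NormedSpace.exp ((t : ℂ) • R)).mulVec v) :=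
    continuous_const.matrix_mulVec (continuous_const.matrix_mulVec continuous_id)
  have h4 := (tendsto_const_nhds (x := N.mulVec (cvec (x t)))).sub h1 |>.add
    ((h3.tendsto _).comp h2)
  rw [sub_zero] at h4
  exact h4

lemma integral_Iic_ouDriver
    (hint : ∀ t, IntegrableOn (ouDriver R N x) (Set.Iic t)) (s t : ℝ) :
    ∫ u in Set.Iic t, ouDriver R N x u =
      (∫ u in Set.Iic s, ouDriver R N x u) + ∫ u in s..t, ouDriver R N x u := by
  rw [← intervalIntegral.integral_Iic_sub_Iic (hint s) (hint t)]
  abel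

lemma continuous_ouConv (hx : IsCadlag x)
    (hint : ∀ t, IntegrableOn (ouDriver R N x) (Set.Iic t)) : Continuous (ouConv R N x) := by
  have h : Continuous fun t => ∫ u in Set.Iic t, ouDriver R N x u := by
    rw [funext fun t => integral_Iic_ouDriver hint 0 t]
    exact continuous_const.add (intervalIntegral.continuous_primitive
      (fun a b => (isCadlag_ouDriver hx).intervalIntegrable a b) 0)
  exact (continuous_exp_smul R).matrix_mulVec h

lemma isCadlag_ouPath (hx : IsCadlag x)
    (hint : ∀ t, IntegrableOn (ouDriver R N x) (Set.Iic t)) : IsCadlag (ouPath R N x) :=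
  (IsCadlag.mulVec continuous_const (hx.comp continuous_cvec)).add
    (continuous_const.matrix_mulVec (continuous_ouConv hx hint)).isCadlag

/-- The product rule gives `z' = R z + N x` for `z = ouConv`, and the right-hand side is `ouPath`.
Only a right derivative exists in general, since `x` is merely right-continuous. -/
lemma hasDerivWithinAt_ouConv (hx : IsCadlag x)
    (hint : ∀ t, IntegrableOn (ouDriver R N x) (Set.Iic t)) (t : ℝ) :
    HasDerivWithinAt (ouConv R N x) (ouPath R N x t) (Set.Ici t) t := by
  have h : HasDerivWithinAt (fun t => ∫ u in Set.Iic t, ouDriver R N x u) (ouDriver R N x t)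
      (Set.Ici t) t := by
    rw [funext fun t => integral_Iic_ouDriver hint 0 t]
    exact ((isCadlag_ouDriver hx).hasDerivWithinAt_integral 0 t).const_add _
  refine (hasDerivWithinAt_mulVec (M' := fun t => R * NormedSpace.exp ((t : ℂ) • R))
    (fun i j => (hasDerivAt_exp_smul_entry R t i j).hasDerivWithinAt) h).congr_deriv ?_
  rw [ouPath, ouConv, ouDriver, Matrix.mulVec_mulVec, exp_mul_exp_neg, sub_self, add_comm,
    ← Matrix.mulVec_mulVec]
  simp [NormedSpace.exp_zero]

/-- The Ornstein–Uhlenbeck equation. -/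
lemma ouPath_eq (hx : IsCadlag x)
    (hint : ∀ t, IntegrableOn (ouDriver R N x) (Set.Iic t)) {s t : ℝ} (hst : s ≤ t) :
    ouPath R N x t = ouPath R N x s + R.mulVec (∫ u in s..t, ouPath R N x u) +
      N.mulVec (cvec (x t) - cvec (x s)) := by
  have h : ∫ u in s..t, ouPath R N x u = ouConv R N x t - ouConv R N x s :=
    intervalIntegral.integral_eq_sub_of_hasDeriv_right_of_le hst
      (continuous_ouConv hx hint).continuousOn
      (fun u _ => (hasDerivWithinAt_ouConv hx hint u).mono Set.Ioi_subset_Ici_self)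
      ((isCadlag_ouPath hx hint).intervalIntegrable _ _)
  rw [h, Matrix.mulVec_sub, Matrix.mulVec_sub, ouPath, ouPath]
  abel

end OrnsteinUhlenbeck

/-! ### Growth of a Lévy process at `-∞`. -/

section Growth

variable {Ω : Type*} [MeasurableSpace Ω] {μ : Measure Ω} {m : ℕ} {L : ℝ → Ω → (Fin m → ℝ)}

/-- Past and future of a process with independent increments. -/
lemma measure_past_inter_future (hmeas : ∀ t, Measurable (L t)) (hind : HasIndepIncrements L μ)
    {t : ℕ → ℝ} (ht : Monotone t) {k n : ℕ} (hkn : k ≤ n) (a b : ℝ) :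
    μ ({ω | a < ‖L (t k) ω - L (t 0) ω‖ ∧ ∀ j < k, ‖L (t j) ω - L (t 0) ω‖ ≤ a} ∩
      {ω | ‖L (t n) ω - L (t k) ω‖ ≤ b}) =
    μ {ω | a < ‖L (t k) ω - L (t 0) ω‖ ∧ ∀ j < k, ‖L (t j) ω - L (t 0) ω‖ ≤ a} *
      μ {ω | ‖L (t n) ω - L (t k) ω‖ ≤ b} := by
  -- The past event depends on increments with index below `k`, the future one on indices in `[k,
  -- n)`; `φ` and `ψ` rebuild the required sums from them.
  have h := (hind.nat ht).indepFun_finset (Finset.range k) (Finset.Ico k n)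
    (by
      rw [Finset.disjoint_left]
      intro i hi hi'
      rw [Finset.mem_range] at hi
      rw [Finset.mem_Ico] at hi'
      omega)
    (fun i => (hmeas _).sub (hmeas _))
  let φ : ℕ → (Finset.range k → Fin m → ℝ) → Fin m → ℝ := fun j v =>
    ∑ i : Finset.range k, if (i : ℕ) < j then v i else 0
  let ψ : (Finset.Ico k n → Fin m → ℝ) → Fin m → ℝ := fun v => ∑ i, v i
  have hφm : ∀ j, Measurable (φ j) := fun j => by
    refine Finset.measurable_fun_sum _ fun i _ => ?_
    by_cases hij : (i : ℕ) < j
    · simpa [hij] using measurable_pi_apply i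
    · simp [hij]
  have hψm : Measurable ψ := Finset.measurable_fun_sum _ fun i _ => measurable_pi_apply i
  have hφ : ∀ j ≤ k, ∀ ω, φ j (fun i => L (t (i + 1)) ω - L (t i) ω) =
      L (t j) ω - L (t 0) ω := by
    intro j hj ω
    simp only [φ]
    rw [Finset.sum_coe_sort (Finset.range k)
      (fun i => if i < j then L (t (i + 1)) ω - L (t i) ω else 0), ← Finset.sum_filter]
    have : (Finset.range k).filter (· < j) = Finset.range j := by
      ext i; simp only [Finset.mem_filter, Finset.mem_range]; omega
    rw [this, Finset.sum_range_sub (fun i => L (t i) ω)]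
  have hψ : ∀ ω, ψ (fun i => L (t (i + 1)) ω - L (t i) ω) = L (t n) ω - L (t k) ω := by
    intro ω
    simp only [ψ]
    rw [Finset.sum_coe_sort (Finset.Ico k n) (fun i => L (t (i + 1)) ω - L (t i) ω),
      Finset.sum_Ico_eq_sub _ hkn, Finset.sum_range_sub (fun i => L (t i) ω),
      Finset.sum_range_sub (fun i => L (t i) ω), sub_sub_sub_cancel_right]
  have hS : MeasurableSet {v | a < ‖φ k v‖ ∧ ∀ j < k, ‖φ j v‖ ≤ a} := by
    refine (measurableSet_lt measurable_const (hφm k).norm).inter ?_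
    change MeasurableSet {v | ∀ j < k, ‖φ j v‖ ≤ a}
    rw [show {v | ∀ j < k, ‖φ j v‖ ≤ a} = ⋂ j, ⋂ (_ : j < k), {v | ‖φ j v‖ ≤ a} by
      ext v; simp]
    exact MeasurableSet.iInter fun j => MeasurableSet.iInter fun _ =>
      measurableSet_le (hφm j).norm measurable_const
  have hT : MeasurableSet {v | ‖ψ v‖ ≤ b} := measurableSet_le hψm.norm measurable_const
  have hmul := h.measure_inter_preimage_eq_mul _ _ hS hT
  have hP : {ω | a < ‖L (t k) ω - L (t 0) ω‖ ∧ ∀ j < k, ‖L (t j) ω - L (t 0) ω‖ ≤ a} =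
      (fun ω (i : Finset.range k) => L (t ((i : ℕ) + 1)) ω - L (t i) ω) ⁻¹'
        {v | a < ‖φ k v‖ ∧ ∀ j < k, ‖φ j v‖ ≤ a} := by
    ext ω
    refine and_congr (by rw [← hφ k le_rfl ω]) (forall₂_congr fun j hj => ?_)
    rw [← hφ j hj.le ω]
  have hQ : {ω | ‖L (t n) ω - L (t k) ω‖ ≤ b} =
      (fun ω (i : Finset.Ico k n) => L (t ((i : ℕ) + 1)) ω - L (t i) ω) ⁻¹' {v | ‖ψ v‖ ≤ b} := by
    ext ω
    change ‖L (t n) ω - L (t k) ω‖ ≤ b ↔ _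
    rw [← hψ ω]
    rfl
  rw [hP, hQ, hmul]

/-- Ottaviani's maximal inequality. -/
lemma ottaviani [IsProbabilityMeasure μ] (hmeas : ∀ t, Measurable (L t))
    (hind : HasIndepIncrements L μ) {t : ℕ → ℝ} (ht : Monotone t) (n : ℕ) {a b : ℝ}
    (hb : ∀ k ≤ n, 1 / 2 ≤ μ {ω | ‖L (t n) ω - L (t k) ω‖ ≤ b}) :
    μ {ω | ∃ k ≤ n, a + b < ‖L (t k) ω - L (t 0) ω‖} ≤
      2 * μ {ω | a < ‖L (t n) ω - L (t 0) ω‖} := by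
  -- On `P k` the level `a + b` is first exceeded at step `k`; if moreover the remaining increment
  -- is at most `b` (`Q k`), the final value exceeds `a`. Independence and `1/2 ≤ μ (Q k)` give `μ
  -- (P k) ≤ 2 μ (P k ∩ Q k)`, and these events are disjoint.
  set P : ℕ → Set Ω := fun k => {ω | a + b < ‖L (t k) ω - L (t 0) ω‖ ∧
    ∀ j < k, ‖L (t j) ω - L (t 0) ω‖ ≤ a + b} with hP
  set Q : ℕ → Set Ω := fun k => {ω | ‖L (t n) ω - L (t k) ω‖ ≤ b} with hQ
  have hPm : ∀ k, MeasurableSet (P k) := fun k => by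
    refine (measurableSet_lt measurable_const ((hmeas _).sub (hmeas _)).norm).inter ?_
    change MeasurableSet {ω | ∀ j < k, ‖L (t j) ω - L (t 0) ω‖ ≤ a + b}
    rw [show {ω | ∀ j < k, ‖L (t j) ω - L (t 0) ω‖ ≤ a + b} =
      ⋂ j, ⋂ (_ : j < k), {ω | ‖L (t j) ω - L (t 0) ω‖ ≤ a + b} by ext ω; simp]
    exact MeasurableSet.iInter fun j => MeasurableSet.iInter fun _ =>
      measurableSet_le ((hmeas _).sub (hmeas _)).norm measurable_const
  have hQm : ∀ k, MeasurableSet (Q k) := fun k =>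
    measurableSet_le ((hmeas _).sub (hmeas _)).norm measurable_const
  have hsub : {ω | ∃ k ≤ n, a + b < ‖L (t k) ω - L (t 0) ω‖} ⊆
      ⋃ k ∈ Finset.range (n + 1), P k := by
    classical
    rintro ω ⟨k, hk, hω⟩
    have hex : ∃ k, a + b < ‖L (t k) ω - L (t 0) ω‖ := ⟨k, hω⟩
    refine Set.mem_biUnion (x := Nat.find hex) ?_ ⟨Nat.find_spec hex, fun j hj => ?_⟩
    · have := Nat.find_min' hex hω
      simp only [Finset.coe_range, Set.mem_Iio]
      omega
    · exact not_lt.1 (Nat.find_min hex hj)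
  have hdisj : (Finset.range (n + 1) : Set ℕ).PairwiseDisjoint fun k => P k ∩ Q k := by
    intro i _ j _ hij
    rw [Function.onFun, Set.disjoint_left]
    rintro ω ⟨hi, -⟩ ⟨hj, -⟩
    rcases lt_or_gt_of_ne hij with h | h
    · exact absurd hi.1 (not_lt.2 (hj.2 i h))
    · exact absurd hj.1 (not_lt.2 (hi.2 j h))
  have hsub2 : ⋃ k ∈ Finset.range (n + 1), P k ∩ Q k ⊆ {ω | a < ‖L (t n) ω - L (t 0) ω‖} := by
    intro ω hω
    obtain ⟨k, -, hk1, hk2⟩ := Set.mem_iUnion₂.1 hω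
    have h1 : a + b < ‖L (t k) ω - L (t 0) ω‖ := hk1.1
    have h2 : ‖L (t n) ω - L (t k) ω‖ ≤ b := hk2
    have h3 : ‖L (t k) ω - L (t 0) ω‖ ≤ ‖L (t n) ω - L (t 0) ω‖ + ‖L (t n) ω - L (t k) ω‖ := by
      have : L (t k) ω - L (t 0) ω = (L (t n) ω - L (t 0) ω) - (L (t n) ω - L (t k) ω) := by abel
      rw [this]
      exact norm_sub_le _ _
    change a < _
    linarith
  calc μ {ω | ∃ k ≤ n, a + b < ‖L (t k) ω - L (t 0) ω‖}
      ≤ ∑ k ∈ Finset.range (n + 1), μ (P k) :=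
        (measure_mono hsub).trans (measure_biUnion_finset_le _ _)
    _ ≤ ∑ k ∈ Finset.range (n + 1), 2 * μ (P k ∩ Q k) := by
        refine Finset.sum_le_sum fun k hk => ?_
        have hkn : k ≤ n := by rw [Finset.mem_range] at hk; omega
        rw [measure_past_inter_future hmeas hind ht hkn]
        calc μ (P k) = 2 * (μ (P k) * (1 / 2)) := by
              rw [mul_comm (μ (P k)), ← mul_assoc, one_div,
                ENNReal.mul_inv_cancel two_ne_zero ENNReal.ofNat_ne_top, one_mul]
          _ ≤ 2 * (μ (P k) * μ (Q k)) := by gcongr; exact hb k hkn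
    _ = 2 * μ (⋃ k ∈ Finset.range (n + 1), P k ∩ Q k) := by
        rw [← Finset.mul_sum, measure_biUnion_finset hdisj fun k _ => (hPm k).inter (hQm k)]
    _ ≤ _ := by gcongr

/-- Càdlàg paths are bounded on `[0, 1]`, so some `b` bounds `‖L 1 - L u‖` for all `u` there with
probability above one half. Stationary increments carry this one `b` to all unit intervals. -/
lemma IsLevyProcess.exists_tight [IsProbabilityMeasure μ] (hL : IsLevyProcess L μ) :
    ∃ b ≥ (0 : ℝ), ∀ s, ∀ u ∈ Set.Icc s (s + 1),
      1 / 2 ≤ μ {ω | ‖L (s + 1) ω - L u ω‖ ≤ b} := by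
  set G : ℕ → Set Ω := fun b => {ω | ∀ u ∈ Set.Icc (0 : ℝ) 1, ‖L 1 ω - L u ω‖ ≤ b}
  have hmono : Monotone G := fun b c hbc ω hω u hu =>
    (hω u hu).trans (Nat.cast_le.2 hbc)
  have hfull : μ (⋃ b, G b) = 1 := by
    have hmem : (⋃ b, G b) ∈ ae μ := by
      filter_upwards [hL.cadlag] with ω hω
      obtain ⟨C, -, hC⟩ := hω.exists_bound 0 1
      obtain ⟨b, hb⟩ := exists_nat_ge (C + C)
      refine Set.mem_iUnion.2 ⟨b, fun u hu => ?_⟩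
      exact (norm_sub_le _ _).trans ((add_le_add (hC 1 ⟨zero_le_one, le_rfl⟩) (hC u hu)).trans hb)
    rw [measure_congr (eventuallyEq_univ.2 hmem), measure_univ]
  rw [hmono.measure_iUnion] at hfull
  obtain ⟨b, hb⟩ : ∃ b, 1 / 2 < μ (G b) := by
    rw [← lt_iSup_iff, hfull, one_div]
    exact ENNReal.inv_lt_one.2 (by norm_num)
  refine ⟨b, Nat.cast_nonneg b, fun s u hu => ?_⟩
  have hid := hL.stationary_increments (u - s) 1 s (by linarith [hu.2])
  rw [add_comm 1 s, sub_add_cancel] at hid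
  have h1 := hid.measure_mem_eq (s := {v | ‖v‖ ≤ (b : ℝ)})
    (measurableSet_le measurable_norm measurable_const)
  refine (hb.le.trans (measure_mono fun ω hω => ?_)).trans_eq h1.symm
  exact hω (u - s) ⟨by linarith [hu.1], by linarith [hu.2]⟩

/-- Ottaviani's inequality bounds the events `E n` on the grids of mesh `1 / (n + 1)` uniformly. By
right-continuity a path exceeding the level somewhere in the block does so on all sufficiently fine
grids, so almost surely the event lies in the limit inferior of the `E n`. -/
lemma IsLevyProcess.measure_block_le [IsProbabilityMeasure μ] (hL : IsLevyProcess L μ) {b : ℝ}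
    (hb : ∀ s, ∀ u ∈ Set.Icc s (s + 1), 1 / 2 ≤ μ {ω | ‖L (s + 1) ω - L u ω‖ ≤ b}) (a s : ℝ) :
    μ {ω | ∃ u ∈ Set.Icc s (s + 1), a + b < ‖L u ω - L s ω‖} ≤ 2 * μ {ω | a < ‖L 1 ω‖} := by
  set E : ℕ → Set Ω := fun n =>
    {ω | ∃ k ≤ n + 1, a + b < ‖L (s + (k : ℕ) / ((n : ℝ) + 1)) ω - L s ω‖} with hE
  have hEn : ∀ n, μ (E n) ≤ 2 * μ {ω | a < ‖L 1 ω‖} := by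
    intro n
    have hn : (0 : ℝ) < n + 1 := by positivity
    have h := ottaviani (a := a) (b := b) hL.measurable hL.indep_increments
      (t := fun k : ℕ => s + (k : ℝ) / ((n : ℝ) + 1)) (fun i j hij => by
        have : (i : ℝ) ≤ j := Nat.cast_le.2 hij
        simp only
        gcongr) (n + 1) (fun k hk => by
        have hk' : (k : ℝ) ≤ n + 1 := by exact_mod_cast hk
        have := hb s (s + (k : ℝ) / ((n : ℝ) + 1)) ⟨by
          have : 0 ≤ (k : ℝ) / ((n : ℝ) + 1) := by positivity
          linarith, by
          have : (k : ℝ) / ((n : ℝ) + 1) ≤ 1 := (div_le_one hn).2 hk'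
          linarith⟩
        simpa [div_self hn.ne'] using this)
    have h2 : μ {ω | a < ‖L (s + 1) ω - L s ω‖} = μ {ω | a < ‖L 1 ω‖} := by
      have hid := hL.stationary_increments 0 1 s zero_le_one
      rw [add_comm 1 s, zero_add] at hid
      have h1 := hid.measure_mem_eq (s := {v | a < ‖v‖})
        (measurableSet_lt measurable_const measurable_norm)
      refine h1.trans (measure_congr ?_)
      filter_upwards [hL.zero] with ω hω
      refine propext ?_
      change a < ‖L 1 ω - L 0 ω‖ ↔ a < ‖L 1 ω‖
      rw [hω, sub_zero]
    rw [← h2]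
    simpa [div_self hn.ne'] using h
  have hsub : {ω | ∃ u ∈ Set.Icc s (s + 1), a + b < ‖L u ω - L s ω‖} ≤ᵐ[μ]
      ⋃ M : ℕ, ⋂ n ≥ M, E n := by
    filter_upwards [hL.cadlag] with ω hω
    rintro ⟨u, hu, hlt⟩
    -- At the right end the next grid point would leave the block, but `s + 1` itself belongs to
    -- every grid.
    rcases hu.2.eq_or_lt with rfl | hlt1
    · refine Set.mem_iUnion.2 ⟨0, Set.mem_iInter₂.2 fun n _ => ⟨n + 1, le_rfl, ?_⟩⟩
      have hn : (0 : ℝ) < n + 1 := by positivity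
      simpa [div_self hn.ne'] using hlt
    · have h1 : Tendsto (fun n => s + gridAbove n (u - s)) atTop (𝓝[≥] u) := by
        have h2 := tendsto_nhdsWithin_iff.1 (tendsto_gridAbove (u - s))
        refine tendsto_nhdsWithin_iff.2 ⟨?_, h2.2.mono fun n hn => ?_⟩
        · simpa using h2.1.const_add s
        · have : u - s < gridAbove n (u - s) := hn
          rw [Set.mem_Ici]
          linarith
      have h3 := ((hω u).1.tendsto.comp h1).sub_const (L s ω) |>.norm
      obtain ⟨M, hM⟩ := eventually_atTop.1 (h3.eventually (lt_mem_nhds hlt))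
      refine Set.mem_iUnion.2 ⟨M, Set.mem_iInter₂.2 fun n hn => ?_⟩
      have h4 := hM n hn
      have hn1 : (0 : ℝ) < n + 1 := by positivity
      have h0 : 0 ≤ (u - s) * (n + 1) := mul_nonneg (by linarith [hu.1]) hn1.le
      refine ⟨⌊(u - s) * (n + 1)⌋₊ + 1, ?_, ?_⟩
      · have : ⌊(u - s) * ((n : ℝ) + 1)⌋₊ < n + 1 := by
          rw [Nat.floor_lt h0]
          push_cast
          nlinarith
        omega
      · have : (((⌊(u - s) * ((n : ℝ) + 1)⌋₊ + 1 : ℕ) : ℝ) / ((n : ℝ) + 1)) =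
            gridAbove n (u - s) := by
          rw [gridAbove]
          push_cast
          rw [natCast_floor_eq_intCast_floor h0]
        rw [this]
        exact h4
  refine (measure_mono_ae hsub).trans ?_
  have hmono : Monotone fun M : ℕ => ⋂ n ≥ M, E n := fun M M' h =>
    Set.biInter_mono (fun n (hn : n ≥ M') => le_trans h hn) fun _ _ => le_rfl
  rw [hmono.measure_iUnion]
  exact iSup_le fun M => (measure_mono (Set.biInter_subset_of_mem le_rfl)).trans (hEn M)

/-- A bound for a function on the negative half-line from bounds for its oscillation on unit
intervals. -/
lemma isBigO_of_block_bound {E : Type*} [NormedAddCommGroup E] {x : ℝ → E} {b c : ℝ} (hb : 0 ≤ b)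
    (hc : 0 < c) (h : ∀ᶠ i : ℕ in atTop, ∀ u ∈ Set.Icc (-((i : ℝ) + 1)) (-((i : ℝ) + 1) + 1),
      ‖x u - x (-((i : ℝ) + 1))‖ ≤ Real.exp (c * i) + b) :
    x =O[atBot] fun u => Real.exp (-c * u) := by
  obtain ⟨i₀, hi₀⟩ := eventually_atTop.1 h
  have hec : 1 < Real.exp c := Real.one_lt_exp_iff.2 hc
  -- The first entry starts the induction at `i₀`; the second gives `K e^c ≥ K + 1 + b`, which
  -- absorbs one more block.
  set K := max ‖x (-(i₀ : ℝ))‖ ((1 + b) / (Real.exp c - 1)) with hK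
  have hK2 : 1 + b ≤ K * (Real.exp c - 1) := by
    rw [← div_le_iff₀ (by linarith)]
    exact le_max_right _ _
  have hK0 : 0 ≤ K := (norm_nonneg _).trans (le_max_left _ _)
  have hexp1 : ∀ i : ℕ, 1 ≤ Real.exp (c * i) := fun i => Real.one_le_exp (by positivity)
  have hbd : ∀ i : ℕ, Real.exp (c * i) + b ≤ (1 + b) * Real.exp (c * i) := fun i => by
    nlinarith [hexp1 i]
  have hint : ∀ i ≥ i₀, ‖x (-(i : ℝ))‖ ≤ K * Real.exp (c * i) := by
    intro i hi
    induction i, hi using Nat.le_induction with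
    | base => nlinarith [hexp1 i₀, le_max_left ‖x (-(i₀ : ℝ))‖ ((1 + b) / (Real.exp c - 1))]
    | succ i hi ih =>
      have h1 := hi₀ i hi (-(i : ℝ)) ⟨by linarith, by linarith⟩
      have h2 : ‖x (-((i : ℝ) + 1))‖ ≤ ‖x (-(i : ℝ))‖ + ‖x (-(i : ℝ)) - x (-((i : ℝ) + 1))‖ := by
        have : x (-((i : ℝ) + 1)) = x (-(i : ℝ)) - (x (-(i : ℝ)) - x (-((i : ℝ) + 1))) := by abel
        conv_lhs => rw [this]
        exact norm_sub_le _ _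
      have h3 : Real.exp (c * ((i + 1 : ℕ) : ℝ)) = Real.exp c * Real.exp (c * i) := by
        rw [← Real.exp_add]; congr 1; push_cast; ring
      rw [h3]
      push_cast
      nlinarith [hbd i, hexp1 i]
  refine Asymptotics.IsBigO.of_bound (K * Real.exp c + (1 + b)) ?_
  filter_upwards [eventually_le_atBot (-(i₀ : ℝ))] with u hu
  have hu0 : 0 ≤ -u := by
    have : (0 : ℝ) ≤ i₀ := Nat.cast_nonneg _
    linarith
  set i := ⌊-u⌋₊ with hi
  have h1 : (i : ℝ) ≤ -u := Nat.floor_le hu0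
  have h2 : -u < i + 1 := Nat.lt_floor_add_one _
  have hii : i₀ ≤ i := Nat.le_floor (by linarith)
  have h3 := hi₀ i hii u ⟨by linarith, by linarith⟩
  have h4 := hint (i + 1) (by omega)
  have h5 : Real.exp (c * ((i + 1 : ℕ) : ℝ)) = Real.exp c * Real.exp (c * i) := by
    rw [← Real.exp_add]; congr 1; push_cast; ring
  rw [h5] at h4
  push_cast at h4
  have h6 : ‖x u‖ ≤ ‖x (-((i : ℝ) + 1))‖ + ‖x u - x (-((i : ℝ) + 1))‖ := by
    have : x u = x (-((i : ℝ) + 1)) + (x u - x (-((i : ℝ) + 1))) := by abel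
    conv_lhs => rw [this]
    exact norm_add_le _ _
  have h7 : Real.exp (c * i) ≤ Real.exp (-c * u) := Real.exp_le_exp.2 (by nlinarith)
  rw [Real.norm_of_nonneg (Real.exp_nonneg _)]
  have h8 : 0 ≤ K * Real.exp c + (1 + b) := by positivity
  calc ‖x u‖ ≤ (K * Real.exp c + (1 + b)) * Real.exp (c * i) := by nlinarith [hbd i]
    _ ≤ _ := by gcongr

/-- A Lévy process with a logarithmic moment grows subexponentially at `-∞`. -/
lemma IsLevyProcess.ae_isBigO [IsProbabilityMeasure μ] (hL : IsLevyProcess L μ)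
    (hlog : Integrable (fun ω => Real.log (max 1 ‖L 1 ω‖)) μ) {c : ℝ} (hc : 0 < c) :
    ∀ᵐ ω ∂μ, (fun t => L t ω) =O[atBot] fun u => Real.exp (-c * u) := by
  obtain ⟨b, hb0, hb⟩ := hL.exists_tight
  -- `∑ P(Z > i)` is finite for the integrable variable `Z = log max(1, ‖L 1‖) / c`. With
  -- `measure_block_le` this feeds Borel–Cantelli on the blocks `[-(i+1), -i]`.
  have hsum : ∑' i : ℕ, μ {ω | Real.exp (c * i) < ‖L 1 ω‖} < ⊤ := by
    have h := @tsum_prob_mem_Ioi_lt_top Ω ⟨μ⟩ ‹_› (fun ω => Real.log (max 1 ‖L 1 ω‖) / c)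
      (hlog.div_const c) (fun ω => div_nonneg (Real.log_nonneg (le_max_left _ _)) hc.le)
    refine lt_of_le_of_lt (ENNReal.tsum_le_tsum fun i => measure_mono fun ω hω => ?_) h
    have hω' : Real.exp (c * i) < ‖L 1 ω‖ := hω
    change (i : ℝ) < Real.log (max 1 ‖L 1 ω‖) / c
    rw [lt_div_iff₀ hc, mul_comm, Real.lt_log_iff_exp_lt (by positivity)]
    exact hω'.trans_le (le_max_right _ _)
  have hBC := ae_eventually_notMem (μ := μ) (s := fun i : ℕ =>
    {ω | ∃ u ∈ Set.Icc (-((i : ℝ) + 1)) (-((i : ℝ) + 1) + 1),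
      Real.exp (c * i) + b < ‖L u ω - L (-((i : ℝ) + 1)) ω‖}) (by
    refine ne_top_of_le_ne_top (ENNReal.mul_ne_top (ENNReal.ofNat_ne_top (n := 2)) hsum.ne) ?_
    rw [← ENNReal.tsum_mul_left]
    exact ENNReal.tsum_le_tsum fun i => hL.measure_block_le hb _ _)
  filter_upwards [hBC] with ω hω
  refine isBigO_of_block_bound hb0 hc (hω.mono fun i hi u hu => ?_)
  by_contra hcon
  exact hi ⟨u, hu, not_le.1 hcon⟩

end Growth

/-! ### From pathwise integrals to integrals in probability. -/

section LevyIntegral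

/-- The uniform grid of `[s, t]` with `k + 1` cells. -/
noncomputable def unifGrid (s t : ℝ) (k i : ℕ) : ℝ := s + i * ((t - s) / (k + 1))

lemma isTaggedPartition_unifGrid {s t : ℝ} (hst : s ≤ t) (k : ℕ) :
    IsTaggedPartition s t ((t - s + 1) / (k + 1)) (k + 1) (unifGrid s t k) (unifGrid s t k) := by
  have hk : (0 : ℝ) < k + 1 := by positivity
  have hd : 0 ≤ (t - s) / (k + 1) := div_nonneg (by linarith) hk.le
  refine ⟨by simp [unifGrid], ?_, fun i _ => ⟨le_rfl, ?_, ?_⟩⟩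
  · simp only [unifGrid]
    push_cast
    field_simp
    ring
  · simp only [unifGrid]
    push_cast
    linarith
  · simp only [unifGrid]
    push_cast
    have : (t - s) / (k + 1) < (t - s + 1) / (k + 1) := by gcongr; linarith
    linarith

lemma tendsto_mesh (c : ℝ) : Tendsto (fun k : ℕ => c / ((k : ℝ) + 1)) atTop (𝓝 0) :=
  tendsto_const_div_atTop_nhds_zero_nat c |>.comp (tendsto_add_atTop_nat 1) |>.congr fun k => by
    simp

/-- The Riemann–Stieltjes sum over the uniform grid. -/
noncomputable def unifSum {Ω : Type*} {d m : ℕ} (g : ℝ → Matrix (Fin d) (Fin m) ℂ) (L : ℝ → Ω → (Fin m → ℝ)) (s t : ℝ)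
    (k : ℕ) (ω : Ω) : Fin d → ℂ :=
  stieltjesSum g L (k + 1) (unifGrid s t k) (unifGrid s t k) ω

lemma stieltjesSum_eq {Ω : Type*} {d m : ℕ} (L : ℝ → Ω → (Fin m → ℝ)) (g : ℝ → Matrix (Fin d) (Fin m) ℂ) (n : ℕ) (τ ξ : ℕ → ℝ) (ω : Ω) :
    stieltjesSum g L n τ ξ ω = ∑ i ∈ Finset.range n,
      (g (ξ i)).mulVec (cvec (L (τ (i + 1)) ω - L (τ i) ω)) := rfl

lemma tendsto_unifSum {Ω : Type*} {d m : ℕ} {L : ℝ → Ω → (Fin m → ℝ)} {g : ℝ → Matrix (Fin d) (Fin m) ℂ} {s t : ℝ} (hst : s ≤ t)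
    {ω : Ω} {I : Fin d → ℂ} (h : HasPathIntegral (fun u => L u ω) g s t I) :
    Tendsto (fun k => unifSum g L s t k ω) atTop (𝓝 I) :=
  h _ _ _ _ (tendsto_mesh (t - s + 1)) (isTaggedPartition_unifGrid hst)

variable {Ω : Type*} [MeasurableSpace Ω] {μ : Measure Ω} {d m : ℕ} {L : ℝ → Ω → (Fin m → ℝ)}

lemma measurable_mulVec {α m n : Type*} [MeasurableSpace α] [Fintype n] (M : Matrix m n ℂ)
    {f : α → n → ℂ} (hf : Measurable f) : Measurable fun a => M.mulVec (f a) :=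
  measurable_pi_iff.2 fun _ => Finset.measurable_fun_sum _ fun j _ =>
    (measurable_const.mul ((measurable_pi_apply j).comp hf))

lemma measurable_cvec {m : Type*} : Measurable (cvec : (m → ℝ) → m → ℂ) :=
  measurable_pi_iff.2 fun b => Complex.measurable_ofReal.comp (measurable_pi_apply b)

lemma measurable_stieltjesSum (hL : ∀ t, Measurable (L t)) (g : ℝ → Matrix (Fin d) (Fin m) ℂ)
    (n : ℕ) (τ ξ : ℕ → ℝ) : Measurable (stieltjesSum g L n τ ξ) := by
  rw [funext (stieltjesSum_eq L g n τ ξ)]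
  exact Finset.measurable_fun_sum _ fun i _ => measurable_mulVec _
    (measurable_cvec.comp ((hL _).sub (hL _)))

lemma aemeasurable_of_hasPathIntegral (hL : ∀ t, Measurable (L t))
    {g : ℝ → Matrix (Fin d) (Fin m) ℂ} {s t : ℝ} (hst : s ≤ t) {I : Ω → Fin d → ℂ}
    (h : ∀ᵐ ω ∂μ, HasPathIntegral (fun u => L u ω) g s t (I ω)) : AEMeasurable I μ :=
  aemeasurable_of_tendsto_metrizable_ae' (f := fun k => unifSum g L s t k)
    (fun _ => (measurable_stieltjesSum hL _ _ _ _).aemeasurable)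
    (h.mono fun _ hω => tendsto_unifSum hst hω)

/-- Pathwise integrals are integrals in probability. -/
lemma hasLevyIntegral_of_hasPathIntegral [IsFiniteMeasure μ] (hL : ∀ t, Measurable (L t))
    {g : ℝ → Matrix (Fin d) (Fin m) ℂ} {s t : ℝ} {I : Ω → Fin d → ℂ}
    (h : ∀ᵐ ω ∂μ, HasPathIntegral (fun u => L u ω) g s t (I ω)) : HasLevyIntegral μ L g s t I := by
  intro ε hε η hη
  -- Failure at every mesh size yields bad partitions with mesh tending to zero, along which
  -- pathwise convergence still implies convergence in probability.
  by_contra! hcon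
  choose n τ ξ hpart hbad using fun k : ℕ => hcon (1 / ((k : ℝ) + 1)) (by positivity)
  have hT : TendstoInMeasure μ (fun k => stieltjesSum g L (n k) (τ k) (ξ k)) atTop I := by
    refine tendstoInMeasure_of_tendsto_ae
      (fun k => (measurable_stieltjesSum hL _ _ _ _).aestronglyMeasurable) ?_
    filter_upwards [h] with ω hω
    exact hω _ _ _ _ (tendsto_mesh 1) hpart
  have h1 := tendstoInMeasure_iff_norm.1 hT ε hε
  have h2 := h1.eventually (gt_mem_nhds (ENNReal.ofReal_pos.2 hη))
  obtain ⟨k, hk⟩ := h2.exists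
  exact absurd hk (not_lt.2 (hbad k).le)

lemma HasLevyIntegral.tendstoInMeasure {g : ℝ → Matrix (Fin d) (Fin m) ℂ} {s t : ℝ} (hst : s ≤ t)
    {I : Ω → Fin d → ℂ} (h : HasLevyIntegral μ L g s t I) :
    TendstoInMeasure μ (unifSum g L s t) atTop I := by
  refine tendstoInMeasure_iff_norm.2 fun ε hε => ?_
  refine ENNReal.tendsto_nhds_zero.2 fun η hη => ?_
  obtain ⟨η', hη'0, hη'⟩ : ∃ η' > (0 : ℝ), ENNReal.ofReal η' ≤ η := by
    rcases eq_or_ne η ⊤ with rfl | htop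
    · exact ⟨1, one_pos, le_top⟩
    · exact ⟨η.toReal, ENNReal.toReal_pos hη.ne' htop, ENNReal.ofReal_toReal_le⟩
  obtain ⟨δ, hδ, h'⟩ := h ε hε η' hη'0
  filter_upwards [(tendsto_mesh (t - s + 1)).eventually (gt_mem_nhds hδ)] with k hk
  obtain ⟨h1, h2, h3⟩ := isTaggedPartition_unifGrid hst k
  exact (h' _ _ _ ⟨h1, h2, fun i hi =>
    ⟨(h3 i hi).1, (h3 i hi).2.1, (h3 i hi).2.2.trans hk⟩⟩).trans hη'

/-- Limits in probability are almost surely unique; this is used for the Riemann sums at each `s`,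
then for `s → -∞`. -/
lemma HasLevyIntegralFromBot.ae_eq {g : ℝ → Matrix (Fin d) (Fin m) ℂ} {t : ℝ}
    {I I' : Ω → Fin d → ℂ} (h : HasLevyIntegralFromBot μ L g t I)
    (h' : HasLevyIntegralFromBot μ L g t I') : I =ᵐ[μ] I' := by
  obtain ⟨J, hJ, hJI⟩ := h
  obtain ⟨J', hJ', hJI'⟩ := h'
  refine tendstoInMeasure_ae_unique (hJI.congr' ?_ EventuallyEq.rfl) hJI'
  filter_upwards [eventually_le_atBot t] with s hs
  exact tendstoInMeasure_ae_unique ((hJ s hs).tendstoInMeasure hs)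
    ((hJ' s hs).tendstoInMeasure hs)

lemma hasLevyIntegralFromBot_of_hasPathIntegral [IsFiniteMeasure μ] (hL : ∀ t, Measurable (L t))
    {g : ℝ → Matrix (Fin d) (Fin m) ℂ} {t : ℝ} {J : ℝ → Ω → Fin d → ℂ} {I : Ω → Fin d → ℂ}
    (hJ : ∀ᵐ ω ∂μ, ∀ s ≤ t, HasPathIntegral (fun u => L u ω) g s t (J s ω))
    (hI : ∀ᵐ ω ∂μ, Tendsto (fun s => J s ω) atBot (𝓝 (I ω))) :
    HasLevyIntegralFromBot μ L g t I := by
  have hJ' : ∀ s ≤ t, ∀ᵐ ω ∂μ, HasPathIntegral (fun u => L u ω) g s t (J s ω) :=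
    fun s hs => hJ.mono fun ω hω => hω s hs
  -- `J s` is controlled only for `s ≤ t`; capping at `t` makes the whole family measurable and
  -- leaves the limit at `-∞` alone.
  refine ⟨fun s => J (min s t), fun s hs => ?_, fun ε hε => ?_⟩
  · change HasLevyIntegral μ L g s t (J (min s t))
    rw [min_eq_left hs]
    exact hasLevyIntegral_of_hasPathIntegral hL (hJ' s hs)
  · refine tendsto_of_seq_tendsto fun u hu => ?_
    refine tendstoInMeasure_of_tendsto_ae (f := fun k => J (min (u k) t)) (fun k =>
      (aemeasurable_of_hasPathIntegral hL (min_le_right _ _)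
        (hJ' _ (min_le_right _ _))).aestronglyMeasurable) ?_ ε hε
    filter_upwards [hI] with ω hω
    refine (hω.comp hu).congr' ?_
    filter_upwards [hu.eventually (eventually_le_atBot t)] with k hk
    simp [min_eq_left hk]

lemma HasPathIntegral.sum {ι : Type*} (S : Finset ι) {x : ℝ → Fin m → ℝ}
    {g : ι → ℝ → Matrix (Fin d) (Fin m) ℂ} {s t : ℝ} {I : ι → Fin d → ℂ}
    (h : ∀ i ∈ S, HasPathIntegral x (g i) s t (I i)) :
    HasPathIntegral x (fun u => ∑ i ∈ S, g i u) s t (∑ i ∈ S, I i) := by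
  intro δ n τ ξ hδ hp
  simp_rw [Matrix.sum_mulVec]
  have := tendsto_finsetSum S fun i hi => h i hi δ n τ ξ hδ hp
  refine this.congr fun k => ?_
  rw [Finset.sum_comm]

end LevyIntegral

/-! ### Shift invariance of laws and its passage to limits. -/

section Stationarity

variable {Ω : Type*} [MeasurableSpace Ω] {μ : Measure Ω}

/-- Laws are determined by bounded continuous test functions, whose expectations pass to almost sure
limits by dominated convergence. -/
lemma identDistrib_of_tendsto [IsProbabilityMeasure μ] {E : Type*} [PseudoMetricSpace E]
    [MeasurableSpace E] [BorelSpace E] {f g : ℕ → Ω → E} {F G : Ω → E}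
    (h : ∀ n, IdentDistrib (f n) (g n) μ μ)
    (hf : ∀ᵐ ω ∂μ, Tendsto (fun n => f n ω) atTop (𝓝 (F ω)))
    (hg : ∀ᵐ ω ∂μ, Tendsto (fun n => g n ω) atTop (𝓝 (G ω))) : IdentDistrib F G μ μ := by
  have hF : AEMeasurable F μ :=
    aemeasurable_of_tendsto_metrizable_ae' (fun n => (h n).aemeasurable_fst) hf
  have hG : AEMeasurable G μ :=
    aemeasurable_of_tendsto_metrizable_ae' (fun n => (h n).aemeasurable_snd) hg
  refine ⟨hF, hG, ?_⟩
  have : IsProbabilityMeasure (μ.map F) := Measure.isProbabilityMeasure_map hF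
  have : IsProbabilityMeasure (μ.map G) := Measure.isProbabilityMeasure_map hG
  refine ext_of_forall_integral_eq_of_IsFiniteMeasure fun φ => ?_
  have key : ∀ {f : ℕ → Ω → E} {F : Ω → E}, (∀ n, AEMeasurable (f n) μ) → AEMeasurable F μ →
      (∀ᵐ ω ∂μ, Tendsto (fun n => f n ω) atTop (𝓝 (F ω))) →
      Tendsto (fun n => ∫ x, φ x ∂(μ.map (f n))) atTop (𝓝 (∫ x, φ x ∂(μ.map F))) := by
    intro f F hfm hFm hlim
    rw [integral_map hFm φ.continuous.measurable.aestronglyMeasurable]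
    simp_rw [fun n => integral_map (hfm n) φ.continuous.measurable.aestronglyMeasurable]
    refine tendsto_integral_of_dominated_convergence (fun _ => ‖φ‖)
      (fun n => (φ.continuous.measurable.comp_aemeasurable (hfm n)).aestronglyMeasurable)
      (integrable_const _) (fun n => .of_forall fun ω => φ.norm_coe_le_norm _) ?_
    exact hlim.mono fun ω hω => (φ.continuous.tendsto _).comp hω
  have h1 := key (fun n => (h n).aemeasurable_fst) hF hf
  have h2 := key (fun n => (h n).aemeasurable_snd) hG hg
  simp_rw [fun n => (h n).map_eq] at h1
  exact tendsto_nhds_unique h1 h2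

lemma exists_monotone_enumeration (S : Finset ℝ) :
    ∃ t : ℕ → ℝ, Monotone t ∧ ∀ x ∈ S, ∃ k, t k = x := by
  rcases S.eq_empty_or_nonempty with rfl | hS
  · exact ⟨fun _ => 0, monotone_const, by simp⟩
  have hc : 0 < S.card := hS.card_pos
  refine ⟨fun k => S.orderEmbOfFin rfl ⟨min k (S.card - 1), by omega⟩, fun i j hij => ?_,
    fun x hx => ?_⟩
  · refine (S.orderEmbOfFin rfl).monotone ?_
    rw [Fin.mk_le_mk]
    omega
  · have : x ∈ Set.range (S.orderEmbOfFin rfl) := by rwa [Finset.range_orderEmbOfFin]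
    obtain ⟨i, rfl⟩ := this
    exact ⟨i, congrArg (S.orderEmbOfFin rfl) (Fin.ext (by simp only; omega))⟩

/-- The joint law of finitely many increments of a Lévy process is invariant under time shifts. -/
lemma IsLevyProcess.identDistrib_increments [IsProbabilityMeasure μ] {m : ℕ}
    {L : ℝ → Ω → (Fin m → ℝ)} (hL : IsLevyProcess L μ)
    {ι : Type*} [Fintype ι] (u v : ι → ℝ) (h : ℝ) :
    IdentDistrib (fun ω i => L (u i + h) ω - L (v i + h) ω)
      (fun ω i => L (u i) ω - L (v i) ω) μ μ := by
  classical
  -- All times are placed on one monotone sequence. Its consecutive increments are independent with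
  -- shift-invariant laws, hence have a shift-invariant joint law, and the desired increments are
  -- differences of their partial sums.
  obtain ⟨t, ht, hS⟩ := exists_monotone_enumeration (Finset.univ.image u ∪ Finset.univ.image v)
  choose a ha using fun i => hS (u i) (by simp)
  choose b hb using fun i => hS (v i) (by simp)
  have hth : Monotone fun k => t k + h := ht.add_const h
  have hid := IdentDistrib.pi (fun k => hL.stationary_increments (t k) (t (k + 1)) h
    (ht (Nat.le_succ k))) (hL.indep_increments.nat hth) (hL.indep_increments.nat ht)
  let Φ : (ℕ → Fin m → ℝ) → ι → Fin m → ℝ := fun w i =>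
    ∑ j ∈ Finset.range (a i), w j - ∑ j ∈ Finset.range (b i), w j
  have hΦ : Measurable Φ := measurable_pi_iff.2 fun i =>
    (Finset.measurable_fun_sum _ fun j _ => measurable_pi_apply j).sub
      (Finset.measurable_fun_sum _ fun j _ => measurable_pi_apply j)
  have hsum : ∀ (y : ℕ → Fin m → ℝ) i, Φ (fun k => y (k + 1) - y k) i = y (a i) - y (b i) := by
    intro y i
    simp only [Φ]
    rw [Finset.sum_range_sub, Finset.sum_range_sub, sub_sub_sub_cancel_right]
  have := hid.comp hΦ
  convert this using 1
  · ext1 ω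
    ext1 i
    rw [Function.comp, hsum (fun k => L (t k + h) ω), ha, hb]
  · ext1 ω
    ext1 i
    rw [Function.comp, hsum (fun k => L (t k) ω), ha, hb]

end Stationarity

/-- Transfers joint stationarity of the Ornstein–Uhlenbeck family to each component, to their sum
and to the state process. -/
lemma IsStrictlyStationary.of_ae_eq {Ω E F : Type*} [MeasurableSpace Ω] {μ : Measure Ω}
    [MeasurableSpace E] [MeasurableSpace F] {Z : ℝ → Ω → E} (hZ : IsStrictlyStationary Z μ) {f : E → F} (hf : Measurable f)
    {W : ℝ → Ω → F} (hW : ∀ t, (fun ω => f (Z t ω)) =ᵐ[μ] W t) : IsStrictlyStationary W μ := by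
  intro n t h
  have hid := (hZ n t h).comp (u := fun (z : Fin n → E) i => f (z i))
    (measurable_pi_iff.2 fun i => hf.comp (measurable_pi_apply i))
  have hcongr : ∀ r : Fin n → ℝ, (fun ω i => f (Z (r i) ω)) =ᵐ[μ] fun ω i => W (r i) ω := by
    intro r
    filter_upwards [ae_all_iff.2 fun i => hW (r i)] with ω hω
    exact funext hω
  exact (IdentDistrib.of_ae_eq hid.aemeasurable_fst (hcongr fun i => t i + h)).symm.trans
    (hid.trans (IdentDistrib.of_ae_eq hid.aemeasurable_snd (hcongr t)))

/-! ### Ornstein–Uhlenbeck processes driven by the Lévy process. -/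

section OUProcess

variable {Ω : Type*} [MeasurableSpace Ω] {μ : Measure Ω} [IsProbabilityMeasure μ] {d m : ℕ}
  {L : ℝ → Ω → (Fin m → ℝ)}

/-- Almost surely, the paths of the Lévy process are regular enough for the Ornstein–Uhlenbeck
path to be defined. -/
lemma IsLevyProcess.ae_ouPath (hL : IsLevyProcess L μ)
    (hlog : Integrable (fun ω => Real.log (max 1 ‖L 1 ω‖)) μ)
    {R : Matrix (Fin d) (Fin d) ℂ} (hR : ∀ z ∈ spectrum ℂ R, z.re < 0)
    (N : Matrix (Fin d) (Fin m) ℂ) :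
    ∀ᵐ ω ∂μ, IsCadlag (fun u => L u ω) ∧
      (∀ t, IntegrableOn (ouDriver R N fun u => L u ω) (Set.Iic t)) ∧
      ∀ t, Tendsto (fun s => ouTrunc R N (fun u => L u ω) s t) atBot
        (𝓝 (ouPath R N (fun u => L u ω) t)) := by
  obtain ⟨c, hc, C, -, hC⟩ := exists_norm_exp_le hR
  filter_upwards [hL.cadlag, hL.ae_isBigO hlog (half_pos hc)] with ω h1 h2
  exact ⟨h1, fun t => integrableOn_ouDriver h1 hC (half_lt_self hc) h2 t,
    fun t => tendsto_ouTrunc h1 hC (half_lt_self hc) h2 t⟩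

/-- `κ = Unit` gives the single processes, `κ = Fin p` their superposition. -/
lemma IsLevyProcess.hasLevyIntegralFromBot_ouPath (hL : IsLevyProcess L μ)
    (hlog : Integrable (fun ω => Real.log (max 1 ‖L 1 ω‖)) μ) {κ : Type*} [Fintype κ]
    {R : κ → Matrix (Fin d) (Fin d) ℂ} (hR : ∀ k, ∀ z ∈ spectrum ℂ (R k), z.re < 0)
    (N : κ → Matrix (Fin d) (Fin m) ℂ) (t : ℝ) :
    HasLevyIntegralFromBot μ L (fun u => ∑ k, ouKernel (R k) (N k) t u) t
      (fun ω => ∑ k, ouPath (R k) (N k) (fun u => L u ω) t) := by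
  have h := ae_all_iff.2 fun k => hL.ae_ouPath hlog (hR k) (N k)
  refine hasLevyIntegralFromBot_of_hasPathIntegral hL.measurable
    (J := fun s ω => ∑ k, ouTrunc (R k) (N k) (fun u => L u ω) s t) ?_ ?_
  · filter_upwards [h] with ω hω s hs
    exact HasPathIntegral.sum _ fun k _ => hasPathIntegral_ouKernel (hω k).1 hs
  · filter_upwards [h] with ω hω
    exact tendsto_finsetSum _ fun k _ => (hω k).2.2 t

lemma unifGrid_add (s t h : ℝ) (k i : ℕ) :
    unifGrid (s + h) (t + h) k i = unifGrid s t k i + h := by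
  simp only [unifGrid, add_sub_add_right_eq_sub]
  ring

lemma ouKernel_add (R : Matrix (Fin d) (Fin d) ℂ) (N : Matrix (Fin d) (Fin m) ℂ) (t u h : ℝ) :
    ouKernel R N (t + h) (u + h) = ouKernel R N t u := by
  simp only [ouKernel, add_sub_add_right_eq_sub]

/-- The grid moves with time and the kernel depends on `t - u` only, so both sides are the same
function of finitely many increments of `L`, taken at shifted and unshifted times. -/
lemma IsLevyProcess.identDistrib_unifSum (hL : IsLevyProcess L μ) {κ : Type*} [Fintype κ]
    (R : κ → Matrix (Fin d) (Fin d) ℂ) (N : κ → Matrix (Fin d) (Fin m) ℂ) {n : ℕ}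
    (t : Fin n → ℝ) (h T : ℝ) (k : ℕ) :
    IdentDistrib
      (fun ω j l => unifSum (ouKernel (R l) (N l) (t j + h)) L (t j - T + h) (t j + h) k ω)
      (fun ω j l => unifSum (ouKernel (R l) (N l) (t j)) L (t j - T) (t j) k ω) μ μ := by
  let u : Fin n × Fin (k + 1) → ℝ := fun q => unifGrid (t q.1 - T) (t q.1) k (q.2 + 1)
  let v : Fin n × Fin (k + 1) → ℝ := fun q => unifGrid (t q.1 - T) (t q.1) k q.2
  let Ψ : (Fin n × Fin (k + 1) → Fin m → ℝ) → Fin n → κ → Fin d → ℂ := fun w j l =>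
    ∑ i, (ouKernel (R l) (N l) (t j) (v (j, i))).mulVec (cvec (w (j, i)))
  have hΨ : Measurable Ψ := by
    refine measurable_pi_iff.2 fun j => measurable_pi_iff.2 fun l =>
      Finset.measurable_fun_sum _ fun i _ => measurable_mulVec _ (measurable_cvec.comp ?_)
    exact measurable_pi_apply _
  convert (hL.identDistrib_increments u v h).comp hΨ using 1
  · ext1 ω
    ext1 j
    ext1 l
    rw [unifSum, stieltjesSum_eq, Finset.sum_range]
    simp only [unifGrid_add, ouKernel_add]
    rfl
  · ext1 ω
    ext1 j
    ext1 l
    rw [unifSum, stieltjesSum_eq, Finset.sum_range]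
    rfl

/-- Joint strict stationarity of Ornstein–Uhlenbeck processes with a common driving process. -/
lemma IsLevyProcess.isStrictlyStationary_ouPath (hL : IsLevyProcess L μ)
    (hlog : Integrable (fun ω => Real.log (max 1 ‖L 1 ω‖)) μ) {κ : Type*} [Fintype κ]
    {R : κ → Matrix (Fin d) (Fin d) ℂ} (hR : ∀ k, ∀ z ∈ spectrum ℂ (R k), z.re < 0)
    (N : κ → Matrix (Fin d) (Fin m) ℂ) :
    IsStrictlyStationary (fun t ω k => ouPath (R k) (N k) (fun u => L u ω) t) μ := by
  intro n t h
  have hae := ae_all_iff.2 fun k => hL.ae_ouPath hlog (hR k) (N k)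
  have hsum : ∀ ω, (∀ _ : κ, IsCadlag (fun u => L u ω)) → ∀ (r : Fin n → ℝ) (T : ℕ),
      Tendsto (fun k j l => unifSum (ouKernel (R l) (N l) (r j)) L (r j - T) (r j) k ω) atTop
        (𝓝 fun j l => ouTrunc (R l) (N l) (fun u => L u ω) (r j - T) (r j)) := by
    intro ω hω r T
    refine tendsto_pi_nhds.2 fun j => tendsto_pi_nhds.2 fun l => ?_
    have hle : r j - T ≤ r j := sub_le_self _ (Nat.cast_nonneg T)
    exact tendsto_unifSum hle (hasPathIntegral_ouKernel (hω l) hle)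
  have htrunc : ∀ ω, (∀ k t, Tendsto (fun s => ouTrunc (R k) (N k) (fun u => L u ω) s t) atBot
      (𝓝 (ouPath (R k) (N k) (fun u => L u ω) t))) → ∀ r : Fin n → ℝ,
      Tendsto (fun (T : ℕ) j l => ouTrunc (R l) (N l) (fun u => L u ω) (r j - T) (r j)) atTop
        (𝓝 fun j l => ouPath (R l) (N l) (fun u => L u ω) (r j)) := by
    intro ω hω r
    refine tendsto_pi_nhds.2 fun j => tendsto_pi_nhds.2 fun l => ?_
    refine (hω l (r j)).comp ?_
    exact tendsto_atBot_add_const_left _ _ (tendsto_neg_atTop_atBot.comp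
      tendsto_natCast_atTop_atTop)
  -- Two limits: Riemann sums to the integral over `[t j - T, t j]`, then `T → ∞`. A lower limit
  -- moving with `t j` keeps every stage shift-invariant.
  refine identDistrib_of_tendsto
    (f := fun T ω j l => ouTrunc (R l) (N l) (fun u => L u ω) (t j + h - (T : ℕ)) (t j + h))
    (g := fun T ω j l => ouTrunc (R l) (N l) (fun u => L u ω) (t j - (T : ℕ)) (t j))
    (fun T => ?_) ?_ ?_
  · refine identDistrib_of_tendsto (fun k => hL.identDistrib_unifSum R N t h T k) ?_ ?_
    · filter_upwards [hae] with ω hω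
      have := hsum ω (fun k => (hω k).1) (fun j => t j + h) T
      simp only [add_sub_right_comm] at this ⊢
      exact this
    · filter_upwards [hae] with ω hω
      exact hsum ω (fun k => (hω k).1) t T
  · filter_upwards [hae] with ω hω
    exact htrunc ω (fun k => (hω k).2.2) fun j => t j + h
  · filter_upwards [hae] with ω hω
    exact htrunc ω (fun k => (hω k).2.2) t

end OUProcess

/-! ### The state space representation. -/

section StateSpace

variable {d p : ℕ}

/-- The state vector with blocks `Re ∑ₖ Rₖʲ yₖ`. -/
noncomputable def blockState (R : Fin p → Matrix (Fin d) (Fin d) ℂ) :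
    (Fin p → Fin d → ℂ) →L[ℝ] (Fin p × Fin d → ℝ) :=
  LinearMap.toContinuousLinearMap
    { toFun := fun y x => (∑ k, (R k ^ (x.1 : ℕ)).mulVec (y k) x.2).re
      map_add' := fun y z => by
        ext x
        simp [Matrix.mulVec_add, Finset.sum_add_distrib]
      map_smul' := fun c y => by
        ext x
        simp [Matrix.mulVec_smul, Finset.mul_sum] }

lemma blockState_apply (R : Fin p → Matrix (Fin d) (Fin d) ℂ) (y : Fin p → Fin d → ℂ)
    (x : Fin p × Fin d) :
    blockState R y x = (∑ k, (R k ^ (x.1 : ℕ)).mulVec (y k) x.2).re := rfl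

lemma stateC_mulVec_blockState (hp : 0 < p) (R : Fin p → Matrix (Fin d) (Fin d) ℂ)
    (y : Fin p → Fin d → ℂ) (a : Fin d) :
    (stateC d p).mulVec (blockState R y) a = (∑ k, y k a).re := by
  rw [Matrix.mulVec, dotProduct, Finset.sum_eq_single (⟨0, hp⟩, a)]
  · simp [stateC, blockState_apply]
  · rintro ⟨l, b⟩ - hne
    have : ¬((l : ℕ) = 0 ∧ a = b) := by
      rintro ⟨h1, rfl⟩
      exact hne (by rw [Prod.mk.injEq]; exact ⟨Fin.ext h1, rfl⟩)
    simp [stateC, this]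
  · simp

lemma sum_pow_mulVec_eq {A : ℕ → Matrix (Fin d) (Fin d) ℝ}
    {R : Fin p → Matrix (Fin d) (Fin d) ℂ} (hR : ∀ k, IsRightSolvent p A (R k))
    (y : Fin p → Fin d → ℂ) :
    ∑ k, (R k ^ p).mulVec (y k) =
      -∑ l : Fin p, (toComplex (A (p - l))).mulVec (∑ k, (R k ^ (l : ℕ)).mulVec (y k)) := by
  have h : ∀ k, R k ^ p = -∑ l : Fin p, toComplex (A (p - l)) * R k ^ (l : ℕ) := by
    intro k
    have h1 := hR k
    rw [IsRightSolvent] at h1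
    rw [eq_neg_of_add_eq_zero_left h1,
      ← Finset.sum_range fun l => toComplex (A (p - l)) * R k ^ l]
    congr 1
    refine Finset.sum_nbij' (fun i => p - i) (fun i => p - i) ?_ ?_ ?_ ?_ ?_ <;>
      simp only [Finset.mem_Icc, Finset.mem_range]
    · intro i hi; omega
    · intro i hi; omega
    · intro i hi; omega
    · intro i hi; omega
    · intro i hi
      rw [Nat.sub_sub_self hi.2]
  simp_rw [h, Matrix.neg_mulVec, Matrix.sum_mulVec, ← Matrix.mulVec_mulVec]
  rw [Finset.sum_neg_distrib, Finset.sum_comm]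
  simp_rw [Matrix.mulVec_sum]

lemma re_toComplex_mulVec {l n : Type*} [Fintype n] (M : Matrix l n ℝ) (z : n → ℂ) (a : l) :
    ((toComplex M).mulVec z a).re = M.mulVec (fun b => (z b).re) a := by
  simp [Matrix.mulVec, dotProduct, toComplex]

/-- The companion matrix replaces block `∑ R_k^j y_k` by block `∑ R_k^{j+1} y_k`; in the last row
this is the solvent equation. Real parts cause no trouble because the `A i` are real. -/
lemma stateA_mulVec_blockState {A : ℕ → Matrix (Fin d) (Fin d) ℝ}
    {R : Fin p → Matrix (Fin d) (Fin d) ℂ} (hR : ∀ k, IsRightSolvent p A (R k))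
    (y : Fin p → Fin d → ℂ) :
    (stateA p A).mulVec (blockState R y) = blockState R fun k => (R k).mulVec (y k) := by
  ext ⟨j, a⟩
  rw [blockState_apply]
  simp_rw [Matrix.mulVec_mulVec, ← pow_succ]
  by_cases hj : (j : ℕ) + 1 = p
  · have h := congrFun (sum_pow_mulVec_eq hR y) a
    rw [Finset.sum_apply] at h
    simp only [hj]
    rw [h, Pi.neg_apply, Finset.sum_apply, Complex.neg_re, Complex.re_sum]
    simp_rw [re_toComplex_mulVec]
    rw [Matrix.mulVec, dotProduct, Fintype.sum_prod_type, ← Finset.sum_neg_distrib]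
    refine Finset.sum_congr rfl fun l _ => ?_
    rw [Matrix.mulVec, dotProduct, ← Finset.sum_neg_distrib]
    refine Finset.sum_congr rfl fun b _ => ?_
    simp [stateA, hj, blockState_apply]
  · have hj' : (j : ℕ) + 1 < p := by omega
    rw [Matrix.mulVec, dotProduct, Finset.sum_eq_single (⟨j + 1, hj'⟩, a)]
    · simp [stateA, hj, blockState_apply]
    · rintro ⟨l, b⟩ - hne
      have : ¬((l : ℕ) = j + 1 ∧ a = b) := by
        rintro ⟨h1, rfl⟩
        exact hne (by rw [Prod.mk.injEq]; exact ⟨Fin.ext h1, rfl⟩)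
      simp [stateA, hj, this]
    · simp

lemma blockState_mulVec_cvec {m q : ℕ} {A : ℕ → Matrix (Fin d) (Fin d) ℝ}
    {B : ℕ → Matrix (Fin d) (Fin m) ℝ} {R : Fin p → Matrix (Fin d) (Fin d) ℂ}
    {N : Fin p → Matrix (Fin d) (Fin m) ℂ}
    (hN : ∀ b < p, ∑ k, R k ^ b * N k = complexBeta p q A B (b + 1)) (v : Fin m → ℝ) :
    blockState R (fun k => (N k).mulVec (cvec v)) = (stateB p q A B).mulVec v := by
  ext ⟨j, a⟩
  rw [blockState_apply]
  simp_rw [Matrix.mulVec_mulVec]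
  rw [← Finset.sum_apply, ← Matrix.sum_mulVec, hN j j.2, complexBeta, re_toComplex_mulVec]
  simp [cvec, stateB, Matrix.mulVec, dotProduct]

/-- The state space equation along a path. -/
lemma blockState_ouPath_eq {m q : ℕ} {A : ℕ → Matrix (Fin d) (Fin d) ℝ}
    {B : ℕ → Matrix (Fin d) (Fin m) ℝ} {R : Fin p → Matrix (Fin d) (Fin d) ℂ}
    (hR : ∀ k, IsRightSolvent p A (R k)) {N : Fin p → Matrix (Fin d) (Fin m) ℂ}
    (hN : ∀ b < p, ∑ k, R k ^ b * N k = complexBeta p q A B (b + 1))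
    {x : ℝ → Fin m → ℝ} (hx : IsCadlag x)
    (hint : ∀ k t, IntegrableOn (ouDriver (R k) (N k) x) (Set.Iic t)) {s t : ℝ} (hst : s ≤ t) :
    blockState R (fun k => ouPath (R k) (N k) x t) =
      blockState R (fun k => ouPath (R k) (N k) x s) +
      (∫ u in s..t, (stateA p A).mulVec (blockState R fun k => ouPath (R k) (N k) x u)) +
      (stateB p q A B).mulVec (x t - x s) := by
  have hcad : IsCadlag fun u k => ouPath (R k) (N k) x u :=
    isCadlag_pi fun k => isCadlag_ouPath hx (hint k)
  set I : Fin p → Fin d → ℂ := ∫ u in s..t, fun k => ouPath (R k) (N k) x u with hI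
  have hIk : ∀ k, I k = ∫ u in s..t, ouPath (R k) (N k) x u := fun k =>
    ((ContinuousLinearMap.proj (R := ℝ) (φ := fun _ : Fin p => Fin d → ℂ) k).intervalIntegral_comp_comm
      (hcad.intervalIntegrable s t)).symm
  have h1 : ∫ u in s..t, (stateA p A).mulVec (blockState R fun k => ouPath (R k) (N k) x u) =
      (stateA p A).mulVec (blockState R I) :=
    ((LinearMap.toContinuousLinearMap (stateA p A).mulVecLin).comp
      (blockState R)).intervalIntegral_comp_comm (hcad.intervalIntegrable s t)
  rw [h1, stateA_mulVec_blockState hR, ← blockState_mulVec_cvec hN, ← map_add, ← map_add]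
  congr 1
  ext1 k
  rw [ouPath_eq hx (hint k) hst, ← hIk, cvec_sub]
  rfl

/-- The superposition of the Ornstein–Uhlenbeck paths is real. -/
lemma im_sum_ouPath_eq_zero {m q : ℕ} {A : ℕ → Matrix (Fin d) (Fin d) ℝ}
    {B : ℕ → Matrix (Fin d) (Fin m) ℝ} {R : Fin p → Matrix (Fin d) (Fin d) ℂ}
    (hR : ∀ k, IsRightSolvent p A (R k)) {N : Fin p → Matrix (Fin d) (Fin m) ℂ}
    (hN : ∀ b < p, ∑ k, R k ^ b * N k = complexBeta p q A B (b + 1))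
    {x : ℝ → Fin m → ℝ} (hx : IsCadlag x) {t : ℝ}
    (hlim : ∀ k, Tendsto (fun s => ouTrunc (R k) (N k) x s t) atBot
      (𝓝 (ouPath (R k) (N k) x t))) (a : Fin d) :
    ((∑ k, ouPath (R k) (N k) x t) a).im = 0 := by
  have hcl : IsClosed {y : Fin d → ℂ | (y a).im = 0} :=
    isClosed_eq (Complex.continuous_im.comp (continuous_apply a)) continuous_const
  refine hcl.mem_of_tendsto (tendsto_finsetSum Finset.univ fun k _ => hlim k) ?_
  filter_upwards [eventually_le_atBot t] with s hs
  have hpath : HasPathIntegral x (fun u => ∑ k, ouKernel (R k) (N k) t u) s t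
      (∑ k, ouTrunc (R k) (N k) x s t) :=
    HasPathIntegral.sum _ fun k _ => hasPathIntegral_ouKernel hx hs
  -- A one-point space makes the path a process, and its Riemann sums are real because the summed
  -- kernel is.
  refine hcl.mem_of_tendsto (tendsto_unifSum (L := fun u (_ : Unit) => x u) (ω := ()) hs hpath)
    (Eventually.of_forall fun k => ?_)
  change (unifSum _ _ s t k () a).im = 0
  rw [unifSum, stieltjesSum_eq, Finset.sum_apply, Complex.im_sum]
  refine Finset.sum_eq_zero fun i _ => ?_
  rw [Matrix.mulVec, dotProduct, Complex.im_sum]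
  refine Finset.sum_eq_zero fun b _ => ?_
  rw [Complex.mul_im, im_sum_ouKernel_eq_zero hR hN]
  simp [cvec]

end StateSpace

/-! ### Càdlàg versions and the main theorem. -/

lemma HasLevyIntegralFromBot.congr_ae {Ω : Type*} [MeasurableSpace Ω] {μ : Measure Ω} {d m : ℕ}
    {L : ℝ → Ω → (Fin m → ℝ)} {g : ℝ → Matrix (Fin d) (Fin m) ℂ} {t : ℝ}
    {I I' : Ω → Fin d → ℂ} (h : HasLevyIntegralFromBot μ L g t I) (hI : I =ᵐ[μ] I') :
    HasLevyIntegralFromBot μ L g t I' := by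
  obtain ⟨J, hJ, hJI⟩ := h
  exact ⟨J, hJ, hJI.congr_right hI⟩

/-- Càdlàg versions of the Ornstein–Uhlenbeck processes agree with the pathwise ones. -/
lemma IsLevyProcess.ae_eq_ouPath {Ω : Type*} [MeasurableSpace Ω] {μ : Measure Ω}
    [IsProbabilityMeasure μ] {d m : ℕ} {L : ℝ → Ω → (Fin m → ℝ)} (hL : IsLevyProcess L μ)
    (hlog : Integrable (fun ω => Real.log (max 1 ‖L 1 ω‖)) μ)
    {R : Matrix (Fin d) (Fin d) ℂ} (hR : ∀ z ∈ spectrum ℂ R, z.re < 0)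
    (N : Matrix (Fin d) (Fin m) ℂ) {Z : ℝ → Ω → Fin d → ℂ}
    (hZ : ∀ t, HasLevyIntegralFromBot μ L (ouKernel R N t) t (Z t))
    (hcad : ∀ᵐ ω ∂μ, IsCadlag fun t => Z t ω) :
    ∀ᵐ ω ∂μ, ∀ t, Z t ω = ouPath R N (fun u => L u ω) t := by
  -- Agreement at rational times involves countably many null sets; right-continuity extends it to
  -- all times at once.
  have hrat : ∀ r : ℚ, ∀ᵐ ω ∂μ, Z r ω = ouPath R N (fun u => L u ω) r := fun r =>
    (hZ r).ae_eq <| by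
      simpa using hL.hasLevyIntegralFromBot_ouPath hlog (κ := Unit) (R := fun _ => R)
        (fun _ => hR) (fun _ => N) r
  filter_upwards [ae_all_iff.2 hrat, hcad, hL.ae_ouPath hlog hR N] with ω h1 h2 h3
  exact h2.eq_of_eq_rat (isCadlag_ouPath h3.1 h3.2.1) h1

end MCARMA

theorem mainTheorem3 {Ω : Type*} [MeasurableSpace Ω] (μ : Measure Ω) [IsProbabilityMeasure μ]
    (d m p q : ℕ) (hqp : q < p)
    (A : ℕ → Matrix (Fin d) (Fin d) ℝ) (B : ℕ → Matrix (Fin d) (Fin m) ℝ)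
    (hAB : MCARMA.LeftCoprime (MCARMA.arPoly p A) (MCARMA.maPoly q B))
    (R : Fin p → Matrix (Fin d) (Fin d) ℂ)
    (hR : MCARMA.IsCompleteRegularSolvents p A R)
    (Γ : Fin p → ℝ → ℂ) (hΓ : ∀ k, MCARMA.IsResidueContour p A (R k) (Γ k))
    (res : Fin p → Matrix (Fin d) (Fin m) ℂ)
    (hres : ∀ k, res k = MCARMA.contourResidue (Γ k) (MCARMA.transferFun p q A B))
    (L : ℝ → Ω → (Fin m → ℝ)) (hL : MCARMA.IsLevyProcess L μ)
    (hstable : ∀ z ∈ MCARMA.polySpectrum (MCARMA.arPoly p A), z.re < 0)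
    (hlog : Integrable (fun ω => Real.log (max 1 ‖L 1 ω‖)) μ) :
    (∃ Yk : Fin p → ℝ → Ω → (Fin d → ℂ),
      (∀ k t, MCARMA.HasLevyIntegralFromBot μ L (MCARMA.ouKernel (R k) (res k) t) t (Yk k t)) ∧
      (∀ k, ∀ᵐ ω ∂μ, MCARMA.IsCadlag (fun t => Yk k t ω))) ∧
    (∀ Yk : Fin p → ℝ → Ω → (Fin d → ℂ),
      (∀ k t, MCARMA.HasLevyIntegralFromBot μ L (MCARMA.ouKernel (R k) (res k) t) t (Yk k t)) →
      (∀ k, ∀ᵐ ω ∂μ, MCARMA.IsCadlag (fun t => Yk k t ω)) →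
      (∀ k, MCARMA.IsStrictlyStationary (Yk k) μ) ∧
      ∃ Y : ℝ → Ω → (Fin d → ℝ),
        (∀ᵐ ω ∂μ, ∀ t, (fun a => ((Y t ω a : ℝ) : ℂ)) = ∑ k, Yk k t ω) ∧
        (∀ t, MCARMA.HasLevyIntegralFromBot μ L
          (fun u => ∑ k, MCARMA.ouKernel (R k) (res k) t u) t
          (fun ω a => ((Y t ω a : ℝ) : ℂ))) ∧
        MCARMA.IsStrictlyStationary Y μ ∧
        (∃ X : ℝ → Ω → (Fin p × Fin d → ℝ), MCARMA.IsStrictlyStationary X μ ∧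
          MCARMA.IsStateSpaceSolution μ p q A B L X Y) ∧
        MCARMA.IsMCARMA μ p q A B L Y) := by
  have hspec : ∀ k, ∀ z ∈ spectrum ℂ (R k), z.re < 0 := fun k z hz =>
    hstable z (hR.2 ▸ Set.mem_iUnion.2 ⟨k, hz⟩)
  have hsolv : ∀ k, MCARMA.IsRightSolvent p A (R k) := fun k => (hR.1 k).1
  have hN : ∀ b < p, ∑ k, R k ^ b * res k = MCARMA.complexBeta p q A B (b + 1) := by
    intro b hb
    simp_rw [hres]
    exact MCARMA.sum_pow_mul_contourResidue hqp hR hΓ b hb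
  have hpath := ae_all_iff.2 fun k => hL.ae_ouPath hlog (hspec k) (res k)
  refine ⟨⟨fun k t ω => MCARMA.ouPath (R k) (res k) (fun u => L u ω) t, fun k t => ?_,
    fun k => ?_⟩, fun Yk hYk hcad => ?_⟩
  · simpa using hL.hasLevyIntegralFromBot_ouPath hlog (κ := Unit) (R := fun _ => R k)
      (fun _ => hspec k) (fun _ => res k) t
  · filter_upwards [hpath] with ω hω
    exact MCARMA.isCadlag_ouPath (hω k).1 (hω k).2.1
  have heq : ∀ᵐ ω ∂μ, ∀ k t, Yk k t ω = MCARMA.ouPath (R k) (res k) (fun u => L u ω) t :=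
    ae_all_iff.2 fun k => hL.ae_eq_ouPath hlog (hspec k) (res k) (hYk k) (hcad k)
  have hstat := hL.isStrictlyStationary_ouPath hlog hspec res
  have hreal : ∀ᵐ ω ∂μ, ∀ t,
      (fun a => (((∑ k, Yk k t ω a).re : ℝ) : ℂ)) = ∑ k, Yk k t ω := by
    filter_upwards [hpath, heq] with ω h1 h2 t
    ext1 a
    -- `q < p` provides an index `0`, from which the càdlàg property of the driving path is read
    -- off.
    have him := MCARMA.im_sum_ouPath_eq_zero hsolv hN (h1 ⟨0, by omega⟩).1
      (fun k => (h1 k).2.2 t) a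
    simp_rw [← h2] at him
    rw [Finset.sum_apply] at him ⊢
    exact Complex.ext rfl him.symm
  have hX : MCARMA.IsStrictlyStationary
      (fun t ω => MCARMA.blockState R fun k => Yk k t ω) μ := by
    refine hstat.of_ae_eq (MCARMA.blockState R).continuous.measurable fun t => ?_
    filter_upwards [heq] with ω hω
    simp_rw [hω]
  have hsol : MCARMA.IsStateSpaceSolution μ p q A B L
      (fun t ω => MCARMA.blockState R fun k => Yk k t ω) fun t ω a => (∑ k, Yk k t ω a).re := by
    refine ⟨fun t => ?_, ?_, ?_, Eventually.of_forall fun ω t => ?_⟩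
    -- Identical distribution includes measurability; one time point and shift `0` suffice.
    · have h := (hX 1 (fun _ => t) 0).aemeasurable_snd
      exact (measurable_pi_apply (0 : Fin 1)).comp_aemeasurable h
    · filter_upwards [ae_all_iff.2 hcad] with ω hω
      exact (MCARMA.isCadlag_pi hω).comp (MCARMA.blockState R).continuous
    · filter_upwards [hpath, heq] with ω h1 h2 s t hst
      simp_rw [h2]
      exact MCARMA.blockState_ouPath_eq hsolv hN (h1 ⟨0, by omega⟩).1 (fun k => (h1 k).2.1) hst
    · ext1 a
      exact (MCARMA.stateC_mulVec_blockState (by omega) R _ a).symm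
  refine ⟨fun k => ?_, fun t ω a => (∑ k, Yk k t ω a).re, hreal, fun t => ?_, ?_,
    ⟨_, hX, hsol⟩, ⟨_, hsol⟩⟩
  · refine hstat.of_ae_eq (measurable_pi_apply k) fun t => ?_
    filter_upwards [heq] with ω hω
    exact (hω k t).symm
  · refine (hL.hasLevyIntegralFromBot_ouPath hlog hspec res t).congr_ae ?_
    filter_upwards [hreal, heq] with ω h1 h2
    simp_rw [h1 t, h2]
  · have hf : Continuous fun (y : Fin p → Fin d → ℂ) a => (∑ k, y k a).re := by fun_prop
    refine hstat.of_ae_eq hf.measurable fun t => ?_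
    filter_upwards [heq] with ω hω
    simp_rw [hω]
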